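/- **Setting.** A stochastic shortest path (SSP) problem has a state space $S$ (a measurable space; the discrete case is the one where all subsets are measurable), a goal $g\notin S$, $S_+=S\cup\{g\}$, a finite action set $A$, an initial state $s_{\rm init}\in S$, measurable costs $c:S\times A\to[c_{\min},1]$ with $c_{\min}>0$, and transition probabilities $P_{s,a}$ on $S_+$. A stationary policy $\pi:S\to A$ is proper if it reaches $g$ with probability $1$ from every state; $V^\pi(s)$ is its expected total cost until $g$ is reached, $V^\star(s)=\inf_{\pi\text{ proper}}V^\pi(s)$ and $B_\star=\sup_sV^\star(s)$. Assume that a proper policy exists and $1<B_\star<\infty$. The SSP is linear with features $\phi:S\times A\to\mathbb R^d$, $d\ge2$: $\phi$ is measurable, $\|\phi(s,a)\|_2\le1$, and there are $\theta^\star\in\mathbb R^d$ with $\|\theta^\star\|_2\le\sqrt d$ and an $\mathbb R^d$-valued measure $\mu$ on $S_+$ with $c(s,a)=\phi(s,a)^\top\theta^\star$, $P_{s,a}(E)=\phi(s,a)^\top\mu(E)$ for all measurable $E$ and $\|\int h\,d\mu\|_2\le\sqrt d\,\|h\|_\infty$ for all bounded measurable $h$. The learner plays $K\ge2$ episodes,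 each starting in $s_{\rm init}$ and ending at $g$. At step $t=1,2,\dots$ (counted through all episodes) it is in $s_t$, plays $a_t$, pays $c_t=c(s_t,a_t)$ and observes $s'_t\sim P_{s_t,a_t}$; $s_{t+1}=s'_t$ unless $s'_t=g$, when $s_{t+1}=s_{\rm init}$. If $T$ is the number of steps in the $K$ episodes, the regret is $R_K=\sum_{t=1}^Tc_t-K\,V^\star(s_{\rm init})$, and $R_K=\infty$ if $T=\infty$. **Algorithm.** Let $\delta\in(0,1)$, $\epsilon=\frac{c_{\min}}{150d^3K}$, $\phi_i=\phi(s_i,a_i)$, $[x]_{[l,r]}=\min\{\max\{x,l\},r\}$, $\mathrm{clip}_j(x)=[x]_{[-2^j,2^j]}$, $\mathcal J_B=\{j\in\mathbb Z:\lceil\log_2\epsilon\rceil\le j\le\lceil\log_2(6\sqrt dB)\rceil\}$, $\iota_{B,t}=2^{11}d\ln\frac{48dBt}{\epsilon\delta}$, $\mathbb B(R)=\{x\in\mathbb R^d:\|x\|_2\le R\}$ and $\mathcal G_\xi(R)=(\xi\mathbb Z)^d\cap\mathbb B(R)$. Put $V_{w,B}(s)=\min_a[\phi(s,a)^\top w]_{[0,2B]}$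 for $s\in S$, $V_{w,B}(g)=0$, and $\epsilon^i_V(w')=\phi_i^\top w'-c_i-V(s'_i)$. The confidence set $\Omega_t(w,B)$ consists of all $w'\in\mathbb B(3\sqrt dB)$ such that for all $j\in\mathcal J_B$ and $\nu\in\mathcal G_{\epsilon/t}(6\sqrt dB)$ $$\Big|\sum_{i<t}\mathrm{clip}_j(\phi_i^\top\nu)\,\epsilon^i_{V_{w,B}}(w')\Big|\le\sqrt{\sum_{i<t}\mathrm{clip}_j^2(\phi_i^\top\nu)\,\epsilon^i_{V_{w,B}}(w')^2\,\iota_{B,t}}+B\,2^j\iota_{B,t}.$$ Let $\Phi^j_t(\nu)=\sum_{i<t}\mathrm{clip}_j(\phi_i^\top\nu)\,\phi_i^\top\nu+2^j\|\nu\|_2^2$. The algorithm keeps parameters $w_t\in\mathbb R^d$, $B_t>0$ and plays $a_t\in\arg\min_a\phi(s_t,a)^\top w_t$. At $t=1$, starting from $B=1$, and at each $t>1$ at which one of the following holds, where $t'$ is the time of the latest recomputation and $B=B_{t-1}$, it recomputes $(w_t,B_t)$: - $s'_{t-1}=g$; - (overestimate condition) $V_{w_{t-1},B_{t-1}}(s'_{t-1})=2B_{t-1}$;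 - (lazy update condition) $\Phi^j_t(\nu)>8d^2\,\Phi^j_{t'}(\nu)$ for some $j\in\mathcal J_{B_{t-1}}$ and $\nu\in\mathcal G_{\epsilon/t}(6\sqrt dB_{t-1})$. Otherwise $(w_t,B_t)=(w_{t-1},B_{t-1})$. To recompute, it minimizes $V_{w,B}(s_t)$ over all $w$ with $w\in\Omega_t(w,B)$; while the minimum exceeds $B$, it doubles $B$ and minimizes again; then $w_t$ is a minimizer and $B_t=B$. Ties are broken arbitrarily, possibly at random, on the basis of the past only; if the recomputation has no result (infeasible problem), the parameters may be chosen arbitrarily. **Theorem.** There are absolute constants $C>0$ and $p\in\mathbb N$ such that for every linear SSP as above, all $K\ge2$ and all $\delta\in(0,1)$, this algorithm satisfies with probability at least $1-\delta$ $$R_K\le C\,\Big(\ln\frac{d\,B_\star K}{c_{\min}\,\delta}\Big)^{p}\Big(d^{3.5}B_\star\sqrt K+d^7B_\star^2\Big).$$ In particular the bound is horizon-free: it does not depend on the hitting time $T_\star$ of the optimal policy, and depends only logarithmically on $1/c_{\min}$. -/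

import Mathlib

open MeasureTheory ProbabilityTheory Filter Topology
open scoped ENNReal

universe u v w

noncomputable section

namespace LinearSSP

/-! ### Stochastic shortest path problems

`Option S` is the state space together with the goal state `g = none`; a set of `Option S` is
measurable iff its trace on `S` is. The discrete setting is the case where every subset of `S` is
measurable. -/

instance instMeasurableSpaceOption {S : Type u} [MeasurableSpace S] :
    MeasurableSpace (Option S) :=
  MeasurableSpace.map Option.some inferInstance

/-- An SSP instance: initial state, costs with values in `[cmin, 1]`, and transition
probabilities from `S × A` to `S ∪ {g}`. -/
structure SSP (S : Type u) (A : Type v) [MeasurableSpace S] [MeasurableSpace A] where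
  init : S
  cmin : ℝ
  cost : S → A → ℝ
  trans : Kernel (S × A) (Option S)
  isMarkov : IsMarkovKernel trans
  measurable_cost : Measurable fun q : S × A => cost q.1 q.2
  cmin_nonneg : 0 ≤ cmin
  cmin_le_cost : ∀ s a, cmin ≤ cost s a
  cost_le_one : ∀ s a, cost s a ≤ 1

section Policies

variable {S : Type u} {A : Type v} [MeasurableSpace S] [MeasurableSpace A]

/-- Expected total cost of the first `n` steps (stopping at the goal) of the stationary policy `π`
started in state `s`. -/
def SSP.costUpTo (M : SSP S A) (π : S → A) : ℕ → S → ℝ≥0∞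
  | 0, _ => 0
  | n + 1, s => ENNReal.ofReal (M.cost s (π s)) +
      ∫⁻ x, Option.elim x 0 (M.costUpTo π n) ∂(M.trans (s, π s))

/-- The value function `V^π(s)`: expected total cost of `π` until the goal is reached. -/
def SSP.value (M : SSP S A) (π : S → A) (s : S) : ℝ≥0∞ := ⨆ n, M.costUpTo π n s

/-- Probability that `π`, started in state `s`, has not reached the goal after `n` steps. -/
def SSP.notReached (M : SSP S A) (π : S → A) : ℕ → S → ℝ≥0∞
  | 0, _ => 1
  | n + 1, s => ∫⁻ x, Option.elim x 0 (M.notReached π n) ∂(M.trans (s, π s))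

/-- A policy is proper if from every state it reaches the goal with probability one. -/
def SSP.IsProper (M : SSP S A) (π : S → A) : Prop :=
  Measurable π ∧ ∀ s, Tendsto (fun n => M.notReached π n s) atTop (𝓝 0)

/-- `V⋆(s)`, the best value of a proper policy. -/
def SSP.Vstar (M : SSP S A) (s : S) : ℝ≥0∞ :=
  ⨅ (π : S → A) (_ : M.IsProper π), M.value π s

/-- `B⋆`, the largest value of `V⋆`. -/
def SSP.Bstar (M : SSP S A) : ℝ≥0∞ := ⨆ s, M.Vstar s

/-- Linear SSP with features `φ`: costs and transitions are linear in `φ`, with the usual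
normalisation. The quantifier over bounds `b` of `|h|` expresses
`‖∫ h dμ‖ ≤ √d ‖h‖_∞`. -/
structure SSP.IsLinear (M : SSP S A) {d : ℕ} (φ : S → A → EuclideanSpace ℝ (Fin d)) : Prop where
  measurable_feature : Measurable fun q : S × A => φ q.1 q.2
  norm_feature_le : ∀ s a, ‖φ s a‖ ≤ 1
  exists_param : ∃ (θ : EuclideanSpace ℝ (Fin d))
      (μ : VectorMeasure (Option S) (EuclideanSpace ℝ (Fin d))),
    ‖θ‖ ≤ √d ∧
    (∀ s a, M.cost s a = inner ℝ (φ s a) θ) ∧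
    (∀ s a (E : Set (Option S)), MeasurableSet E →
      (M.trans (s, a)).real E = inner ℝ (φ s a) (μ E)) ∧
    (∀ (h : Option S → ℝ) (b : ℝ), Measurable h → (∀ x, |h x| ≤ b) →
      ‖∫ᵛ x, h x ∂•μ‖ ≤ √d * b)

end Policies

/-! ### The algorithm

Time is indexed from `0`, so index `n` stands for the time step `t = n + 1`, before which `n`
transitions have been observed. -/

/-- What the learner sees: states `s_t`, actions `a_t`, incurred costs `c_t`, and successor
states `s'_t`. Quantities of the algorithm at index `n` use only entries before `n`
and the current state. -/
structure Trajectory (S : Type u) (A : Type v) where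
  state : ℕ → S
  action : ℕ → A
  cost : ℕ → ℝ
  next : ℕ → Option S

/-- `clip_j(x)`, the projection of `x` onto `[-2^j, 2^j]`. -/
def clip (j : ℤ) (x : ℝ) : ℝ := min (max x (-(2 : ℝ) ^ j)) ((2 : ℝ) ^ j)

/-- The points of `(ξℤ)^d` in the closed Euclidean ball of radius `R`. -/
def grid (d : ℕ) (ξ R : ℝ) : Set (EuclideanSpace ℝ (Fin d)) :=
  {ν | ‖ν‖ ≤ R ∧ ∀ i, ∃ m : ℤ, ν i = m * ξ}

/-- The set `𝒥_B` of clipping levels. -/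
def levels (d : ℕ) (ε B : ℝ) : Set ℤ :=
  Set.Icc ⌈Real.logb 2 ε⌉ ⌈Real.logb 2 (6 * √d * B)⌉

/-- The logarithmic factor `ι_{B,t}`. -/
def iota (d : ℕ) (ε δ B t : ℝ) : ℝ := 2 ^ 11 * d * Real.log (48 * d * B * t / (ε * δ))

section Algorithm

variable {S : Type u} {A : Type v} {d : ℕ}

/-- `V_{w,B}(s) = min_a [φ(s,a)ᵀ w]_{[0,2B]}` and `V_{w,B}(g) = 0`. -/
def optValue (φ : S → A → EuclideanSpace ℝ (Fin d)) (w : EuclideanSpace ℝ (Fin d)) (B : ℝ) :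
    Option S → ℝ
  | none => 0
  | some s => ⨅ a, min (max (inner ℝ (φ s a) w) 0) (2 * B)

variable (φ : S → A → EuclideanSpace ℝ (Fin d))

/-- The feature `φ_i = φ(s_i, a_i)`. -/
def Trajectory.feat (x : Trajectory S A) (i : ℕ) : EuclideanSpace ℝ (Fin d) :=
  φ (x.state i) (x.action i)

/-- The residual `ε^i_V(w') = φ_iᵀ w' - c_i - V(s'_i)`. -/
def Trajectory.resid (x : Trajectory S A) (V : Option S → ℝ)
    (w' : EuclideanSpace ℝ (Fin d)) (i : ℕ) : ℝ :=
  inner ℝ (x.feat φ i) w' - x.cost i - V (x.next i)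

/-- The variance-aware confidence set `Ω_t(w, B)`, `t = n + 1`. -/
def Trajectory.confSet (ε δ : ℝ) (x : Trajectory S A) (n : ℕ)
    (w : EuclideanSpace ℝ (Fin d)) (B : ℝ) : Set (EuclideanSpace ℝ (Fin d)) :=
  {w' | ‖w'‖ ≤ 3 * √d * B ∧
    ∀ j ∈ levels d ε B, ∀ ν ∈ grid d (ε / (n + 1)) (6 * √d * B),
      |∑ i ∈ Finset.range n,
          clip j (inner ℝ (x.feat φ i) ν) * x.resid φ (optValue φ w B) w' i| ≤
        √((∑ i ∈ Finset.range n,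
            clip j (inner ℝ (x.feat φ i) ν) ^ 2 * x.resid φ (optValue φ w B) w' i ^ 2) *
          iota d ε δ B (n + 1)) + B * (2 : ℝ) ^ j * iota d ε δ B (n + 1)}

/-- The feasible set of the global optimisation problem: `w ∈ Ω_t(w, B)`. -/
def Trajectory.feasible (ε δ : ℝ) (x : Trajectory S A) (n : ℕ) (B : ℝ) :
    Set (EuclideanSpace ℝ (Fin d)) :=
  {w | w ∈ x.confSet φ ε δ n w B}

/-- `Φ^j_t(ν) = ∑_{i < t} clip_j(φ_iᵀ ν) φ_iᵀ ν + 2^j ‖ν‖²`, `t = n + 1`. -/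
def Trajectory.potential (x : Trajectory S A) (j : ℤ) (n : ℕ)
    (ν : EuclideanSpace ℝ (Fin d)) : ℝ :=
  ∑ i ∈ Finset.range n, clip j (inner ℝ (x.feat φ i) ν) * inner ℝ (x.feat φ i) ν +
    (2 : ℝ) ^ j * ‖ν‖ ^ 2

/-- `(w, B)` is a result of the recomputation at index `n` that starts from the estimate `B₀`:
solve `min {V_{w,B}(s_t) : w ∈ Ω_t(w, B)}`; while the optimal value exceeds `B`, double `B` and
solve again. -/
def Trajectory.Recomputed (ε δ : ℝ) (x : Trajectory S A) (n : ℕ) (B₀ : ℝ)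
    (w : EuclideanSpace ℝ (Fin d)) (B : ℝ) : Prop :=
  ∃ m : ℕ, B = 2 ^ m * B₀ ∧
    w ∈ x.feasible φ ε δ n B ∧
    (∀ w' ∈ x.feasible φ ε δ n B,
      optValue φ w B (some (x.state n)) ≤ optValue φ w' B (some (x.state n))) ∧
    optValue φ w B (some (x.state n)) ≤ B ∧
    ∀ k < m, ∀ w' ∈ x.feasible φ ε δ n (2 ^ k * B₀),
      2 ^ k * B₀ < optValue φ w' (2 ^ k * B₀) (some (x.state n))

/-- When the parameters are recomputed at index `n + 1`, given the parameters `w`, `B` of index `n`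
and the index `τ ≤ n` of the latest recomputation: the goal was reached; or the overestimate
condition holds; or the lazy update condition holds. -/
def Trajectory.Trigger (ε : ℝ) (x : Trajectory S A) (n τ : ℕ)
    (w : EuclideanSpace ℝ (Fin d)) (B : ℝ) : Prop :=
  x.next n = none ∨
  optValue φ w B (x.next n) = 2 * B ∨
  ∃ j ∈ levels d ε B, ∃ ν ∈ grid d (ε / (n + 2)) (6 * √d * B),
    8 * (d : ℝ) ^ 2 * x.potential φ j τ ν < x.potential φ j (n + 1) ν

/-- `x`, together with the parameters `w_t`, `B_t`, is a run of the algorithm. Ties in the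
minimisations are broken arbitrarily, and nothing is required of the parameters if the
recomputation has no result (infeasible problem). -/
def IsRun (ε δ : ℝ) (x : Trajectory S A) (w : ℕ → EuclideanSpace ℝ (Fin d)) (B : ℕ → ℝ) : Prop :=
  ∃ τ : ℕ → ℕ,
    τ 0 = 0 ∧
    ((∃ w' B', x.Recomputed φ ε δ 0 1 w' B') → x.Recomputed φ ε δ 0 1 (w 0) (B 0)) ∧
    (∀ n, x.Trigger φ ε n (τ n) (w n) (B n) →
      τ (n + 1) = n + 1 ∧
      ((∃ w' B', x.Recomputed φ ε δ (n + 1) (B n) w' B') →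
        x.Recomputed φ ε δ (n + 1) (B n) (w (n + 1)) (B (n + 1)))) ∧
    (∀ n, ¬ x.Trigger φ ε n (τ n) (w n) (B n) →
      τ (n + 1) = τ n ∧ w (n + 1) = w n ∧ B (n + 1) = B n) ∧
    (∀ n a, inner ℝ (φ (x.state n) (x.action n)) (w n) ≤ inner ℝ (φ (x.state n) a) (w n))

end Algorithm

/-! ### Interaction and regret -/

section Interaction

variable {S : Type u} {A : Type v} [MeasurableSpace S] [MeasurableSpace A]

/-- The state sequence determined by the successor states `s'_t`: every episode starts in
`init`, and `s_{t+1} = s'_t` unless `s'_t = g`. -/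
def SSP.stateSeq (M : SSP S A) (y : ℕ → Option S) : ℕ → S
  | 0 => M.init
  | n + 1 => (y n).getD M.init

/-- The trajectory determined by the actions and the successor states. -/
def SSP.trajectory (M : SSP S A) (a : ℕ → A) (y : ℕ → Option S) : Trajectory S A where
  state := M.stateSeq y
  action := a
  cost n := M.cost (M.stateSeq y n) (a n)
  next := y

/-- The random interaction of the algorithm with `M`. The action `a_t` and the parameters `w_t`,
`B_t` are chosen on the basis of the past `ℱ_t` (which may contain additional randomness), and
given the past, `s'_t` has law `P(· | s_t, a_t)`. -/
structure SSP.IsInteraction (M : SSP S A) {d : ℕ} (φ : S → A → EuclideanSpace ℝ (Fin d))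
    (ε δ : ℝ) {Ω : Type w} [mΩ : MeasurableSpace Ω] (Pr : Measure Ω) (ℱ : Filtration ℕ mΩ)
    (a : ℕ → Ω → A) (y : ℕ → Ω → Option S)
    (wt : ℕ → Ω → EuclideanSpace ℝ (Fin d)) (Bt : ℕ → Ω → ℝ) : Prop where
  measurable_action : ∀ n, Measurable[ℱ n] (a n)
  measurable_next : ∀ n, Measurable[ℱ (n + 1)] (y n)
  measurable_weight : ∀ n, Measurable[ℱ n] (wt n)
  measurable_estimate : ∀ n, Measurable[ℱ n] (Bt n)
  law_next : ∀ n (F : Set Ω) (E : Set (Option S)), MeasurableSet[ℱ n] F → MeasurableSet E →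
    Pr (F ∩ y n ⁻¹' E) =
      ∫⁻ ω in F, M.trans (M.stateSeq (y · ω) n, a n ω) E ∂Pr
  isRun : ∀ᵐ ω ∂Pr, IsRun φ ε δ (M.trajectory (a · ω) (y · ω)) (wt · ω) (Bt · ω)

/-- Number of episodes completed within the first `n` steps. -/
def Trajectory.episodes (x : Trajectory S A) (n : ℕ) : ℕ :=
  {i : ℕ | i < n ∧ x.next i = none}.ncard

open Classical in
/-- The regret `R_K = ∑_{t ≤ T} c(s_t, a_t) - K V⋆(s_init)`, where `T` is the number of steps of the
first `K` episodes, and `R_K = ∞` if `T = ∞`. -/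
def SSP.regret (M : SSP S A) (K : ℕ) (x : Trajectory S A) : EReal :=
  if h : ∃ n, x.episodes n = K then
    ((∑ i ∈ Finset.range (Nat.find h), x.cost i - K * (M.Vstar M.init).toReal : ℝ) : EReal)
  else ⊤

end Interaction

end LinearSSP

end

namespace LinearSSP

/-! ### A self-normalised martingale inequality -/

/-! The argument combines optimism with a variance-aware analysis of Bellman errors in which the
number of steps enters only through logarithms. Write `U V` for the parameter with `φᵀ U V = c + P
V`, and call `U V_{w,B} - w` the Bellman error (`bellmanGap`).

Confidence. The martingale inequality `measure_abs_sum_gt_le` is self-normalised: its radius uses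
the observed squares. A union bound over grids of `ν` and `w`, over clipping levels and over `B =
2^m`, together with the Lipschitz dependence of `V_{w,B}` on `w`, shows that with high probability
`U V_{w,B} ∈ Ω_t(w,B)` for all relevant `w`, `B`, `t` at once (`bellman_mem_confSet`). Value
iteration converges to a parameter with `U V_{w,B} = w` and `V_{w,B} ≤ V⋆` (`exists_fixed_point`).
This parameter is feasible, so every recomputation succeeds, its value at the current state is at
most `V⋆`, and `B` never exceeds `2 B⋆` (`exists_goodRun`).

Bellman errors. Both `w` and `U V_{w,B}` satisfy the constraints of `Ω`. Their residuals differ by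
exactly `φᵀ ν`, with `ν` the Bellman error, so subtracting two constraints bounds the clipped form
`∑ clip_j(φᵀν) φᵀν` by `2^j` times a multiple of `√(Q ι) + √d B ι`, where `Q` is the sum of squared
deviations. A telescoping sum of squared values bounds `Q` by `B` times (total cost `C` plus total
Bellman error); the lowest clipping level closes this system, and `Q` disappears in favour of `C`
(`sum_clip_gap_le`). The lazy update rule carries the bound from the last recomputation to the
present at the price of a factor `8 d²` (`potential_le`). At the level `2^j ≈ |φ_tᵀν_t|` this says
that `|φ_tᵀν_t|` is at most a large factor times the relative growth of the potential at step `t`.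
The elliptical potential lemma `sum_min_one_div_potential_le` bounds the sum of these growths by `d`
times squared logarithms, for arbitrary vectors and levels: pigeonholing removes the clipping, and a
determinant argument counts. It therefore bounds both the total Bellman error (`sum_abs_gap_le`) and
the number of lazy updates (`card_lazy_le`).

Regret. Along a run, `c + V(s') - V(s)` is at most the Bellman error minus the deviation. Summation
telescopes up to the jumps of `V` at recomputations: a finished episode costs at most `V⋆(s_init)`,
a lazy update at most `2 B⋆`, and an overestimate gains `B_t`, up to the telescoping increase of `B`
(`ledger`). The deviations are again controlled by their squares, hence by the cost itself
(`cost_le`). The outcome is an inequality for the regret `R` with a term of order `√(B⋆ (K B⋆ +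
R))`, which is solved for `R` (`regret_solve`). Since every step costs at least `cmin`, the step
count inside the logarithm can be removed (`log_le_of_regret`), and the same cost bound forces the
`K` episodes to end. -/

theorem exp_sub_sq_le {x : ℝ} (hx : -(1 / 2) ≤ x) : Real.exp (x - x ^ 2) ≤ 1 + x := by
  -- The inverse inequality only needs lower bounds of an exponential. For `x ≥ 0` the first-order
  -- bound leaves `1 + x³ ≥ 1` after multiplication by `1 + x`; for `x ≤ 0` the exponent is
  -- nonnegative and the second-order term is needed to beat the negative `x³`.
  have key : (1 + x)⁻¹ ≤ Real.exp (-(x - x ^ 2)) := by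
    have h1 : 0 < 1 + x := by linarith
    rw [inv_le_iff_one_le_mul₀ h1]
    rcases le_total 0 x with h | h
    · have := Real.add_one_le_exp (-(x - x ^ 2))
      have h3 : 0 ≤ x ^ 3 := by positivity
      nlinarith
    · have h2 : 0 ≤ -(x - x ^ 2) := by nlinarith
      have := Real.quadratic_le_exp_of_nonneg h2
      have h3 : 0 ≤ x ^ 2 * (1 + x - x ^ 2 + x ^ 3) := by
        apply mul_nonneg (by positivity)
        nlinarith [mul_nonneg (by linarith : (0:ℝ) ≤ 1 + 2 * x) (sq_nonneg x)]
      nlinarith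
  rw [Real.exp_neg] at key
  exact (inv_le_inv₀ (by linarith) (Real.exp_pos _)).1 key

section OneStep

variable {Ω Ω' X : Type*} [MeasurableSpace Ω] [MeasurableSpace Ω'] [MeasurableSpace X]
  {Pr : Measure Ω} [IsProbabilityMeasure Pr] {f : Ω → Ω'} {y : Ω → X}

/-- The hypothesis on rectangles determines the joint law of `(f, y)` as the composition product of
the law of `f` with `κ`, because rectangles form a π-system. -/
theorem lintegral_of_law (hf : Measurable f) (hy : Measurable y) (κ : Kernel Ω' X)
    [IsMarkovKernel κ]
    (h : ∀ F E, MeasurableSet F → MeasurableSet E →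
      Pr (f ⁻¹' F ∩ y ⁻¹' E) = ∫⁻ ω in f ⁻¹' F, κ (f ω) E ∂Pr)
    {G : Ω' × X → ℝ≥0∞} (hG : Measurable G) :
    ∫⁻ ω, G (f ω, y ω) ∂Pr = ∫⁻ ω, ∫⁻ x, G (f ω, x) ∂(κ (f ω)) ∂Pr := by
  have : IsProbabilityMeasure (Pr.map f) := Measure.isProbabilityMeasure_map hf.aemeasurable
  have : IsProbabilityMeasure (Pr.map fun ω => (f ω, y ω)) :=
    Measure.isProbabilityMeasure_map (hf.prodMk hy).aemeasurable
  have key : Pr.map (fun ω => (f ω, y ω)) = (Pr.map f) ⊗ₘ κ := by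
    refine Measure.ext_prod fun {F E} hF hE => ?_
    rw [Measure.map_apply (hf.prodMk hy) (hF.prod hE), Measure.compProd_apply_prod hF hE,
      setLIntegral_map hF (κ.measurable_coe hE) hf, ← h F E hF hE]
    rfl
  rw [← lintegral_map hG (hf.prodMk hy), key, Measure.lintegral_compProd hG,
    lintegral_map (hG.lintegral_kernel_prod_right') hf]

/-- The increment `c (∫ v dκ - v)` has conditional mean zero and is at least `-1/2`, so `exp (u -
u²) ≤ 1 + u` has conditional expectation at most one. The square subtracted is the realised one, not
its expectation; this is what makes the resulting inequality self-normalised. -/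
theorem lintegral_mul_exp_le (hf : Measurable f) (hy : Measurable y) (κ : Kernel Ω' X)
    [IsMarkovKernel κ]
    (h : ∀ F E, MeasurableSet F → MeasurableSet E →
      Pr (f ⁻¹' F ∩ y ⁻¹' E) = ∫⁻ ω in f ⁻¹' F, κ (f ω) E ∂Pr)
    {Z : Ω' → ℝ≥0∞} (hZ : Measurable Z) {v : Ω' × X → ℝ} (hv : Measurable v)
    {c : Ω' → ℝ} (hc : Measurable c) (hint : ∀ ω, Integrable (fun x => v (ω, x)) (κ ω))
    (hb : ∀ ω x, |c ω * (∫ x, v (ω, x) ∂(κ ω) - v (ω, x))| ≤ 1 / 2) :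
    ∫⁻ ω, Z (f ω) * ENNReal.ofReal (Real.exp
      (c (f ω) * (∫ x, v (f ω, x) ∂(κ (f ω)) - v (f ω, y ω)) -
        (c (f ω) * (∫ x, v (f ω, x) ∂(κ (f ω)) - v (f ω, y ω))) ^ 2)) ∂Pr ≤
      ∫⁻ ω, Z (f ω) ∂Pr := by
  have hm : Measurable fun ω => ∫ x, v (ω, x) ∂(κ ω) :=
    (hv.stronglyMeasurable.integral_kernel_prod_right' (κ := κ)).measurable
  set g : Ω' × X → ℝ := fun p => c p.1 * (∫ x, v (p.1, x) ∂(κ p.1) - v p) with hg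
  have hgm : Measurable g := (hc.comp measurable_fst).mul ((hm.comp measurable_fst).sub hv)
  have hG : Measurable fun p : Ω' × X =>
      Z p.1 * ENNReal.ofReal (Real.exp (g p - g p ^ 2)) :=
    (hZ.comp measurable_fst).mul
      (Real.measurable_exp.comp (hgm.sub (hgm.pow_const 2))).ennreal_ofReal
  have := lintegral_of_law hf hy κ h hG
  simp only [hg] at this
  rw [this]
  refine lintegral_mono fun ω => ?_
  have hm1 : Measurable fun x => ENNReal.ofReal (Real.exp (g (f ω, x) - g (f ω, x) ^ 2)) :=
    (Real.measurable_exp.comp ((hgm.sub (hgm.pow_const 2)).comp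
      measurable_prodMk_left)).ennreal_ofReal
  have hle : ∫⁻ x, ENNReal.ofReal (Real.exp (g (f ω, x) - g (f ω, x) ^ 2)) ∂(κ (f ω)) ≤ 1 := by
    have hgi : Integrable (fun x => g (f ω, x)) (κ (f ω)) :=
      (((integrable_const (∫ x, v (f ω, x) ∂(κ (f ω)))).sub (hint (f ω))).const_mul (c (f ω)):)
    calc ∫⁻ x, ENNReal.ofReal (Real.exp (g (f ω, x) - g (f ω, x) ^ 2)) ∂(κ (f ω))
        ≤ ∫⁻ x, ENNReal.ofReal (1 + g (f ω, x)) ∂(κ (f ω)) := by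
          refine lintegral_mono fun x => ENNReal.ofReal_le_ofReal (exp_sub_sq_le ?_)
          exact (abs_le.1 (hb (f ω) x)).1
      _ = ENNReal.ofReal (∫ x, (1 + g (f ω, x)) ∂(κ (f ω))) := by
          have hgi1 : Integrable (fun x => 1 + g (f ω, x)) (κ (f ω)) :=
            (integrable_const _).add hgi
          rw [ofReal_integral_eq_lintegral_ofReal hgi1]
          refine Eventually.of_forall fun x => ?_
          have := (abs_le.1 (hb (f ω) x)).1
          change 0 ≤ 1 + g (f ω, x)
          simp only [hg]
          linarith
      _ = 1 := by
          rw [integral_add (integrable_const _) hgi]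
          simp only [hg]
          rw [integral_const_mul, integral_sub (integrable_const _) (hint (f ω))]
          simp
  calc _ = Z (f ω) * ∫⁻ x, ENNReal.ofReal (Real.exp (g (f ω, x) - g (f ω, x) ^ 2))
        ∂(κ (f ω)) := by rw [← lintegral_const_mul _ hm1]
    _ ≤ Z (f ω) * 1 := by gcongr
    _ = Z (f ω) := mul_one _

end OneStep

/-- The one-step exponential bound from which the self-normalised inequality follows. -/
def ExpDominated {Ω : Type*} [mΩ : MeasurableSpace Ω] (Pr : Measure Ω) (ℱ : Filtration ℕ mΩ)
    (X : ℕ → Ω → ℝ) (b : ℝ) : Prop :=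
  ∀ n (l : ℝ), |l| * b ≤ 1 / 2 → ∀ Z : Ω → ℝ≥0∞, Measurable[ℱ n] Z →
    ∫⁻ ω, Z ω * ENNReal.ofReal (Real.exp (l * X n ω - (l * X n ω) ^ 2)) ∂Pr ≤ ∫⁻ ω, Z ω ∂Pr

section Freedman

variable {Ω : Type*} [mΩ : MeasurableSpace Ω] {Pr : Measure Ω} [IsProbabilityMeasure Pr]
  {ℱ : Filtration ℕ mΩ} {X : ℕ → Ω → ℝ} {b : ℝ}

theorem lintegral_exp_sum_le (hX : ∀ n, Measurable[ℱ (n + 1)] (X n))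
    (hE : ExpDominated Pr ℱ X b) {l : ℝ} (hl : |l| * b ≤ 1 / 2) (n : ℕ) :
    Measurable[ℱ n] (fun ω => ENNReal.ofReal (Real.exp
      (∑ i ∈ Finset.range n, (l * X i ω - (l * X i ω) ^ 2)))) ∧
    ∫⁻ ω, ENNReal.ofReal (Real.exp
      (∑ i ∈ Finset.range n, (l * X i ω - (l * X i ω) ^ 2))) ∂Pr ≤ 1 := by
  induction n with
  | zero => simp
  | succ n ih =>
    have heq : (fun ω => ENNReal.ofReal (Real.exp
        (∑ i ∈ Finset.range (n + 1), (l * X i ω - (l * X i ω) ^ 2)))) =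
        fun ω => ENNReal.ofReal (Real.exp
          (∑ i ∈ Finset.range n, (l * X i ω - (l * X i ω) ^ 2))) *
          ENNReal.ofReal (Real.exp (l * X n ω - (l * X n ω) ^ 2)) := by
      funext ω
      rw [Finset.sum_range_succ, Real.exp_add, ENNReal.ofReal_mul (Real.exp_pos _).le]
    constructor
    · rw [heq]
      have h1 : Measurable[ℱ (n + 1)] (fun ω => l * X n ω) := (hX n).const_mul l
      exact (ih.1.mono (ℱ.mono n.le_succ) le_rfl).mul
        (Real.measurable_exp.comp (h1.sub (h1.pow_const 2))).ennreal_ofReal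
    · rw [heq]
      exact (hE n l hl _ ih.1).trans ih.2

theorem measure_sum_ge_le (hX : ∀ n, Measurable[ℱ (n + 1)] (X n))
    (hE : ExpDominated Pr ℱ X b) {l : ℝ} (hl : |l| * b ≤ 1 / 2) (n : ℕ) (L : ℝ) :
    Pr {ω | L ≤ ∑ i ∈ Finset.range n, (l * X i ω - (l * X i ω) ^ 2)} ≤
      ENNReal.ofReal (Real.exp (-L)) := by
  obtain ⟨h1, h2⟩ := lintegral_exp_sum_le hX hE hl n
  have h3 := mul_meas_ge_le_lintegral (μ := Pr) (h1.mono (ℱ.le n) le_rfl)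
    (ENNReal.ofReal (Real.exp L))
  have h4 : {ω | L ≤ ∑ i ∈ Finset.range n, (l * X i ω - (l * X i ω) ^ 2)} ⊆
      {ω | ENNReal.ofReal (Real.exp L) ≤ ENNReal.ofReal (Real.exp
      (∑ i ∈ Finset.range n, (l * X i ω - (l * X i ω) ^ 2)))} := fun ω hω =>
    ENNReal.ofReal_le_ofReal (Real.exp_le_exp.2 hω)
  have h5 := (mul_le_mul_right (measure_mono (μ := Pr) h4) (ENNReal.ofReal (Real.exp L))).trans
    (h3.trans h2)
  rw [Real.exp_neg, ENNReal.ofReal_inv_of_pos (Real.exp_pos _)]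
  rw [mul_comm] at h5
  rw [← one_div, ENNReal.le_div_iff_mul_le]
  · exact h5
  · left; simp [Real.exp_pos]
  · left; simp

/-- Each scale `l` gives `|∑ x| ≤ l Q + L / l`, and the best `l` is `√(L / Q)`, which depends on the
data. A dyadic approximation from below costs a factor two in one term, whence the constant `3`; if
`Q` is small, the largest scale `1 / (2b)` gives `4 b L`. -/
theorem abs_sum_le_of_forall_scale {n : ℕ} {x : ℕ → ℝ} {b L : ℝ} (hb : 0 < b) (hL : 1 ≤ L)
    (hx : ∀ i < n, |x i| ≤ b)
    (h : ∀ k ≤ n, ∀ s : ℝ, |s| = 1 → ∑ i ∈ Finset.range n,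
      (s * ((1 / 2) ^ k / (2 * b)) * x i - (s * ((1 / 2) ^ k / (2 * b)) * x i) ^ 2) < L) :
    |∑ i ∈ Finset.range n, x i| ≤ 3 * √((∑ i ∈ Finset.range n, x i ^ 2) * L) + 4 * b * L := by
  set Q := ∑ i ∈ Finset.range n, x i ^ 2 with hQ
  have hQ0 : 0 ≤ Q := Finset.sum_nonneg fun i _ => sq_nonneg _
  have hQn : Q ≤ n * b ^ 2 := by
    calc Q ≤ ∑ i ∈ Finset.range n, b ^ 2 := Finset.sum_le_sum fun i hi => by
            rw [← sq_abs]; exact pow_le_pow_left₀ (abs_nonneg _) (hx i (Finset.mem_range.1 hi)) 2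
      _ = n * b ^ 2 := by simp
  have key : ∀ k ≤ n, |∑ i ∈ Finset.range n, x i| ≤
      ((1 / 2) ^ k / (2 * b)) * Q + L / ((1 / 2) ^ k / (2 * b)) := by
    intro k hk
    set l : ℝ := (1 / 2) ^ k / (2 * b) with hl
    have hl0 : 0 < l := by positivity
    have hs : ∀ s : ℝ, |s| = 1 → s * ∑ i ∈ Finset.range n, x i ≤ l * Q + L / l := by
      intro s hs
      have h1 := h k hk s hs
      have h2 : ∑ i ∈ Finset.range n, (s * l * x i - (s * l * x i) ^ 2) =
          l * (s * ∑ i ∈ Finset.range n, x i) - l ^ 2 * Q := by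
        rw [Finset.sum_sub_distrib, hQ, Finset.mul_sum, Finset.mul_sum, Finset.mul_sum]
        congr 1
        · exact Finset.sum_congr rfl fun i _ => by ring
        · refine Finset.sum_congr rfl fun i _ => ?_
          rw [mul_pow, mul_pow, ← sq_abs s, hs]; ring
      rw [h2] at h1
      have h3 : l * (s * ∑ i ∈ Finset.range n, x i) ≤ l * (l * Q + L / l) := by
        have : l * (L / l) = L := by field_simp
        rw [mul_add, this]; nlinarith
      exact le_of_mul_le_mul_left h3 hl0
    rw [abs_le]
    constructor
    · have := hs (-1) (by simp); linarith
    · have := hs 1 (by simp); linarith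
  by_cases hc : Q ≤ 4 * b ^ 2 * L
  · have h0 := key 0 (Nat.zero_le _)
    have h1 : ((1 / 2 : ℝ) ^ 0 / (2 * b)) * Q ≤ 2 * b * L := by
      rw [pow_zero, div_mul_eq_mul_div, one_mul, div_le_iff₀ (by positivity)]; nlinarith
    have h2 : L / ((1 / 2 : ℝ) ^ 0 / (2 * b)) = 2 * b * L := by
      rw [pow_zero]; field_simp
    have := Real.sqrt_nonneg (Q * L)
    linarith
  · push Not at hc
    have hQp : 0 < Q := lt_trans (by positivity) hc
    set r := √(L / Q) with hr
    have hr0 : 0 < r := Real.sqrt_pos.2 (by positivity)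
    have hrQ : r * Q = √(Q * L) := by
      rw [hr, eq_comm, Real.sqrt_eq_iff_mul_self_eq (by positivity) (by positivity)]
      have : √(L / Q) * √(L / Q) = L / Q := Real.mul_self_sqrt (by positivity)
      calc Q * L = (L / Q) * Q * Q := by field_simp
        _ = (√(L / Q) * √(L / Q)) * Q * Q := by rw [this]
        _ = √(L / Q) * Q * (√(L / Q) * Q) := by ring
    have hrL : L / r = √(Q * L) := by
      rw [← hrQ, div_eq_iff hr0.ne']
      have : r * r = L / Q := Real.mul_self_sqrt (by positivity)
      calc L = (L / Q) * Q := by field_simp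
        _ = r * Q * r := by rw [← this]; ring
    have hrlt : r < 1 / (2 * b) := by
      rw [hr, Real.sqrt_lt' (by positivity), div_lt_iff₀ hQp]
      have : (1 / (2 * b)) ^ 2 * (4 * b ^ 2 * L) = L := by field_simp; ring
      calc L = (1 / (2 * b)) ^ 2 * (4 * b ^ 2 * L) := this.symm
        _ < _ := by gcongr
    have hex : ∃ k, (1 / 2 : ℝ) ^ k / (2 * b) ≤ r := by
      obtain ⟨k, hk⟩ := exists_pow_lt_of_lt_one (show (0 : ℝ) < r * (2 * b) by positivity)
        (show (1 / 2 : ℝ) < 1 by norm_num)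
      exact ⟨k, by rw [div_le_iff₀ (by positivity)]; exact hk.le⟩
    classical
    have hk1 := Nat.find_spec hex
    set k := Nat.find hex with hk
    -- Only `n + 1` scales are needed: `Q ≤ n b²` and `L ≥ 1` keep the optimal scale above `2^{-n} /
    -- (2b)`.
    have hkn : k ≤ n := by
      refine Nat.find_min' hex ?_
      rw [hr]
      apply Real.le_sqrt_of_sq_le
      rw [le_div_iff₀ hQp]
      have h1 : ((1 / 2 : ℝ) ^ n / (2 * b)) ^ 2 * Q ≤
          ((1 / 2 : ℝ) ^ n / (2 * b)) ^ 2 * (n * b ^ 2) := by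
        gcongr
      have h2 : ((1 / 2 : ℝ) ^ n / (2 * b)) ^ 2 * (n * b ^ 2) = ((1 / 2 : ℝ) ^ n) ^ 2 * n / 4 := by
        field_simp; ring
      have h3 : ((1 / 2 : ℝ) ^ n) ≤ 1 := pow_le_one₀ (by norm_num) (by norm_num)
      have h5 : ((1 / 2 : ℝ) ^ n) * n ≤ 1 := by
        rw [one_div, inv_pow, inv_mul_le_iff₀ (by positivity), mul_one]
        exact_mod_cast (Nat.lt_two_pow_self (n := n)).le
      have h6 : (0 : ℝ) < (1 / 2 : ℝ) ^ n := by positivity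
      nlinarith
    have hkpos : k ≠ 0 := by
      intro h0
      rw [h0, pow_zero] at hk1
      linarith
    have hk2 : ¬ (1 / 2 : ℝ) ^ (k - 1) / (2 * b) ≤ r := Nat.find_min hex (by omega)
    have hk3 : r < 2 * ((1 / 2 : ℝ) ^ k / (2 * b)) := by
      push Not at hk2
      have : (1 / 2 : ℝ) ^ k = (1 / 2) ^ (k - 1) * (1 / 2) := by
        rw [← pow_succ]; congr 1; omega
      rw [this]
      calc r < _ := hk2
        _ = _ := by ring
    have h1 := key k hkn
    set l : ℝ := (1 / 2) ^ k / (2 * b) with hl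
    have hl0 : 0 < l := by positivity
    have h2 : l * Q ≤ √(Q * L) := by rw [← hrQ]; gcongr
    have h3 : L / l ≤ 2 * √(Q * L) := by
      rw [← hrL, div_le_iff₀ hl0]
      have : L = L / r * r := by field_simp
      calc L = L / r * r := this
        _ ≤ L / r * (2 * l) := by gcongr
        _ = _ := by ring
    have : 0 ≤ 4 * b * L := by positivity
    linarith

/-- Union bound over the `n + 1` dyadic scales and the two signs, each event having probability at
most `exp (-L)`. -/
theorem measure_abs_sum_gt_le (hX : ∀ n, Measurable[ℱ (n + 1)] (X n))
    (hE : ExpDominated Pr ℱ X b) (hb : 0 < b) (hXb : ∀ n ω, |X n ω| ≤ b) (n : ℕ) {L : ℝ}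
    (hL : 1 ≤ L) :
    Pr {ω | 3 * √((∑ i ∈ Finset.range n, X i ω ^ 2) * L) + 4 * b * L <
      |∑ i ∈ Finset.range n, X i ω|} ≤ ENNReal.ofReal (2 * (n + 1) * Real.exp (-L)) := by
  have hsub : {ω | 3 * √((∑ i ∈ Finset.range n, X i ω ^ 2) * L) + 4 * b * L <
      |∑ i ∈ Finset.range n, X i ω|} ⊆
      ⋃ k ∈ Finset.range (n + 1), ⋃ s ∈ ({1, -1} : Finset ℝ),
        {ω | L ≤ ∑ i ∈ Finset.range n, ((s * ((1 / 2) ^ k / (2 * b))) * X i ω -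
          ((s * ((1 / 2) ^ k / (2 * b))) * X i ω) ^ 2)} := by
    intro ω hω
    by_contra hcon
    simp only [Set.mem_iUnion, not_exists, Set.mem_ofPred_eq, not_le] at hcon
    refine absurd (abs_sum_le_of_forall_scale hb hL (fun i _ => hXb i ω) ?_) (not_le.2 hω)
    intro k hk s hs
    refine hcon k (Finset.mem_range.2 (by omega)) s ?_
    rcases (abs_eq (by norm_num)).1 hs with h | h <;> simp [h]
  refine (measure_mono hsub).trans ?_
  calc _ ≤ ∑ k ∈ Finset.range (n + 1), ∑ s ∈ ({1, -1} : Finset ℝ),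
        ENNReal.ofReal (Real.exp (-L)) := by
        refine (measure_biUnion_finset_le _ _).trans (Finset.sum_le_sum fun k _ => ?_)
        refine (measure_biUnion_finset_le _ _).trans (Finset.sum_le_sum fun s hs => ?_)
        refine measure_sum_ge_le hX hE ?_ n L
        have hs1 : |s| = 1 := by
          simp only [Finset.mem_insert, Finset.mem_singleton] at hs
          rcases hs with h | h <;> simp [h]
        rw [abs_mul, hs1, one_mul, abs_of_pos (by positivity)]
        have : ((1 / 2 : ℝ) ^ k) ≤ 1 := pow_le_one₀ (by norm_num) (by norm_num)
        calc (1 / 2 : ℝ) ^ k / (2 * b) * b = (1 / 2 : ℝ) ^ k / 2 := by field_simp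
          _ ≤ 1 / 2 := by linarith
    _ = ENNReal.ofReal (2 * (n + 1) * Real.exp (-L)) := by
        rw [Finset.sum_const, Finset.sum_const, Finset.card_range,
          Finset.card_pair (by norm_num), smul_smul, nsmul_eq_mul,
          ENNReal.ofReal_mul (by positivity)]
        congr 1
        rw [show (2 * ((n : ℝ) + 1)) = (((n + 1) * 2 : ℕ) : ℝ) by push_cast; ring,
          ENNReal.ofReal_natCast]

end Freedman

end LinearSSP

namespace LinearSSP

/-! ### Integration against the vector measure of a linear SSP -/

section VectorMeasure

variable {X : Type*} [MeasurableSpace X] {d : ℕ}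

/-- The norm is dominated by the sum of the coordinates, and each coordinate is a real signed
measure, whose total variation is finite. -/
theorem isFiniteMeasure_variation (μ : VectorMeasure X (EuclideanSpace ℝ (Fin d))) :
    IsFiniteMeasure μ.variation := by
  set s : Fin d → SignedMeasure X := fun i =>
    μ.mapRange (EuclideanSpace.proj (𝕜 := ℝ) i).toLinearMap.toAddMonoidHom
      (EuclideanSpace.proj (𝕜 := ℝ) i).continuous with hs
  have hle : μ.variation ≤ ∑ i, (s i).totalVariation := by
    refine VectorMeasure.variation_le_of_forall_enorm_le fun E _ => ?_
    rw [Measure.finsetSum_apply]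
    calc ‖μ E‖ₑ ≤ ∑ i, ‖s i E‖ₑ := by
          have h1 : ‖μ E‖ ≤ ∑ i, ‖s i E‖ := by
            have h2 : ∀ i, s i E = μ E i := fun i => rfl
            simp only [h2]
            conv_lhs => rw [← (EuclideanSpace.basisFun (Fin d) ℝ).sum_repr (μ E)]
            refine (norm_sum_le _ _).trans (Finset.sum_le_sum fun i _ => ?_)
            rw [norm_smul]
            simp
          have h3 : ∀ i, ‖s i E‖ₑ = ENNReal.ofReal ‖s i E‖ := fun i => (ofReal_norm _).symm
          simp only [h3]
          rw [← ofReal_norm, ← ENNReal.ofReal_sum_of_nonneg fun i _ => norm_nonneg _]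
          exact ENNReal.ofReal_le_ofReal h1
      _ ≤ _ := Finset.sum_le_sum fun i _ => SignedMeasure.enorm_le_totalVariation _ _
  have hfin : IsFiniteMeasure (∑ i, (s i).totalVariation) := by
    refine ⟨?_⟩
    rw [Measure.finsetSum_apply]
    exact ENNReal.sum_lt_top.2 fun i _ => measure_lt_top _ _
  exact isFiniteMeasure_of_le _ hle

/-- Both sides are linear and agree on indicators, hence on simple functions; bounded approximation
passes to the limit on each side by dominated convergence, with respect to the finite variation and
to `P`. -/
theorem inner_integral_eq (μ : VectorMeasure X (EuclideanSpace ℝ (Fin d)))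
    (P : Measure X) [IsFiniteMeasure P] (f : EuclideanSpace ℝ (Fin d))
    (hP : ∀ E, MeasurableSet E → P.real E = inner ℝ f (μ E)) {h : X → ℝ} {b : ℝ}
    (hm : Measurable h) (hb : ∀ x, |h x| ≤ b) :
    inner ℝ f (∫ᵛ x, h x ∂•μ) = ∫ x, h x ∂P := by
  have hfin := isFiniteMeasure_variation μ
  have hsimple : ∀ g : SimpleFunc X ℝ, inner ℝ f (∫ᵛ x, g x ∂•μ) = ∫ x, g x ∂P := by
    intro g
    induction g using SimpleFunc.induction with
    | const c hs =>
      rename_i s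
      classical
      have h1 : ∫ᵛ x, (SimpleFunc.piecewise s hs (SimpleFunc.const X c)
          (SimpleFunc.const X 0)) x ∂•μ = c • μ s := by
        rw [SimpleFunc.coe_piecewise, SimpleFunc.coe_const, SimpleFunc.coe_const,
          Function.const_zero, Set.piecewise_eq_indicator]
        exact setToFun_indicator_const _ hs (measure_ne_top _ _) c
      rw [h1, SimpleFunc.coe_piecewise, SimpleFunc.coe_const, SimpleFunc.coe_const,
          Function.const_zero, Set.piecewise_eq_indicator]
      rw [inner_smul_right, ← hP s hs]
      change _ = ∫ x, s.indicator (fun _ => c) x ∂P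
      rw [integral_indicator_const _ hs, smul_eq_mul, mul_comm]
    | add hd hf hg =>
      rename_i f1 g1
      have i1 : ∀ k : SimpleFunc X ℝ, Integrable k μ.variation := fun k =>
        SimpleFunc.integrable_of_isFiniteMeasure k
      have i2 : ∀ k : SimpleFunc X ℝ, Integrable k P := fun k =>
        SimpleFunc.integrable_of_isFiniteMeasure k
      rw [SimpleFunc.coe_add]
      simp only [Pi.add_apply]
      rw [VectorMeasure.integral_fun_add (i1 f1) (i1 g1), integral_add (i2 f1) (i2 g1),
        inner_add_right, hf, hg]
  have hsm := hm.stronglyMeasurable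
  have hb0 : ∀ x, ‖h x‖ ≤ b := hb
  have hlim : ∀ x, Tendsto (fun n => hsm.approxBounded b n x) atTop (𝓝 (h x)) := fun x =>
    hsm.tendsto_approxBounded_of_norm_le (hb0 x)
  rcases isEmpty_or_nonempty X with hX | ⟨⟨x0⟩⟩
  · simp [integral_of_isEmpty, VectorMeasure.integral_of_isEmpty]
  have hbn : 0 ≤ b := (norm_nonneg _).trans (hb0 x0)
  have hbd : ∀ n x, ‖hsm.approxBounded b n x‖ ≤ b := fun n x => hsm.norm_approxBounded_le hbn n x
  have l1 : Tendsto (fun n => ∫ᵛ x, hsm.approxBounded b n x ∂•μ) atTop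
      (𝓝 (∫ᵛ x, h x ∂•μ)) := by
    refine VectorMeasure.tendsto_integral_filter_of_norm_le_const
      (Eventually.of_forall fun n => (SimpleFunc.stronglyMeasurable _).aestronglyMeasurable)
      ⟨b, Eventually.of_forall fun n => Eventually.of_forall fun x => hbd n x⟩
      (Eventually.of_forall hlim)
  have l2 : Tendsto (fun n => ∫ x, hsm.approxBounded b n x ∂P) atTop (𝓝 (∫ x, h x ∂P)) := by
    refine tendsto_integral_of_dominated_convergence (fun _ => b)
      (fun n => (SimpleFunc.stronglyMeasurable _).aestronglyMeasurable)
      (integrable_const _) (fun n => Eventually.of_forall fun x => hbd n x)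
      (Eventually.of_forall hlim)
  have l3 : Tendsto (fun n => (inner ℝ f (∫ᵛ x, hsm.approxBounded b n x ∂•μ) : ℝ)) atTop
      (𝓝 (inner ℝ f (∫ᵛ x, h x ∂•μ))) := (tendsto_const_nhds.inner l1)
  simp only [hsimple] at l3
  exact tendsto_nhds_unique l3 l2

end VectorMeasure

/-- The integral operator of a linear SSP: `G h` stands for `∫ h dμ`. -/
theorem SSP.IsLinear.exists_integral_operator {S : Type*} {A : Type*} [MeasurableSpace S]
    [MeasurableSpace A] {M : SSP S A} {d : ℕ} {φ : S → A → EuclideanSpace ℝ (Fin d)}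
    (hM : M.IsLinear φ) :
    ∃ (θ : EuclideanSpace ℝ (Fin d)) (G : (Option S → ℝ) → EuclideanSpace ℝ (Fin d)),
      ‖θ‖ ≤ √d ∧ (∀ s a, M.cost s a = inner ℝ (φ s a) θ) ∧
      ∀ (h : Option S → ℝ) (b : ℝ), Measurable h → (∀ x, |h x| ≤ b) →
        ‖G h‖ ≤ √d * b ∧ ∀ s a, inner ℝ (φ s a) (G h) = ∫ x, h x ∂(M.trans (s, a)) := by
  obtain ⟨θ, μ, h1, h2, h3, h4⟩ := hM.exists_param
  have := M.isMarkov
  exact ⟨θ, fun h => ∫ᵛ x, h x ∂•μ, h1, h2, fun h b hm hb =>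
    ⟨h4 h b hm hb, fun s a => inner_integral_eq μ _ _ (h3 s a) hm hb⟩⟩

end LinearSSP

namespace LinearSSP

/-! ### A generalised elliptical potential lemma -/

theorem clip_mul_self (j : ℤ) (x : ℝ) : clip j x * x = min ((2 : ℝ) ^ j * |x|) (x ^ 2) := by
  have h2 : (0 : ℝ) < 2 ^ j := by positivity
  unfold clip
  generalize (2 : ℝ) ^ j = l at *
  rcases le_total 0 x with hx | hx
  · rw [abs_of_nonneg hx, max_eq_left (by linarith)]
    rcases le_total x l with h | h
    · rw [min_eq_left h, min_eq_right (by nlinarith)]; ring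
    · rw [min_eq_right h, min_eq_left (by nlinarith)]
  · rw [abs_of_nonpos hx]
    rcases le_total x (-l) with h | h
    · rw [max_eq_right h, min_eq_left (by linarith), min_eq_left (by nlinarith)]; ring
    · rw [max_eq_left h, min_eq_left (by linarith), min_eq_right (by nlinarith)]; ring

theorem abs_clip_le (j : ℤ) (x : ℝ) : |clip j x| ≤ 2 ^ j := by
  have h2 : (0 : ℝ) < 2 ^ j := by positivity
  unfold clip
  rw [abs_le]
  refine ⟨le_min (le_max_right _ _) (by linarith), min_le_right _ _⟩

theorem clip_of_abs_le {j : ℤ} {x : ℝ} (h : |x| ≤ 2 ^ j) : clip j x = x := by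
  unfold clip
  rw [max_eq_left (abs_le.1 h).1, min_eq_left (abs_le.1 h).2]

theorem clip_mul_self_nonneg (j : ℤ) (x : ℝ) : 0 ≤ clip j x * x := by
  rw [clip_mul_self]; positivity

theorem clip_mul_self_le_sq (j : ℤ) (x : ℝ) : clip j x * x ≤ x ^ 2 := by
  rw [clip_mul_self]; exact min_le_right _ _

/-- The function `min (2^j |x|, x²)` has slope at most `2 · 2^j`. This is the price of replacing a
vector by a grid point in the potential. -/
theorem clip_mul_self_sub_le (j : ℤ) (x y : ℝ) :
    clip j x * x ≤ clip j y * y + 2 * 2 ^ j * |x - y| := by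
  have h2 : (0 : ℝ) < 2 ^ j := by positivity
  rw [clip_mul_self, clip_mul_self]
  generalize (2 : ℝ) ^ j = l at *
  have h1 : |x| ≤ |y| + |x - y| := by
    calc |x| = |y + (x - y)| := by ring_nf
      _ ≤ _ := abs_add_le _ _
  have h4 := abs_nonneg (x - y)
  rw [← sq_abs x, ← sq_abs y]
  have hx := abs_nonneg x
  have hy := abs_nonneg y
  generalize |x - y| = r at *
  generalize |x| = a at *
  generalize |y| = b at *
  rcases le_total (l * b) (b ^ 2) with h | h
  · rw [min_eq_left h]
    refine (min_le_left _ _).trans ?_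
    nlinarith
  · rw [min_eq_right h]
    rcases le_total a l with h3 | h3
    · refine (min_le_right _ _).trans ?_
      have hbl : b = 0 ∨ b ≤ l := by
        rcases hy.eq_or_lt with h0 | h0
        · exact Or.inl h0.symm
        · right; by_contra hc; push Not at hc; nlinarith
      have hbl : b ≤ l := by rcases hbl with h0 | h0 <;> linarith
      rcases le_total a b with hab | hab
      · nlinarith
      · nlinarith
    · refine (min_le_left _ _).trans ?_
      have hbl : b ≤ l := by
        rcases hy.eq_or_lt with h0 | h0
        · linarith
        · by_contra hc; push Not at hc; nlinarith
      nlinarith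

/-- If clipped products are small compared with `clip_j(a) a`, so are squares. -/
theorem sum_sq_le_of_sum_clip_le {ι : Type*} {s : Finset ι} {x : ι → ℝ} {j : ℤ} {a : ℝ}
    (h : ∑ i ∈ s, clip j (x i) * x i < clip j a * a) : ∑ i ∈ s, x i ^ 2 ≤ a ^ 2 := by
  have h2 : (0 : ℝ) < 2 ^ j := by positivity
  have hlt : ∀ i ∈ s, clip j (x i) * x i < clip j a * a := fun i hi =>
    (Finset.single_le_sum (f := fun i => clip j (x i) * x i)
      (fun k _ => clip_mul_self_nonneg j (x k)) hi).trans_lt h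
  simp only [clip_mul_self] at h hlt
  generalize (2 : ℝ) ^ j = l at *
  -- As `min (l |x|, x²)` increases with `|x|`, every single `|x i|` is below `|a|`. If `|a| ≤ l`,
  -- nothing is clipped; otherwise `l x² ≤ |a| min (l |x|, x²)` converts the clipped sum into the
  -- quadratic one.
  have habs : ∀ i ∈ s, |x i| < |a| := by
    intro i hi
    by_contra hc
    push Not at hc
    refine absurd (hlt i hi) (not_lt.2 (min_le_min ?_ ?_))
    · gcongr
    · exact sq_le_sq.2 hc
  rcases le_total |a| l with ha | ha
  · have e1 : ∀ i ∈ s, min (l * |x i|) (x i ^ 2) = x i ^ 2 := fun i hi => by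
      rw [← sq_abs]
      exact min_eq_right (by nlinarith [habs i hi, abs_nonneg (x i)])
    rw [Finset.sum_congr rfl e1] at h
    exact h.le.trans (min_le_right _ _)
  · have e1 : ∀ i ∈ s, l * x i ^ 2 ≤ |a| * min (l * |x i|) (x i ^ 2) := fun i hi => by
      rcases min_choice (l * |x i|) (x i ^ 2) with h' | h'
      · rw [h', ← sq_abs]
        have h1 := mul_nonneg h2.le (abs_nonneg (x i))
        nlinarith [habs i hi]
      · rw [h']; gcongr
    have e2 : l * ∑ i ∈ s, x i ^ 2 ≤ l * a ^ 2 := by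
      calc l * ∑ i ∈ s, x i ^ 2 ≤ |a| * ∑ i ∈ s, min (l * |x i|) (x i ^ 2) := by
            rw [Finset.mul_sum, Finset.mul_sum]; exact Finset.sum_le_sum e1
        _ ≤ |a| * (l * |a|) := by gcongr; exact h.le.trans (min_le_left _ _)
        _ = l * a ^ 2 := by rw [← sq_abs]; ring
    exact le_of_mul_le_mul_left e2 h2

/-! ### Determinant growth and the counting of large inner products. -/

section Determinant

open Matrix

variable {d : ℕ}

/-- By the matrix determinant lemma the factor is `1 + xᵀV⁻¹x`, and Cauchy–Schwarz in the geometry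
of `V` gives `xᵀV⁻¹x ≥ (xᵀν)² / νᵀVν ≥ 1/2`. -/
theorem det_add_vecMulVec_ge {V : Matrix (Fin d) (Fin d) ℝ} (hV : V.PosDef) {x ν : Fin d → ℝ}
    (h0 : x ⬝ᵥ ν ≠ 0) (h : ν ⬝ᵥ V *ᵥ ν ≤ 2 * (x ⬝ᵥ ν) ^ 2) :
    3 / 2 * V.det ≤ (V + vecMulVec x x).det := by
  have hu : IsUnit V.det := hV.det_pos.ne'.isUnit
  rw [vecMulVec_eq Unit, det_add_replicateCol_mul_replicateRow hu]
  have hd : (1 + replicateRow Unit x * V⁻¹ * replicateCol Unit x).det = 1 + x ⬝ᵥ V⁻¹ *ᵥ x := by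
    rw [det_unique, Matrix.add_apply, one_apply_eq, Matrix.mul_assoc]
    rfl
  rw [hd]
  set z := V⁻¹ *ᵥ x with hz
  have hVz : V *ᵥ z = x := by
    rw [hz, mulVec_mulVec, mul_nonsing_inv _ hu, one_mulVec]
  have hsymm : ∀ p q : Fin d → ℝ, p ⬝ᵥ V *ᵥ q = q ⬝ᵥ V *ᵥ p := fun p q => by
    have hT : Vᵀ = V := by simpa using hV.isHermitian.eq
    rw [dotProduct_mulVec, dotProduct_comm, ← mulVec_transpose, hT]
  set a := x ⬝ᵥ ν with ha
  -- Cauchy–Schwarz by completing the square: positivity of the quadratic form at `V⁻¹x - ν / (2a)`,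
  -- where the multiple of `ν` is optimal in the extreme case `νᵀVν = 2a²`.
  have h1 := hV.posSemidef.dotProduct_mulVec_nonneg (z - (1 / (2 * a)) • ν)
  have h2 : star (z - (1 / (2 * a)) • ν) ⬝ᵥ V *ᵥ (z - (1 / (2 * a)) • ν) =
      x ⬝ᵥ z - 1 + (1 / (2 * a)) ^ 2 * (ν ⬝ᵥ V *ᵥ ν) := by
    rw [star_trivial, mulVec_sub, sub_dotProduct, dotProduct_sub, dotProduct_sub, hVz,
      mulVec_smul, smul_dotProduct, dotProduct_smul, smul_dotProduct, dotProduct_smul,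
      hsymm z ν, hVz, dotProduct_comm ν x, ← ha, dotProduct_comm z x]
    simp only [smul_eq_mul]
    field_simp
    ring
  rw [h2] at h1
  have h3 : (1 / (2 * a)) ^ 2 * (ν ⬝ᵥ V *ᵥ ν) ≤ (1 / (2 * a)) ^ 2 * (2 * a ^ 2) := by gcongr
  have h4 : (1 / (2 * a)) ^ 2 * (2 * a ^ 2) = 1 / 2 := by field_simp
  have h5 : 3 / 2 ≤ 1 + x ⬝ᵥ z := by linarith
  have := hV.det_pos
  nlinarith

theorem posSemidef_det_le_trace_pow {V : Matrix (Fin d) (Fin d) ℝ} (hV : V.PosSemidef) :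
    V.det ≤ V.trace ^ d := by
  rw [hV.isHermitian.det_eq_prod_eigenvalues, hV.isHermitian.trace_eq_sum_eigenvalues]
  simp only [RCLike.ofReal_real_eq_id, id]
  calc ∏ i, hV.isHermitian.eigenvalues i
      ≤ ∏ _i : Fin d, ∑ k, hV.isHermitian.eigenvalues k :=
        Finset.prod_le_prod (fun i _ => hV.eigenvalues_nonneg i) fun i _ =>
          Finset.single_le_sum (fun k _ => hV.eigenvalues_nonneg k) (Finset.mem_univ i)
    _ = _ := by simp

variable {φ ν : ℕ → EuclideanSpace ℝ (Fin d)}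

/-- Eluder-type counting lemma. -/
theorem card_mul_log_le (hd : 0 < d) (hφ : ∀ i, ‖φ i‖ ≤ 1) {D : ℝ} (hD : 0 < D) (I : Finset ℕ)
    (h0 : ∀ t ∈ I, (inner ℝ (φ t) (ν t) : ℝ) ≠ 0)
    (h1 : ∀ t ∈ I, ∑ i ∈ I with i < t, (inner ℝ (φ i) (ν t) : ℝ) ^ 2 ≤
      (inner ℝ (φ t) (ν t) : ℝ) ^ 2)
    (h2 : ∀ t ∈ I, ‖ν t‖ ^ 2 ≤ D * (inner ℝ (φ t) (ν t) : ℝ) ^ 2) :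
    I.card * Real.log (3 / 2) ≤ d * Real.log (d + I.card * D) := by
  set l : ℝ := 1 / D with hl
  have hl0 : 0 < l := by positivity
  -- The regulariser `1 / D` is chosen so that hypothesis `h2` bounds its contribution to `νᵀVν` by
  -- `(φᵀν)²`. With `h1` this yields the factor two required for one determinant step.
  set V : Finset ℕ → Matrix (Fin d) (Fin d) ℝ := fun J =>
    l • (1 : Matrix (Fin d) (Fin d) ℝ) + ∑ i ∈ J, vecMulVec (φ i).ofLp (φ i).ofLp with hV
  have hpd : ∀ J, (V J).PosDef := fun J => by
    refine (PosDef.one.smul hl0).add_posSemidef (posSemidef_sum _ fun i _ => ?_)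
    simpa using posSemidef_vecMulVec_self_star (φ i).ofLp
  have hinner : ∀ x y : EuclideanSpace ℝ (Fin d),
      (inner ℝ x y : ℝ) = x.ofLp ⬝ᵥ y.ofLp := fun x y => by
    rw [EuclideanSpace.inner_eq_star_dotProduct, star_trivial, dotProduct_comm]
  have hlow : (3 / 2 : ℝ) ^ I.card * l ^ d ≤ (V I).det := by
    -- Elements are added in increasing order. Restricting to initial segments of `I` makes the set
    -- present before `a` exactly the index set of the sum in `h1`.
    have : ∀ J : Finset ℕ, J ⊆ I → (∀ t ∈ J, ∀ i ∈ I, i < t → i ∈ J) →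
        (3 / 2 : ℝ) ^ J.card * l ^ d ≤ (V J).det := by
      intro J
      induction J using Finset.induction_on_max with
      | empty => simp [hV]
      | insert a s hmax ih =>
        intro hsub hdown
        have hna : a ∉ s := fun h => lt_irrefl _ (hmax a h)
        have haI : a ∈ I := hsub (Finset.mem_insert_self _ _)
        have hs : (Finset.filter (· < a) I) = s := by
          ext i
          simp only [Finset.mem_filter]
          constructor
          · rintro ⟨hi, hia⟩
            rcases Finset.mem_insert.1 (hdown a (Finset.mem_insert_self _ _) i hi hia) with h | h
            · omega
            · exact h
          · exact fun hi => ⟨hsub (Finset.mem_insert_of_mem hi), hmax i hi⟩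
        have hVins : V (insert a s) = V s + vecMulVec (φ a).ofLp (φ a).ofLp := by
          simp only [hV]
          rw [Finset.sum_insert hna]; abel
        have ihs := ih (fun i hi => hsub (Finset.mem_insert_of_mem hi)) (fun t ht i hi hit => by
          rcases Finset.mem_insert.1 (hdown t (Finset.mem_insert_of_mem ht) i hi hit) with h | h
          · have := hmax t ht; omega
          · exact h)
        rw [hVins, Finset.card_insert_of_notMem hna, pow_succ]
        have hstep := det_add_vecMulVec_ge (hpd s) (x := (φ a).ofLp) (ν := (ν a).ofLp)
          (by rw [← hinner]; exact h0 a haI) (by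
            simp only [hV]
            rw [add_mulVec, smul_mulVec, one_mulVec, sum_mulVec, dotProduct_add, dotProduct_smul,
              dotProduct_sum, ← hinner, ← hinner, smul_eq_mul, real_inner_self_eq_norm_sq]
            have e1 : ∀ i ∈ s, (ν a).ofLp ⬝ᵥ vecMulVec (φ i).ofLp (φ i).ofLp *ᵥ (ν a).ofLp =
                (inner ℝ (φ i) (ν a) : ℝ) ^ 2 := fun i _ => by
              rw [vecMulVec_mulVec, hinner]
              simp only [dotProduct_smul, MulOpposite.smul_eq_mul_unop, MulOpposite.unop_op]
              rw [dotProduct_comm]; ring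
            rw [Finset.sum_congr rfl e1]
            have e2 := h1 a haI
            rw [hs] at e2
            have e3 : l * ‖ν a‖ ^ 2 ≤ (inner ℝ (φ a) (ν a) : ℝ) ^ 2 := by
              rw [hl, one_div, inv_mul_le_iff₀ hD]; exact h2 a haI
            linarith)
        nlinarith
    exact this I le_rfl fun t _ i hi _ => hi
  have hup : (V I).det ≤ (d * l + I.card) ^ d := by
    refine (posSemidef_det_le_trace_pow (hpd I).posSemidef).trans ?_
    refine pow_le_pow_left₀ (hpd I).posSemidef.trace_nonneg ?_ _
    simp only [hV]
    rw [trace_add, trace_smul, trace_one, trace_sum, Fintype.card_fin, smul_eq_mul, mul_comm]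
    gcongr
    calc ∑ i ∈ I, (vecMulVec (φ i).ofLp (φ i).ofLp).trace ≤ ∑ i ∈ I, (1 : ℝ) := by
          refine Finset.sum_le_sum fun i _ => ?_
          rw [trace_vecMulVec, ← hinner, real_inner_self_eq_norm_sq]
          exact pow_le_one₀ (norm_nonneg _) (hφ i)
      _ = I.card := by simp
  have hd1 : (1 : ℝ) ≤ d := by exact_mod_cast hd
  have hpos : 0 < (d : ℝ) + I.card * D := by positivity
  have hfin : (3 / 2 : ℝ) ^ I.card ≤ (d + I.card * D) ^ d := by
    have e1 : (d * l + I.card) ^ d = (d + I.card * D) ^ d * l ^ d := by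
      rw [← mul_pow]; congr 1; rw [hl]; field_simp
    have := hlow.trans hup
    rw [e1] at this
    exact le_of_mul_le_mul_right this (by positivity)
  have := Real.log_le_log (by positivity) hfin
  rwa [Real.log_pow, Real.log_pow] at this

end Determinant

/-! ### Pigeonhole reduction of the clipped potential to determinants. -/

section Potential

variable {d : ℕ} {φ : ℕ → EuclideanSpace ℝ (Fin d)}

/-- `∑_{i < n} clip_j(φ_iᵀ ν) φ_iᵀ ν + 2^j ‖ν‖²` for a sequence of features. -/
noncomputable def seqPotential (φ : ℕ → EuclideanSpace ℝ (Fin d)) (j : ℤ) (n : ℕ)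
    (ν : EuclideanSpace ℝ (Fin d)) : ℝ :=
  ∑ i ∈ Finset.range n, clip j (inner ℝ (φ i) ν) * inner ℝ (φ i) ν + (2 : ℝ) ^ j * ‖ν‖ ^ 2

theorem seqPotential_nonneg (j : ℤ) (n : ℕ) (ν : EuclideanSpace ℝ (Fin d)) :
    0 ≤ seqPotential φ j n ν :=
  add_nonneg (Finset.sum_nonneg fun _ _ => clip_mul_self_nonneg _ _) (by positivity)

theorem seqPotential_succ (j : ℤ) (n : ℕ) (ν : EuclideanSpace ℝ (Fin d)) :
    seqPotential φ j (n + 1) ν =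
      seqPotential φ j n ν + clip j (inner ℝ (φ n) ν) * inner ℝ (φ n) ν := by
  unfold seqPotential
  rw [Finset.sum_range_succ]; ring

/-- Pigeonhole: if the whole past sum is below `m` times the new term, then one of `m` colour
classes has past sum below the new term, and `t` joins that class. Colours already given are
unaffected, so the property persists. -/
theorem exists_colouring (j : ℕ → ℤ) (ν : ℕ → EuclideanSpace ℝ (Fin d)) {m : ℕ} (hm : 0 < m)
    (A : Finset ℕ)
    (hA : ∀ t ∈ A, seqPotential φ (j t) t (ν t) <
      m * (clip (j t) (inner ℝ (φ t) (ν t)) * inner ℝ (φ t) (ν t))) :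
    ∃ col : ℕ → Fin m, ∀ t ∈ A, ∑ i ∈ A with i < t ∧ col i = col t,
      clip (j t) (inner ℝ (φ i) (ν t)) * inner ℝ (φ i) (ν t) <
        clip (j t) (inner ℝ (φ t) (ν t)) * inner ℝ (φ t) (ν t) := by
  induction A using Finset.induction_on_max with
  | empty => exact ⟨fun _ => ⟨0, hm⟩, by simp⟩
  | insert a s hmax ih =>
    obtain ⟨col, hcol⟩ := ih fun t ht => hA t (Finset.mem_insert_of_mem ht)
    set F : ℕ → ℝ := fun i => clip (j a) (inner ℝ (φ i) (ν a)) * inner ℝ (φ i) (ν a) with hF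
    have h1 : ∑ c : Fin m, ∑ i ∈ s with col i = c, F i < ∑ _c : Fin m, F a := by
      rw [Finset.sum_fiberwise]
      have e1 : ∑ i ∈ s, F i ≤ ∑ i ∈ Finset.range a, F i :=
        Finset.sum_le_sum_of_subset_of_nonneg (fun i hi => Finset.mem_range.2 (hmax i hi))
          fun i _ _ => clip_mul_self_nonneg _ _
      have e2 := hA a (Finset.mem_insert_self _ _)
      have e3 : 0 ≤ (2 : ℝ) ^ (j a) * ‖ν a‖ ^ 2 := by positivity
      rw [Finset.sum_const, Finset.card_univ, Fintype.card_fin, nsmul_eq_mul]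
      unfold seqPotential at e2
      linarith
    obtain ⟨c, -, hc⟩ := Finset.exists_lt_of_sum_lt h1
    refine ⟨Function.update col a c, fun t ht => ?_⟩
    rcases Finset.mem_insert.1 ht with rfl | hts
    · have hfil : ((insert t s).filter fun i => i < t ∧
          Function.update col t c i = Function.update col t c t) = s.filter fun i => col i = c := by
        ext i
        simp only [Finset.mem_filter, Finset.mem_insert, Function.update_self]
        constructor
        · rintro ⟨rfl | hi, hlt, h⟩
          · exact absurd hlt (lt_irrefl _)
          · rw [Function.update_of_ne hlt.ne] at h; exact ⟨hi, h⟩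
        · rintro ⟨hi, h⟩
          have := hmax i hi
          exact ⟨Or.inr hi, this, by rw [Function.update_of_ne this.ne]; exact h⟩
      rw [hfil]
      exact hc
    · have hta := hmax t hts
      have hfil : ((insert a s).filter fun i => i < t ∧
          Function.update col a c i = Function.update col a c t) =
          s.filter fun i => i < t ∧ col i = col t := by
        ext i
        simp only [Finset.mem_filter, Finset.mem_insert]
        rw [Function.update_of_ne hta.ne]
        constructor
        · rintro ⟨rfl | hi, hlt, h⟩
          · omega
          · rw [Function.update_of_ne (by omega)] at h; exact ⟨hi, hlt, h⟩
        · rintro ⟨hi, hlt, h⟩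
          exact ⟨Or.inr hi, hlt, by rw [Function.update_of_ne (by omega)]; exact h⟩
      rw [hfil]
      exact hcol t hts

/-- Within a colour class the clipped past sum is smaller than the current term, so
`sum_sq_le_of_sum_clip_le` removes the clipping and the determinant count applies to each of the `m`
classes. The regulariser `2^j ‖ν‖²` of the potential supplies the norm condition with `D = m / e`.
-/
theorem card_mul_log_le_of_potential (hd : 0 < d) (hφ : ∀ i, ‖φ i‖ ≤ 1) (j : ℕ → ℤ)
    (ν : ℕ → EuclideanSpace ℝ (Fin d)) {m : ℕ} (hm : 0 < m) {e : ℝ} (he : 0 < e)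
    (hj : ∀ t, e ≤ (2 : ℝ) ^ (j t)) (A : Finset ℕ)
    (hA : ∀ t ∈ A, seqPotential φ (j t) t (ν t) <
      m * (clip (j t) (inner ℝ (φ t) (ν t)) * inner ℝ (φ t) (ν t))) :
    A.card * Real.log (3 / 2) ≤ m * (d * Real.log (d + A.card * (m / e))) := by
  obtain ⟨col, hcol⟩ := exists_colouring j ν hm A hA
  have hm0 : (0 : ℝ) < m := by exact_mod_cast hm
  have hd1 : (1 : ℝ) ≤ d := by exact_mod_cast hd
  have hc : ∀ c : Fin m, ((A.filter fun t => col t = c).card : ℝ) * Real.log (3 / 2) ≤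
      d * Real.log (d + A.card * (m / e)) := by
    intro c
    refine (card_mul_log_le (φ := φ) (ν := ν) hd hφ (D := m / e) (by positivity) _
      ?_ ?_ ?_).trans ?_
    · intro t ht h0
      have := hA t (Finset.mem_filter.1 ht).1
      rw [h0, mul_zero, mul_zero] at this
      exact absurd this (not_lt.2 (seqPotential_nonneg _ _ _))
    · intro t ht
      obtain ⟨htA, htc⟩ := Finset.mem_filter.1 ht
      refine sum_sq_le_of_sum_clip_le (j := j t) ?_
      convert hcol t htA using 2
      rw [Finset.filter_filter]
      ext i
      simp only [Finset.mem_filter, htc]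
      tauto
    · intro t ht
      have h1 := hA t (Finset.mem_filter.1 ht).1
      have h2 := clip_mul_self_le_sq (j t) (inner ℝ (φ t) (ν t))
      have h3 : (2 : ℝ) ^ (j t) * ‖ν t‖ ^ 2 ≤ seqPotential φ (j t) t (ν t) := by
        unfold seqPotential
        have : 0 ≤ ∑ i ∈ Finset.range t, clip (j t) (inner ℝ (φ i) (ν t)) * inner ℝ (φ i) (ν t) :=
          Finset.sum_nonneg fun _ _ => clip_mul_self_nonneg _ _
        linarith
      have h4 : e * ‖ν t‖ ^ 2 ≤ m * (inner ℝ (φ t) (ν t) : ℝ) ^ 2 := by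
        calc e * ‖ν t‖ ^ 2 ≤ (2 : ℝ) ^ (j t) * ‖ν t‖ ^ 2 := by gcongr; exact hj t
          _ ≤ _ := h3.trans h1.le
          _ ≤ _ := by gcongr
      rw [div_mul_eq_mul_div, le_div_iff₀ he]
      linarith
    · gcongr
      exact Finset.filter_subset _ _
  have hsum : (A.card : ℝ) = ∑ c : Fin m, ((A.filter fun t => col t = c).card : ℝ) := by
    exact_mod_cast Finset.card_eq_sum_card_fiberwise (f := col) (t := Finset.univ) (by simp)
  rw [hsum, Finset.sum_mul, ← hsum]
  calc _ ≤ ∑ _c : Fin m, d * Real.log (d + A.card * (m / e)) := Finset.sum_le_sum fun c _ => hc c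
    _ = _ := by simp

/-- The bound of the generalised elliptical potential lemma. -/
noncomputable def potentialBound (d T : ℕ) (e : ℝ) : ℝ :=
  2 * (Nat.log 2 T + 1) * (5 / 2 * d * Real.log (d + 2 * T ^ 2 / e)) + 1

theorem two_fifths_le_log : 2 / 5 ≤ Real.log (3 / 2) := by
  rw [Real.le_log_iff_exp_le (by norm_num)]
  have h1 : Real.exp (2 / 5) ^ 5 = Real.exp 1 ^ 2 := by
    rw [← Real.exp_nat_mul, ← Real.exp_nat_mul]; norm_num
  have h2 : Real.exp 1 ^ 2 ≤ (3 / 2 : ℝ) ^ 5 := by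
    have := Real.exp_one_lt_d9
    have h0 := Real.exp_pos 1
    nlinarith
  rw [← h1] at h2
  exact le_of_pow_le_pow_left₀ (by norm_num) (by norm_num) h2

/-- **Generalised elliptical potential lemma** for clipped quadratic forms. -/
theorem sum_min_one_div_potential_le (hd : 0 < d) (hφ : ∀ i, ‖φ i‖ ≤ 1) (j : ℕ → ℤ)
    (ν : ℕ → EuclideanSpace ℝ (Fin d)) {e : ℝ} (he : 0 < e)
    (hj : ∀ t, e ≤ (2 : ℝ) ^ (j t)) (T : ℕ) :
    ∑ t ∈ Finset.range T, min 1 (clip (j t) (inner ℝ (φ t) (ν t)) * inner ℝ (φ t) (ν t) /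
      seqPotential φ (j t) t (ν t)) ≤ potentialBound d T e := by
  set g : ℕ → ℝ := fun t => min 1 (clip (j t) (inner ℝ (φ t) (ν t)) * inner ℝ (φ t) (ν t) /
      seqPotential φ (j t) t (ν t)) with hg
  have hd1 : (1 : ℝ) ≤ d := by exact_mod_cast hd
  rcases Nat.eq_zero_or_pos T with rfl | hT
  · simp only [Finset.range_zero, Finset.sum_empty, potentialBound]
    have : 0 ≤ Real.log (d + 2 * ((0 : ℕ) : ℝ) ^ 2 / e) := Real.log_nonneg (by simp [hd1])
    positivity
  set N := Nat.log 2 T with hN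
  set E : ℝ := 5 / 2 * d * Real.log (d + 2 * T ^ 2 / e) with hE
  have hT1 : (1 : ℝ) ≤ T := by exact_mod_cast hT
  have hg1 : ∀ t, g t ≤ 1 := fun t => min_le_left _ _
  -- A growth term above `2^{-(s+1)}` means that the potential is below `2^{s+1}` times the new
  -- term; this is the counting lemma with `2^{s+1}` colours.
  have hcount : ∀ s ≤ N, (((Finset.range T).filter fun t => (1 / 2 : ℝ) ^ (s + 1) < g t).card : ℝ)
      ≤ 2 ^ (s + 1) * E := by
    intro s hs
    set A := (Finset.range T).filter fun t => (1 / 2 : ℝ) ^ (s + 1) < g t with hA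
    have hpow : ((2 ^ (s + 1) : ℕ) : ℝ) ≤ 2 * T := by
      have : 2 ^ (s + 1) ≤ 2 * T := by
        rw [pow_succ, mul_comm]
        exact Nat.mul_le_mul_left 2 ((Nat.pow_le_pow_right (by norm_num) hs).trans
          (Nat.pow_log_le_self 2 hT.ne'))
      exact_mod_cast this
    have hcardT : (A.card : ℝ) ≤ T := by
      have : A.card ≤ (Finset.range T).card := Finset.card_filter_le _ _
      rw [Finset.card_range] at this
      exact_mod_cast this
    have h1 := card_mul_log_le_of_potential hd hφ j ν (m := 2 ^ (s + 1)) (by positivity) he hj A ?_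
    · have h2 : (2 ^ (s + 1) : ℕ) * (d * Real.log (d + A.card * ((2 ^ (s + 1) : ℕ) / e))) ≤
          (2 ^ (s + 1) : ℕ) * (d * Real.log (d + 2 * T ^ 2 / e)) := by
        gcongr
        calc (A.card : ℝ) * ((2 ^ (s + 1) : ℕ) / e) ≤ T * (2 * T / e) := by gcongr
          _ = 2 * T ^ 2 / e := by ring
      have h3 : (A.card : ℝ) * (2 / 5) ≤ A.card * Real.log (3 / 2) := by
        gcongr; exact two_fifths_le_log
      push_cast at h2 h1
      rw [hE]
      linarith
    · intro t ht
      have h2 := (Finset.mem_filter.1 ht).2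
      have h3 := h2.trans_le (min_le_right _ _)
      have hp : 0 < seqPotential φ (j t) t (ν t) := by
        rcases (seqPotential_nonneg (φ := φ) (j t) t (ν t)).eq_or_lt with h0 | h0
        · rw [← h0, div_zero] at h3
          exact absurd h3 (not_lt.2 (by positivity))
        · exact h0
      rw [lt_div_iff₀ hp, one_div, inv_pow, inv_mul_lt_iff₀ (by positivity)] at h3
      push_cast
      exact h3
  -- Dyadic layer decomposition. Layer `s` has weight `2^{-s}` and at most `2^{s+1} E` members, so
  -- each layer contributes `2 E`; stopping at `N = log₂ T` leaves a total remainder of at most one.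
  have hpt : ∀ t, g t ≤ ∑ s ∈ Finset.range (N + 1),
      (1 / 2 : ℝ) ^ s * (if (1 / 2 : ℝ) ^ (s + 1) < g t then 1 else 0) + (1 / 2 : ℝ) ^ (N + 1) := by
    intro t
    have : ∀ n, g t ≤ ∑ s ∈ Finset.range n,
        (1 / 2 : ℝ) ^ s * (if (1 / 2 : ℝ) ^ (s + 1) < g t then 1 else 0) + (1 / 2 : ℝ) ^ n := by
      intro n
      induction n with
      | zero => simpa using hg1 t
      | succ n ih =>
        rw [Finset.sum_range_succ]
        by_cases h : (1 / 2 : ℝ) ^ (n + 1) < g t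
        · rw [if_pos h]
          have : (0 : ℝ) < (1 / 2) ^ (n + 1) := by positivity
          linarith
        · rw [if_neg h]
          have : 0 ≤ ∑ s ∈ Finset.range n,
              (1 / 2 : ℝ) ^ s * (if (1 / 2 : ℝ) ^ (s + 1) < g t then 1 else 0) :=
            Finset.sum_nonneg fun s _ => by positivity
          linarith
    exact this (N + 1)
  calc ∑ t ∈ Finset.range T, g t
      ≤ ∑ t ∈ Finset.range T, (∑ s ∈ Finset.range (N + 1),
        (1 / 2 : ℝ) ^ s * (if (1 / 2 : ℝ) ^ (s + 1) < g t then 1 else 0) + (1 / 2 : ℝ) ^ (N + 1)) :=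
        Finset.sum_le_sum fun t _ => hpt t
    _ = ∑ s ∈ Finset.range (N + 1), (1 / 2 : ℝ) ^ s *
          (((Finset.range T).filter fun t => (1 / 2 : ℝ) ^ (s + 1) < g t).card : ℝ) +
          T * (1 / 2 : ℝ) ^ (N + 1) := by
        rw [Finset.sum_add_distrib, Finset.sum_comm]
        congr 1
        · refine Finset.sum_congr rfl fun s _ => ?_
          rw [← Finset.mul_sum, Finset.sum_boole]
        · simp
    _ ≤ ∑ s ∈ Finset.range (N + 1), 2 * E + 1 := by
        refine add_le_add (Finset.sum_le_sum fun s hs => ?_) ?_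
        · have h1 := hcount s (Nat.lt_succ_iff.1 (Finset.mem_range.1 hs))
          calc (1 / 2 : ℝ) ^ s * _ ≤ (1 / 2 : ℝ) ^ s * (2 ^ (s + 1) * E) := by gcongr
            _ = ((1 / 2) * 2) ^ s * (2 * E) := by rw [mul_pow]; ring
            _ = 2 * E := by norm_num
        · have h1 : (T : ℝ) ≤ 2 ^ (N + 1) := by
            exact_mod_cast (Nat.lt_pow_succ_log_self (by norm_num) T).le
          calc (T : ℝ) * (1 / 2) ^ (N + 1) ≤ 2 ^ (N + 1) * (1 / 2) ^ (N + 1) := by gcongr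
            _ = 1 := by rw [← mul_pow]; norm_num
    _ = potentialBound d T e := by
        rw [Finset.sum_const, Finset.card_range, potentialBound, nsmul_eq_mul]
        push_cast
        ring

end Potential

end LinearSSP

namespace LinearSSP

/-! ### Value functions -/

section OptValue

variable {S : Type*} {A : Type*} {d : ℕ} {φ : S → A → EuclideanSpace ℝ (Fin d)}

theorem optValue_nonneg [Nonempty A] {w : EuclideanSpace ℝ (Fin d)} {B : ℝ} (hB : 0 ≤ B)
    (x : Option S) : 0 ≤ optValue φ w B x := by
  cases x with
  | none => exact le_rfl
  | some s => exact le_ciInf fun a => le_min (le_max_right _ _) (by linarith)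

theorem optValue_le_apply [Finite A] {w : EuclideanSpace ℝ (Fin d)} {B : ℝ} (s : S) (a : A) :
    optValue φ w B (some s) ≤ min (max (inner ℝ (φ s a) w) 0) (2 * B) :=
  ciInf_le (Set.finite_range _).bddBelow a

theorem optValue_le [Nonempty A] [Finite A] {w : EuclideanSpace ℝ (Fin d)} {B : ℝ} (hB : 0 ≤ B)
    (x : Option S) : optValue φ w B x ≤ 2 * B := by
  cases x with
  | none => simpa [optValue] using hB
  | some s =>
    obtain ⟨a⟩ := ‹Nonempty A›
    exact (optValue_le_apply s a).trans (min_le_right _ _)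

theorem optValue_eq_of_argmin [Finite A] {w : EuclideanSpace ℝ (Fin d)} {B : ℝ} {s : S} {a : A}
    (ha : ∀ a', (inner ℝ (φ s a) w : ℝ) ≤ inner ℝ (φ s a') w) :
    optValue φ w B (some s) = min (max (inner ℝ (φ s a) w) 0) (2 * B) := by
  have : Nonempty A := ⟨a⟩
  refine le_antisymm (optValue_le_apply s a) (le_ciInf fun a' => ?_)
  exact min_le_min_right _ (max_le_max_right _ (ha a'))

/-- Clipping and minimisation over actions are nonexpansive and features have norm at most one. The
estimate serves both the covering arguments and the compactness of the feasible set. -/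
theorem abs_optValue_sub_le [Nonempty A] [Finite A] (hφ : ∀ s a, ‖φ s a‖ ≤ 1)
    (w w' : EuclideanSpace ℝ (Fin d)) (B : ℝ) (x : Option S) :
    |optValue φ w B x - optValue φ w' B x| ≤ ‖w - w'‖ := by
  cases x with
  | none => simp [optValue]
  | some s =>
    have key : ∀ u u' : EuclideanSpace ℝ (Fin d),
        optValue φ u B (some s) - ‖u - u'‖ ≤ optValue φ u' B (some s) := by
      intro u u'
      refine le_ciInf fun a => ?_
      have h1 := optValue_le_apply (φ := φ) (w := u) (B := B) s a
      have h2 : (inner ℝ (φ s a) u : ℝ) ≤ inner ℝ (φ s a) u' + ‖u - u'‖ := by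
        have : (inner ℝ (φ s a) (u - u') : ℝ) ≤ ‖u - u'‖ :=
          (real_inner_le_norm _ _).trans (mul_le_of_le_one_left (norm_nonneg _) (hφ s a))
        rw [inner_sub_right] at this; linarith
      have h3 := norm_nonneg (u - u')
      have h4 : min (max (inner ℝ (φ s a) u : ℝ) 0) (2 * B) ≤
          min (max (inner ℝ (φ s a) u' : ℝ) 0) (2 * B) + ‖u - u'‖ := by
        rw [← min_add_add_right, ← max_add_add_right]
        exact min_le_min (max_le_max h2 (by linarith)) (by linarith)
      linarith
    rw [abs_le]
    constructor
    · have := key w' w; rw [norm_sub_rev] at this; linarith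
    · have := key w w'; linarith

theorem continuous_optValue [Nonempty A] [Finite A] (hφ : ∀ s a, ‖φ s a‖ ≤ 1) (B : ℝ)
    (x : Option S) : Continuous fun w => optValue φ w B x := by
  have : LipschitzWith 1 fun w => optValue φ w B x :=
    LipschitzWith.of_dist_le_mul fun w w' => by
      rw [Real.dist_eq, dist_eq_norm, NNReal.coe_one, one_mul]
      exact abs_optValue_sub_le hφ w w' B x
  exact this.continuous

end OptValue

/-! ### Measurability on the state space with the goal added. -/

section OptionMeasurable

variable {S : Type*} [MeasurableSpace S]

theorem measurable_option_iff {Y : Type*} [MeasurableSpace Y] {f : Option S → Y} :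
    Measurable f ↔ Measurable fun s => f (some s) := Iff.rfl

theorem measurable_option_getD (s₀ : S) : Measurable fun x : Option S => x.getD s₀ :=
  measurable_option_iff.2 measurable_id

theorem measurableSet_none : MeasurableSet ({none} : Set (Option S)) := by
  change MeasurableSet (some ⁻¹' ({none} : Set (Option S)))
  have : some ⁻¹' ({none} : Set (Option S)) = ∅ := by ext; simp
  rw [this]
  exact MeasurableSet.empty

theorem measurable_optValue {A : Type*} [Finite A] [MeasurableSpace A] [Nonempty S] {d : ℕ}
    {φ : S → A → EuclideanSpace ℝ (Fin d)} (hφ : Measurable fun q : S × A => φ q.1 q.2)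
    {Ω' : Type*} [MeasurableSpace Ω'] {w : Ω' → EuclideanSpace ℝ (Fin d)} {B : Ω' → ℝ}
    (hw : Measurable w) (hB : Measurable B) :
    Measurable fun p : Ω' × Option S => optValue φ (w p.1) (B p.1) p.2 := by
  classical
  obtain ⟨s₀⟩ := ‹Nonempty S›
  have h1 : (fun p : Ω' × Option S => optValue φ (w p.1) (B p.1) p.2) =
      fun p => if p.2 ∈ ({none} : Set (Option S)) then 0 else
        ⨅ a, min (max (inner ℝ (φ (p.2.getD s₀) a) (w p.1)) 0) (2 * B p.1) := by
    funext p
    rcases p with ⟨o, _ | s⟩ <;> simp [optValue]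
  rw [h1]
  refine Measurable.ite (measurable_snd measurableSet_none) measurable_const ?_
  refine Measurable.iInf fun a => ?_
  have h2 : Measurable fun p : Ω' × Option S => φ (p.2.getD s₀) a :=
    hφ.comp (((measurable_option_getD s₀).comp measurable_snd).prodMk measurable_const)
  exact ((h2.inner (hw.comp measurable_fst)).max measurable_const).min
    ((hB.comp measurable_fst).const_mul 2)

theorem measurable_optValue_const {A : Type*} [Finite A] [MeasurableSpace A] [Nonempty S] {d : ℕ}
    {φ : S → A → EuclideanSpace ℝ (Fin d)} (hφ : Measurable fun q : S × A => φ q.1 q.2)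
    (w : EuclideanSpace ℝ (Fin d)) (B : ℝ) : Measurable (optValue φ w B) :=
  (measurable_optValue hφ (Ω' := Unit) (w := fun _ => w) (B := fun _ => B) measurable_const
    measurable_const).comp (measurable_prodMk_left (x := ()))

end OptionMeasurable

/-! ### Martingale structure of the interaction -/

section Interaction

variable {S : Type*} {A : Type*} [MeasurableSpace S] [MeasurableSpace A]
  {M : SSP S A} {d : ℕ} {φ : S → A → EuclideanSpace ℝ (Fin d)} {e δ : ℝ}
  {Ω : Type*} [mΩ : MeasurableSpace Ω] {Pr : Measure Ω}
  {ℱ : Filtration ℕ mΩ} {a : ℕ → Ω → A} {y : ℕ → Ω → Option S}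
  {wt : ℕ → Ω → EuclideanSpace ℝ (Fin d)} {Bt : ℕ → Ω → ℝ}

theorem SSP.IsInteraction.measurable_state (h : M.IsInteraction φ e δ Pr ℱ a y wt Bt) (n : ℕ) :
    Measurable[ℱ n] fun ω => M.stateSeq (y · ω) n := by
  cases n with
  | zero => exact measurable_const
  | succ n => exact (measurable_option_getD M.init).comp (h.measurable_next n)

theorem SSP.IsInteraction.measurable_feat (h : M.IsInteraction φ e δ Pr ℱ a y wt Bt)
    (hφ : Measurable fun q : S × A => φ q.1 q.2) (n : ℕ) :
    Measurable[ℱ n] fun ω => (M.trajectory (a · ω) (y · ω)).feat φ n :=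
  hφ.comp ((h.measurable_state n).prodMk (h.measurable_action n))

/-- The expectation of `v` under the transition of step `n`. -/
noncomputable def SSP.stepMean (M : SSP S A) (x : Trajectory S A) (v : Option S → ℝ) (n : ℕ) : ℝ :=
  ∫ o, v o ∂(M.trans (x.state n, x.action n))

/-- For predictable multipliers `c` and predictable value functions `v`, the products of `c` with
the deviations `P v - v(s')` are bounded martingale differences. Allowing random `v` covers fixed
grid functions as well as the learner's own. -/
theorem SSP.IsInteraction.expDominated [IsProbabilityMeasure Pr]
    (h : M.IsInteraction φ e δ Pr ℱ a y wt Bt)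
    {c : ℕ → Ω → ℝ} (hc : ∀ n, Measurable[ℱ n] (c n)) {v : ℕ → Ω → Option S → ℝ}
    (hv : ∀ n, Measurable[(ℱ n).prod inferInstance] fun p : Ω × Option S => v n p.1 p.2)
    {b₁ b₂ : ℝ} (hb₁ : ∀ n ω, |c n ω| ≤ b₁) (hv0 : ∀ n ω o, 0 ≤ v n ω o)
    (hb₂ : ∀ n ω o, v n ω o ≤ b₂) :
    ExpDominated Pr ℱ (fun n ω => c n ω *
      (M.stepMean (M.trajectory (a · ω) (y · ω)) (v n ω) n - v n ω (y n ω))) (b₁ * b₂) ∧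
    (∀ n, Measurable[ℱ n] fun ω => M.stepMean (M.trajectory (a · ω) (y · ω)) (v n ω) n) ∧
    (∀ n, Measurable[ℱ (n + 1)] (fun ω => c n ω *
      (M.stepMean (M.trajectory (a · ω) (y · ω)) (v n ω) n - v n ω (y n ω)))) ∧
    ∀ n ω, |c n ω *
      (M.stepMean (M.trajectory (a · ω) (y · ω)) (v n ω) n - v n ω (y n ω))| ≤ b₁ * b₂ := by
  have := M.isMarkov
  have hvn : ∀ n ω, Measurable (v n ω) := fun n ω =>
    (hv n).comp (@measurable_prodMk_left Ω (Option S) (ℱ n) _ ω)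
  have hint : ∀ n ω (q : S × A), Integrable (v n ω) (M.trans q) := fun n ω q =>
    Integrable.of_bound (hvn n ω).aestronglyMeasurable b₂ (Eventually.of_forall fun o => by
      rw [Real.norm_eq_abs, abs_of_nonneg (hv0 n ω o)]; exact hb₂ n ω o)
  have hmean0 : ∀ n ω (q : S × A), 0 ≤ ∫ o, v n ω o ∂(M.trans q) := fun n ω q =>
    integral_nonneg (hv0 n ω)
  have hmean : ∀ n ω (q : S × A), ∫ o, v n ω o ∂(M.trans q) ≤ b₂ := fun n ω q => by
    calc ∫ o, v n ω o ∂(M.trans q) ≤ ∫ _o, b₂ ∂(M.trans q) :=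
          integral_mono (hint n ω q) (integrable_const _) (hb₂ n ω)
      _ = b₂ := by simp
  have hbd : ∀ n ω (q : S × A) o, |c n ω * (∫ o, v n ω o ∂(M.trans q) - v n ω o)| ≤ b₁ * b₂ := by
    intro n ω q o
    rw [abs_mul]
    refine mul_le_mul (hb₁ n ω) ?_ (abs_nonneg _) ((abs_nonneg _).trans (hb₁ n ω))
    rw [abs_le]
    constructor <;> linarith [hmean0 n ω q, hmean n ω q, hv0 n ω o, hb₂ n ω o]
  have hq : ∀ n, Measurable[ℱ n] fun ω => (M.stateSeq (y · ω) n, a n ω) := fun n =>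
    (h.measurable_state n).prodMk (h.measurable_action n)
  have hmm : ∀ n, Measurable[ℱ n] fun ω =>
      M.stepMean (M.trajectory (a · ω) (y · ω)) (v n ω) n := by
    intro n
    let _ : MeasurableSpace Ω := ℱ n
    set κ : Kernel Ω (Option S) := M.trans.comap _ (hq n) with hκ
    exact ((hv n).stronglyMeasurable.integral_kernel_prod_right' (κ := κ)).measurable
  refine ⟨?_, hmm, ?_, fun n ω => hbd n ω _ _⟩
  · intro n l hl Z hZ
    -- The law of `s'_n` given `ℱ n` is the transition kernel pulled back along the predictable pair
    -- `(s_n, a_n)`; the one-step bound is applied to the identity map from `Ω` to `Ω` with the past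
    -- σ-algebra.
    set κ : @Kernel Ω (Option S) (ℱ n) _ := @Kernel.comap _ _ _ _ _ (ℱ n) M.trans _ (hq n) with hκ
    have hκm : @IsMarkovKernel _ _ (ℱ n) _ κ := by
      rw [hκ]; exact @Kernel.IsMarkovKernel.comap _ _ _ _ _ (ℱ n) _ M.trans _ (hq n)
    have hy : Measurable (y n) := (h.measurable_next n).mono (ℱ.le _) le_rfl
    have key := @lintegral_mul_exp_le Ω Ω (Option S) mΩ (ℱ n) _ Pr _ id (y n)
      (measurable_id'' (ℱ.le n)) hy κ hκm
      (fun F E hF hE => h.law_next n F E hF hE) Z hZ (fun p => v n p.1 p.2) (hv n)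
      (fun ω => l * c n ω) ((hc n).const_mul l) (fun ω => hint n ω _) (fun ω o => by
        rw [mul_assoc, abs_mul]
        refine le_trans ?_ hl
        gcongr
        exact hbd n ω _ o)
    simp only [mul_assoc] at key
    exact key
  · intro n
    have h1 : Measurable[ℱ (n + 1)] fun ω => v n ω (y n ω) := by
      have h2 : Measurable[ℱ (n + 1), (ℱ n).prod inferInstance] fun ω => (ω, y n ω) :=
        @Measurable.prodMk Ω (ℱ (n + 1)) Ω (Option S) (ℱ n) _ _ _
          (measurable_id'' (ℱ.mono n.le_succ)) (h.measurable_next n)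
      exact (hv n).comp h2
    exact ((hc n).mono (ℱ.mono n.le_succ) le_rfl).mul
      (((hmm n).mono (ℱ.mono n.le_succ) le_rfl).sub h1)

end Interaction

end LinearSSP

namespace LinearSSP

/-! ### Grids and clipping levels -/

section Grid

variable {d : ℕ}

/-- Each coordinate is rounded towards zero, not to the nearest multiple. Then the norm does not
grow, so the grid point stays in the ball and the regulariser of the potential does not increase. -/
theorem exists_mem_grid_near {ξ R : ℝ} (hξ : 0 < ξ) {ν : EuclideanSpace ℝ (Fin d)} (hν : ‖ν‖ ≤ R) :
    ∃ ν' ∈ grid d ξ R, ‖ν'‖ ≤ ‖ν‖ ∧ ‖ν - ν'‖ ≤ √d * ξ := by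
  set k : Fin d → ℤ := fun i => if 0 ≤ ν i then ⌊ν i / ξ⌋ else ⌈ν i / ξ⌉ with hk
  have h1 : ∀ i, |(k i : ℝ) * ξ| ≤ |ν i| ∧ |ν i - k i * ξ| ≤ ξ := by
    intro i
    have hmul : ν i / ξ * ξ = ν i := by field_simp
    simp only [hk]
    split_ifs with h
    · have a1 : (0 : ℝ) ≤ ⌊ν i / ξ⌋ := by
        exact_mod_cast Int.floor_nonneg.2 (by positivity)
      have a2 : (⌊ν i / ξ⌋ : ℝ) * ξ ≤ ν i := by
        rw [← hmul]; simp only [mul_div_cancel_right₀ _ hξ.ne']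
        gcongr; exact Int.floor_le _
      have a3 : ν i ≤ (⌊ν i / ξ⌋ + 1 : ℝ) * ξ := by
        calc ν i = ν i / ξ * ξ := hmul.symm
          _ ≤ _ := by gcongr; exact (Int.lt_floor_add_one _).le
      rw [abs_of_nonneg (by positivity), abs_of_nonneg h, abs_of_nonneg (by linarith)]
      exact ⟨a2, by linarith⟩
    · push Not at h
      have h0 : ν i / ξ ≤ 0 := by
        rw [div_le_iff₀ hξ]; linarith
      have a1 : (⌈ν i / ξ⌉ : ℝ) ≤ 0 := by
        exact_mod_cast Int.ceil_le.2 (by simpa using h0)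
      have a2 : ν i ≤ (⌈ν i / ξ⌉ : ℝ) * ξ := by
        calc ν i = ν i / ξ * ξ := hmul.symm
          _ ≤ _ := by gcongr; exact Int.le_ceil _
      have a3 : (⌈ν i / ξ⌉ - 1 : ℝ) * ξ ≤ ν i := by
        calc (⌈ν i / ξ⌉ - 1 : ℝ) * ξ ≤ ν i / ξ * ξ := by
              gcongr; linarith [Int.ceil_lt_add_one (ν i / ξ)]
          _ = ν i := hmul
      have a4 : (⌈ν i / ξ⌉ : ℝ) * ξ ≤ 0 := by nlinarith
      rw [abs_of_nonpos a4, abs_of_neg h, abs_of_nonpos (by linarith)]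
      exact ⟨by linarith, by linarith⟩
  set ν' : EuclideanSpace ℝ (Fin d) := WithLp.toLp 2 fun i => (k i : ℝ) * ξ with hν'
  have hnorm : ‖ν'‖ ≤ ‖ν‖ := by
    rw [EuclideanSpace.norm_eq, EuclideanSpace.norm_eq]
    gcongr with i _
    exact (h1 i).1
  refine ⟨ν', ⟨hnorm.trans hν, fun i => ⟨k i, rfl⟩⟩, hnorm, ?_⟩
  rw [EuclideanSpace.norm_eq]
  calc √(∑ i, ‖(ν - ν') i‖ ^ 2) ≤ √(∑ _i : Fin d, ξ ^ 2) := by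
        gcongr with i _
        exact (h1 i).2
    _ = √d * ξ := by
        rw [Finset.sum_const, Finset.card_univ, Fintype.card_fin, nsmul_eq_mul,
          Real.sqrt_mul (by positivity), Real.sqrt_sq hξ.le]

theorem exists_finset_grid {ξ R : ℝ} (hξ : 0 < ξ) (hR : 0 ≤ R) :
    ∃ F : Finset (EuclideanSpace ℝ (Fin d)), (∀ ν ∈ grid d ξ R, ν ∈ F) ∧
      (F.card : ℝ) ≤ (2 * R / ξ + 1) ^ d := by
  classical
  set N : ℤ := ⌊R / ξ⌋ with hN
  have hN0 : 0 ≤ N := Int.floor_nonneg.2 (by positivity)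
  refine ⟨(Fintype.piFinset fun _ : Fin d => Finset.Icc (-N) N).image
    fun k => WithLp.toLp 2 fun i => (k i : ℝ) * ξ, ?_, ?_⟩
  · rintro ν ⟨hν, hint⟩
    choose k hk using hint
    refine Finset.mem_image.2 ⟨k, ?_, ?_⟩
    · rw [Fintype.mem_piFinset]
      intro i
      have h1 : |(k i : ℝ)| ≤ R / ξ := by
        rw [le_div_iff₀ hξ]
        have h2 : |ν i| ≤ ‖ν‖ := PiLp.norm_apply_le ν i
        rw [hk i, abs_mul, abs_of_pos hξ] at h2
        exact h2.trans hν
      rw [Finset.mem_Icc]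
      rw [abs_le] at h1
      constructor
      · have : -k i ≤ N := Int.le_floor.2 (by push_cast; linarith)
        linarith
      · exact Int.le_floor.2 h1.2
    · ext i
      exact (hk i).symm
  · refine (Nat.cast_le.2 Finset.card_image_le).trans ?_
    rw [Fintype.card_piFinset]
    simp only [Int.card_Icc, Finset.prod_const, Finset.card_univ, Fintype.card_fin]
    push_cast
    gcongr
    have h1 : (((N + 1 - -N).toNat : ℤ) : ℝ) = 2 * N + 1 := by
      rw [Int.toNat_of_nonneg (by linarith)]; push_cast; ring
    have h2 : (((N + 1 - -N).toNat : ℕ) : ℝ) = 2 * N + 1 := by exact_mod_cast h1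
    rw [h2]
    have h3 : (N : ℝ) ≤ R / ξ := Int.floor_le _
    have : 2 * R / ξ = 2 * (R / ξ) := by ring
    linarith

theorem exists_finset_levels {e B : ℝ} (hd : 0 < d) (he : 0 < e) (hB : 0 < B) :
    ∃ F : Finset ℤ, (∀ j, j ∈ levels d e B ↔ j ∈ F) ∧
      (F.card : ℝ) ≤ |Real.logb 2 (6 * √d * B / e)| + 2 := by
  refine ⟨Finset.Icc _ _, fun j => by rw [Finset.mem_Icc]; rfl, ?_⟩
  rw [Int.card_Icc]
  have hd0 : (0 : ℝ) < √d := Real.sqrt_pos.2 (by exact_mod_cast hd)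
  rw [Real.logb_div (by positivity) he.ne']
  set p := Real.logb 2 (6 * √d * B)
  set q := Real.logb 2 e
  have h1 : (⌈p⌉ : ℝ) < p + 1 := Int.ceil_lt_add_one p
  have h2 : q ≤ ⌈q⌉ := Int.le_ceil q
  have h3 := le_abs_self (p - q)
  rcases le_total 0 (⌈p⌉ + 1 - ⌈q⌉) with h | h
  · have h4 : (((⌈p⌉ + 1 - ⌈q⌉).toNat : ℤ) : ℝ) = ⌈p⌉ + 1 - ⌈q⌉ := by
      rw [Int.toNat_of_nonneg h]; push_cast; ring
    have h5 : (((⌈p⌉ + 1 - ⌈q⌉).toNat : ℕ) : ℝ) = ⌈p⌉ + 1 - ⌈q⌉ := by exact_mod_cast h4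
    rw [h5]; linarith
  · rw [Int.toNat_of_nonpos h]
    simp only [Nat.cast_zero]
    positivity

theorem le_zpow_of_mem_levels {e B : ℝ} (he : 0 < e) {j : ℤ} (hj : j ∈ levels d e B) :
    e ≤ (2 : ℝ) ^ j := by
  have h1 : Real.logb 2 e ≤ (j : ℝ) := (Int.le_ceil _).trans (by exact_mod_cast hj.1)
  rw [Real.logb_le_iff_le_rpow (by norm_num) he] at h1
  rwa [Real.rpow_intCast] at h1

/-- The level set contains a power of two within a factor two above every magnitude between `e` and
`6 √d B`; this is how clipping levels are matched to the size of an inner product. -/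
theorem mem_levels_ceil_logb {e B x : ℝ} (he : 0 < e) (hx : e ≤ x) (hxB : x ≤ 6 * √d * B) :
    ⌈Real.logb 2 x⌉ ∈ levels d e B ∧ x ≤ (2 : ℝ) ^ ⌈Real.logb 2 x⌉ ∧
      (2 : ℝ) ^ ⌈Real.logb 2 x⌉ ≤ 2 * x := by
  have hx0 : 0 < x := he.trans_le hx
  refine ⟨⟨Int.ceil_mono (Real.logb_le_logb_of_le (by norm_num) he hx),
    Int.ceil_mono (Real.logb_le_logb_of_le (by norm_num) hx0 hxB)⟩, ?_, ?_⟩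
  · have := Int.le_ceil (Real.logb 2 x)
    rwa [Real.logb_le_iff_le_rpow (by norm_num) hx0, Real.rpow_intCast] at this
  · have h1 : (⌈Real.logb 2 x⌉ : ℝ) - 1 ≤ Real.logb 2 x := by
      linarith [Int.ceil_lt_add_one (Real.logb 2 x)]
    rw [Real.le_logb_iff_rpow_le (by norm_num) hx0] at h1
    rw [Real.rpow_sub (by norm_num), Real.rpow_one, Real.rpow_intCast] at h1
    linarith

end Grid

/-! ### Linear parameters -/

/-- `θ` and `G h = ∫ h dμ` represent costs and transitions of a linear SSP. -/
structure SSP.LinearOp {S : Type*} {A : Type*} [MeasurableSpace S] [MeasurableSpace A]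
    (M : SSP S A) {d : ℕ} (φ : S → A → EuclideanSpace ℝ (Fin d))
    (θ : EuclideanSpace ℝ (Fin d)) (G : (Option S → ℝ) → EuclideanSpace ℝ (Fin d)) : Prop where
  measurable_feature : Measurable fun q : S × A => φ q.1 q.2
  norm_feature_le : ∀ s a, ‖φ s a‖ ≤ 1
  norm_theta_le : ‖θ‖ ≤ √d
  cost_eq : ∀ s a, M.cost s a = inner ℝ (φ s a) θ
  norm_le : ∀ (h : Option S → ℝ) (b : ℝ), Measurable h → (∀ x, |h x| ≤ b) → ‖G h‖ ≤ √d * b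
  inner_eq : ∀ (h : Option S → ℝ) (b : ℝ), Measurable h → (∀ x, |h x| ≤ b) →
    ∀ s a, inner ℝ (φ s a) (G h) = ∫ x, h x ∂(M.trans (s, a))

theorem SSP.IsLinear.exists_linearOp {S : Type*} {A : Type*} [MeasurableSpace S]
    [MeasurableSpace A] {M : SSP S A} {d : ℕ} {φ : S → A → EuclideanSpace ℝ (Fin d)}
    (hM : M.IsLinear φ) : ∃ θ G, M.LinearOp φ θ G := by
  obtain ⟨θ, G, h1, h2, h3⟩ := hM.exists_integral_operator
  exact ⟨θ, G, hM.measurable_feature, hM.norm_feature_le, h1, h2,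
    fun h b hm hb => (h3 h b hm hb).1, fun h b hm hb => (h3 h b hm hb).2⟩

section Bellman

variable {S : Type*} {A : Type*} [MeasurableSpace S] [MeasurableSpace A] [Nonempty A] [Finite A]
  {M : SSP S A} {d : ℕ} {φ : S → A → EuclideanSpace ℝ (Fin d)}
  {θ : EuclideanSpace ℝ (Fin d)} {G : (Option S → ℝ) → EuclideanSpace ℝ (Fin d)}

/-- The parameter `U V_{w,B}` with `φ(s,a)ᵀ U V = c(s,a) + P_{s,a} V`. -/
noncomputable def bellman (φ : S → A → EuclideanSpace ℝ (Fin d)) (θ : EuclideanSpace ℝ (Fin d))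
    (G : (Option S → ℝ) → EuclideanSpace ℝ (Fin d)) (w : EuclideanSpace ℝ (Fin d)) (B : ℝ) :
    EuclideanSpace ℝ (Fin d) :=
  θ + G (optValue φ w B)

omit [MeasurableSpace S] [MeasurableSpace A] in
theorem abs_optValue_le {w : EuclideanSpace ℝ (Fin d)} {B : ℝ} (hB : 0 ≤ B) (x : Option S) :
    |optValue φ w B x| ≤ 2 * B := by
  rw [abs_of_nonneg (optValue_nonneg hB x)]
  exact optValue_le hB x

namespace SSP.LinearOp

variable (hM : M.LinearOp φ θ G)
include hM

omit [Nonempty A] in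
theorem measurable_optValue_const (w : EuclideanSpace ℝ (Fin d)) (B : ℝ) :
    Measurable (optValue φ w B) := by
  have : Nonempty S := ⟨M.init⟩
  exact LinearSSP.measurable_optValue_const hM.measurable_feature w B

theorem norm_op_le (w : EuclideanSpace ℝ (Fin d)) {B : ℝ} (hB : 0 ≤ B) :
    ‖G (optValue φ w B)‖ ≤ 2 * √d * B := by
  have := hM.norm_le _ _ (hM.measurable_optValue_const w B) (abs_optValue_le (φ := φ) (w := w) hB)
  linarith

/-- The cost parameter contributes `√d` and the transition part `2 √d B`, which together explain the
radius `3 √d B` of the confidence sets. -/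
theorem norm_bellman_le (w : EuclideanSpace ℝ (Fin d)) {B : ℝ} (hB : 1 ≤ B) :
    ‖bellman φ θ G w B‖ ≤ 3 * √d * B := by
  have h1 := hM.norm_op_le w (by linarith : 0 ≤ B)
  have h2 := norm_add_le θ (G (optValue φ w B))
  have h3 := hM.norm_theta_le
  have h4 := Real.sqrt_nonneg (d : ℝ)
  unfold bellman
  nlinarith

theorem inner_op (w : EuclideanSpace ℝ (Fin d)) {B : ℝ} (hB : 0 ≤ B) (s : S) (a : A) :
    inner ℝ (φ s a) (G (optValue φ w B)) = ∫ x, optValue φ w B x ∂(M.trans (s, a)) :=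
  hM.inner_eq _ _ (hM.measurable_optValue_const w B) (abs_optValue_le hB) s a

theorem inner_bellman (w : EuclideanSpace ℝ (Fin d)) {B : ℝ} (hB : 0 ≤ B) (s : S) (a : A) :
    inner ℝ (φ s a) (bellman φ θ G w B) =
      M.cost s a + ∫ x, optValue φ w B x ∂(M.trans (s, a)) := by
  rw [bellman, inner_add_right, ← hM.cost_eq, hM.inner_op w hB]

theorem stepMean_nonneg_le (x : Trajectory S A) (w : EuclideanSpace ℝ (Fin d)) {B : ℝ}
    (hB : 0 ≤ B) (i : ℕ) :
    0 ≤ M.stepMean x (optValue φ w B) i ∧ M.stepMean x (optValue φ w B) i ≤ 2 * B := by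
  have := M.isMarkov
  refine ⟨integral_nonneg (optValue_nonneg hB), ?_⟩
  calc ∫ o, optValue φ w B o ∂_ ≤ ∫ _o, 2 * B ∂(M.trans (x.state i, x.action i)) := by
        refine integral_mono ?_ (integrable_const _) (optValue_le hB)
        exact Integrable.of_bound (hM.measurable_optValue_const w B).aestronglyMeasurable (2 * B)
          (Eventually.of_forall (abs_optValue_le hB))
    _ = 2 * B := by simp

theorem abs_stepMean_sub_le (x : Trajectory S A) (w w' : EuclideanSpace ℝ (Fin d)) {B : ℝ}
    (hB : 0 ≤ B) (i : ℕ) :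
    |M.stepMean x (optValue φ w B) i - M.stepMean x (optValue φ w' B) i| ≤ ‖w - w'‖ := by
  have := M.isMarkov
  have hint : ∀ u, Integrable (optValue φ u B) (M.trans (x.state i, x.action i)) := fun u =>
    Integrable.of_bound (hM.measurable_optValue_const u B).aestronglyMeasurable (2 * B)
          (Eventually.of_forall (abs_optValue_le hB))
  unfold SSP.stepMean
  rw [← integral_sub (hint w) (hint w'), ← Real.norm_eq_abs]
  refine (norm_integral_le_of_norm_le_const (C := ‖w - w'‖) (Eventually.of_forall fun o =>
    abs_optValue_sub_le hM.norm_feature_le w w' B o)).trans ?_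
  simp

end SSP.LinearOp

end Bellman

end LinearSSP

namespace LinearSSP

/-! ### Validity of the confidence sets -/

theorem tsum_one_div_mul_le : ∑' n : ℕ, ENNReal.ofReal (1 / ((n + 1) * (n + 2))) ≤ 1 := by
  refine ENNReal.tsum_le_of_sum_range_le fun N => ?_
  rw [← ENNReal.ofReal_sum_of_nonneg fun i _ => by positivity]
  have : ∑ i ∈ Finset.range N, (1 / (((i : ℝ) + 1) * (i + 2))) = 1 - 1 / (N + 1) := by
    induction N with
    | zero => simp
    | succ N ih => rw [Finset.sum_range_succ, ih]; push_cast; field_simp; ring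
  rw [this, ← ENNReal.ofReal_one]
  refine ENNReal.ofReal_le_ofReal ?_
  have : (0 : ℝ) ≤ 1 / (N + 1) := by positivity
  linarith

/-- The argument of the logarithm in `iota`. -/
noncomputable def logArg (d : ℕ) (e δ B t : ℝ) : ℝ := 48 * d * B * t / (e * δ)

/-! ### Cardinalities of the nets compared with the argument of the logarithm. -/

section LogArg

variable {d : ℕ} {e δ B : ℝ} {n : ℕ}

theorem le_logArg (hd : 2 ≤ d) (he : 0 < e) (hδ : 0 < δ) (hδ1 : δ < 1) (hB : 1 ≤ B) :
    48 * (d * B * (n + 1) / e) ≤ logArg d e δ B (n + 1) := by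
  unfold logArg
  rw [le_div_iff₀ (by positivity)]
  have h1 : 48 * (d * B * (n + 1) / e) * (e * δ) = 48 * d * B * (n + 1) * δ := by
    field_simp
  rw [h1]
  exact mul_le_of_le_one_right (by positivity) hδ1.le

theorem one_le_ratio (hd : 2 ≤ d) (he : 0 < e) (he1 : e ≤ 1) (hB : 1 ≤ B) :
    2 ≤ d * B * (n + 1) / e := by
  rw [le_div_iff₀ he]
  have h2 : (2 : ℝ) ≤ d := by exact_mod_cast hd
  have h3 : (1 : ℝ) ≤ n + 1 := by linarith [(Nat.cast_nonneg n : (0 : ℝ) ≤ n)]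
  calc 2 * e ≤ 2 * 1 * 1 := by linarith
    _ ≤ d * B * (n + 1) := by gcongr

theorem one_le_log_logArg (hd : 2 ≤ d) (he : 0 < e) (he1 : e ≤ 1) (hδ : 0 < δ) (hδ1 : δ < 1)
    (hB : 1 ≤ B) : 1 ≤ Real.log (logArg d e δ B (n + 1)) := by
  have h1 := le_logArg (n := n) hd he hδ hδ1 hB
  have h2 := one_le_ratio (n := n) hd he he1 hB
  rw [Real.le_log_iff_exp_le (by linarith)]
  have := Real.exp_one_lt_d9
  linarith

theorem card_grid_le_logArg (hd : 2 ≤ d) (he : 0 < e) (he1 : e ≤ 1) (hδ : 0 < δ) (hδ1 : δ < 1)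
    (hB : 1 ≤ B) {c : ℝ} (hc : c ≤ 6) :
    2 * (c * √d * B) / (e / (n + 1)) + 1 ≤ logArg d e δ B (n + 1) := by
  have h1 := le_logArg (n := n) hd he hδ hδ1 hB
  have h2 := one_le_ratio (n := n) hd he he1 hB
  have h3 : √(d : ℝ) ≤ d := by
    rw [Real.sqrt_le_left (by positivity)]
    have : (2 : ℝ) ≤ d := by exact_mod_cast hd
    nlinarith
  have h4 : 2 * (c * √d * B) / (e / (n + 1)) = 2 * c * (√d * B * (n + 1) / e) := by
    field_simp
  have h5 : 2 * c * (√d * B * (n + 1) / e) ≤ 2 * 6 * (d * B * (n + 1) / e) := by gcongr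
  rw [h4]
  linarith

theorem card_levels_le_logArg (hd : 2 ≤ d) (he : 0 < e) (he1 : e ≤ 1) (hδ : 0 < δ) (hδ1 : δ < 1)
    (hB : 1 ≤ B) : |Real.logb 2 (6 * √d * B / e)| + 2 ≤ logArg d e δ B (n + 1) := by
  have h1 := le_logArg (n := n) hd he hδ hδ1 hB
  have h2 := one_le_ratio (n := n) hd he he1 hB
  have hd2 : (2 : ℝ) ≤ d := by exact_mod_cast hd
  have h3 : √(d : ℝ) ≤ d := by
    rw [Real.sqrt_le_left (by positivity)]; nlinarith
  have h6 : 1 ≤ √(d : ℝ) := by rw [Real.one_le_sqrt]; linarith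
  set x := 6 * √d * B / e with hx
  have hx1 : 1 ≤ x := by
    rw [hx, le_div_iff₀ he]
    nlinarith [mul_le_mul h6 hB (by norm_num) (by positivity)]
  have h7 : x ≤ 6 * (d * B * (n + 1) / e) := by
    have h8 : (1 : ℝ) ≤ n + 1 := by linarith [(Nat.cast_nonneg n : (0 : ℝ) ≤ n)]
    calc x = 6 * (√d * B * 1 / e) := by rw [hx]; ring
      _ ≤ _ := by gcongr
  rw [abs_of_nonneg (Real.logb_nonneg (by norm_num) hx1)]
  have h9 : Real.logb 2 x ≤ 2 * x := by
    rw [Real.logb, div_le_iff₀ (Real.log_pos (by norm_num))]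
    have := Real.log_le_sub_one_of_pos (show 0 < x by linarith)
    have := Real.log_two_gt_d9
    nlinarith
  linarith

theorem two_mul_le_logArg (hd : 2 ≤ d) (he : 0 < e) (he1 : e ≤ 1) (hδ : 0 < δ) (hδ1 : δ < 1)
    (hB : 1 ≤ B) : 2 * ((n : ℝ) + 1) ≤ logArg d e δ B (n + 1) := by
  have h1 := le_logArg (n := n) hd he hδ hδ1 hB
  have hd2 : (2 : ℝ) ≤ d := by exact_mod_cast hd
  have : (n : ℝ) + 1 ≤ d * B * (n + 1) / e := by
    rw [le_div_iff₀ he]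
    calc ((n : ℝ) + 1) * e ≤ 1 * 1 * (n + 1) := by nlinarith [(Nat.cast_nonneg n : (0 : ℝ) ≤ n)]
      _ ≤ _ := by gcongr; linarith
  have : (0 : ℝ) ≤ n := Nat.cast_nonneg n
  linarith

/-- The argument of the logarithm is at least `96 (m+1)(n+1) / δ`, so its inverse square is summable
over times and over the estimates `2^m`, with total at most `δ / 2`. -/
theorem inv_logArg_sq_le (hd : 2 ≤ d) (he : 0 < e) (he1 : e ≤ 1) (hδ : 0 < δ) (hδ1 : δ < 1)
    (m : ℕ) : (logArg d e δ (2 ^ m) (n + 1) ^ 2)⁻¹ ≤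
      δ / 2 * (1 / ((n + 1) * (n + 2)) * (1 / ((m + 1) * (m + 2)))) := by
  have hd2 : (2 : ℝ) ≤ d := by exact_mod_cast hd
  have hn : (0 : ℝ) ≤ n := Nat.cast_nonneg n
  have hm : (0 : ℝ) ≤ m := Nat.cast_nonneg m
  have hm2 : ((m : ℝ) + 1) ≤ 2 ^ m := by
    exact_mod_cast (Nat.lt_two_pow_self (n := m))
  have h1 : 96 * ((m + 1) * (n + 1) / δ) ≤ logArg d e δ (2 ^ m) (n + 1) := by
    unfold logArg
    rw [show 96 * (((m : ℝ) + 1) * (n + 1) / δ) = (48 * 2 * (m + 1) * (n + 1)) / (1 * δ) by ring]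
    gcongr
  have h0 : 0 < ((m : ℝ) + 1) * (n + 1) / δ := by positivity
  have h2 : (96 * (((m : ℝ) + 1) * (n + 1) / δ)) ^ 2 ≤ logArg d e δ (2 ^ m) (n + 1) ^ 2 := by
    gcongr
  have h3 : 2 / δ * (((n : ℝ) + 1) * (n + 2) * ((m + 1) * (m + 2))) ≤
      (96 * (((m : ℝ) + 1) * (n + 1) / δ)) ^ 2 := by
    have e1 : (96 * (((m : ℝ) + 1) * (n + 1) / δ)) ^ 2 =
        (9216 * ((m + 1) ^ 2 * (n + 1) ^ 2) / δ) * (1 / δ) := by field_simp; ring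
    have e2 : 2 / δ * (((n : ℝ) + 1) * (n + 2) * ((m + 1) * (m + 2))) ≤
        9216 * ((m + 1) ^ 2 * (n + 1) ^ 2) / δ := by
      rw [div_mul_eq_mul_div]
      gcongr ?_ / δ
      have a1 : ((n : ℝ) + 1) * (n + 2) ≤ 2 * (n + 1) ^ 2 := by nlinarith
      have a2 : ((m : ℝ) + 1) * (m + 2) ≤ 2 * (m + 1) ^ 2 := by nlinarith
      calc 2 * (((n : ℝ) + 1) * (n + 2) * ((m + 1) * (m + 2)))
          ≤ 2 * ((2 * (n + 1) ^ 2) * (2 * (m + 1) ^ 2)) := by gcongr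
        _ ≤ _ := by nlinarith [mul_nonneg (sq_nonneg ((n : ℝ) + 1)) (sq_nonneg ((m : ℝ) + 1))]
    rw [e1]
    refine e2.trans (le_mul_of_one_le_right (by positivity) ?_)
    rw [le_div_iff₀ hδ]; linarith
  calc (logArg d e δ (2 ^ m) (n + 1) ^ 2)⁻¹
      ≤ (2 / δ * (((n : ℝ) + 1) * (n + 2) * ((m + 1) * (m + 2))))⁻¹ := by
        gcongr
        exact h3.trans h2
    _ = _ := by field_simp

end LogArg

/-- The confidence level used in the union bound. -/
noncomputable def confLevel (d : ℕ) (e δ B t : ℝ) : ℝ :=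
  (2 * d + 7) * Real.log (logArg d e δ B t)

theorem iota_eq (d : ℕ) (e δ B t : ℝ) :
    iota d e δ B t = 2 ^ 11 * d * Real.log (logArg d e δ B t) := rfl

theorem sqrt_add_le {p q : ℝ} (hp : 0 ≤ p) (hq : 0 ≤ q) : √(p + q) ≤ √p + √q := by
  rw [Real.sqrt_le_left (by positivity)]
  nlinarith [Real.sq_sqrt hp, Real.sq_sqrt hq, Real.sqrt_nonneg p, Real.sqrt_nonneg q,
    mul_nonneg (Real.sqrt_nonneg p) (Real.sqrt_nonneg q)]

/-- The condition `19 L ≤ ι` absorbs all discretisation losses: `18 Q L` under the root, and `9 + 8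
+ 2 = 19` units of `B l L` in the linear terms. -/
theorem confidence_radius_le {Q Q' l L ι B : ℝ} (hQ : 0 ≤ Q) (hQ' : Q' ≤ 2 * Q + 8 * l ^ 2)
    (hl : 0 < l) (hL : 1 ≤ L) (hι : 19 * L ≤ ι) (hB : 1 ≤ B) :
    3 * √(Q' * L) + 4 * (l * (2 * B)) * L + 2 * l ≤ √(Q * ι) + B * l * ι := by
  have h1 : √(Q' * L) ≤ √(2 * Q * L) + √(8 * l ^ 2 * L) := by
    refine (Real.sqrt_le_sqrt (mul_le_mul_of_nonneg_right hQ' (by linarith))).trans ?_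
    rw [add_mul]
    exact sqrt_add_le (by positivity) (by positivity)
  have h2 : 3 * √(2 * Q * L) ≤ √(Q * ι) := by
    apply Real.le_sqrt_of_sq_le
    rw [mul_pow, Real.sq_sqrt (by positivity)]
    have := mul_le_mul_of_nonneg_left hι hQ
    have : 0 ≤ Q * L := by positivity
    linarith
  have h3 : √(8 * l ^ 2 * L) ≤ 3 * l * L := by
    rw [Real.sqrt_le_left (by positivity)]
    have e1 : L ≤ L ^ 2 := by nlinarith
    have e2 : l ^ 2 * L ≤ l ^ 2 * L ^ 2 := by gcongr
    have e3 : 0 ≤ l ^ 2 * L ^ 2 := by positivity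
    have e4 : (3 * l * L) ^ 2 = 9 * (l ^ 2 * L ^ 2) := by ring
    rw [e4]
    linarith
  have hlL : l ≤ l * L := by nlinarith
  have a1 : l * L ≤ B * (l * L) := by
    have : 0 ≤ l * L := by positivity
    nlinarith
  have a3 : B * l * (19 * L) ≤ B * l * ι := by gcongr
  linarith

section Conf

variable {S : Type*} {A : Type*} [MeasurableSpace S] [MeasurableSpace A]
  {M : SSP S A} {d : ℕ} {φ : S → A → EuclideanSpace ℝ (Fin d)} {e δ : ℝ}
  {θ : EuclideanSpace ℝ (Fin d)} {G : (Option S → ℝ) → EuclideanSpace ℝ (Fin d)}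

/-- The deviation `P_i V - V(s'_i)`. -/
noncomputable def SSP.deviation (M : SSP S A) (x : Trajectory S A) (v : Option S → ℝ) (i : ℕ) : ℝ :=
  M.stepMean x v i - v (x.next i)

/-- The concentration inequality on the net at index `n`. -/
def SSP.NetGood (M : SSP S A) (φ : S → A → EuclideanSpace ℝ (Fin d)) (e δ : ℝ)
    (x : Trajectory S A) (n : ℕ) (B : ℝ) : Prop :=
  ∀ j ∈ levels d e B, ∀ ν ∈ grid d (e / (n + 1)) (6 * √d * B),
    ∀ w ∈ grid d (e / (n + 1)) (3 * √d * B),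
      |∑ i ∈ Finset.range n, clip j (inner ℝ (x.feat φ i) ν) *
          M.deviation x (optValue φ w B) i| ≤
        3 * √((∑ i ∈ Finset.range n, (clip j (inner ℝ (x.feat φ i) ν) *
          M.deviation x (optValue φ w B) i) ^ 2) * confLevel d e δ B (n + 1)) +
        4 * (2 ^ j * (2 * B)) * confLevel d e δ B (n + 1)

/-- The residual of the Bellman update is the martingale deviation, so its constraints are
concentration statements. The vectors `ν` are already on a grid; only `w` has to be rounded, because
it determines the value function. The rounding error is at most `1 / (n + 1)` per step and hence
harmless over `n` steps. -/
theorem SSP.LinearOp.bellman_mem_confSet [Nonempty A] [Finite A] (hM : M.LinearOp φ θ G)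
    (hd : 2 ≤ d) (he : 0 < e)
    (he1 : √d * e ≤ 1) (hδ : 0 < δ) (hδ1 : δ < 1) {x : Trajectory S A}
    (hx : ∀ i, x.cost i = M.cost (x.state i) (x.action i)) {n : ℕ} {B : ℝ} (hB : 1 ≤ B)
    (hnet : M.NetGood φ e δ x n B) {w : EuclideanSpace ℝ (Fin d)} (hw : ‖w‖ ≤ 3 * √d * B) :
    bellman φ θ G w B ∈ x.confSet φ e δ n w B := by
  have hB0 : (0 : ℝ) ≤ B := by linarith
  refine ⟨hM.norm_bellman_le w hB, fun j hj ν hν => ?_⟩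
  have hres : ∀ i, x.resid φ (optValue φ w B) (bellman φ θ G w B) i =
      M.deviation x (optValue φ w B) i := fun i => by
    unfold Trajectory.resid Trajectory.feat SSP.deviation SSP.stepMean
    rw [hM.inner_bellman w hB0, hx]; ring
  simp only [hres]
  obtain ⟨w', hw', -, hnear⟩ := exists_mem_grid_near (ξ := e / (n + 1)) (by positivity) hw
  have hmain := hnet j hj ν hν w' hw'
  set η := ‖w - w'‖ with hη
  have hη0 : 0 ≤ η := norm_nonneg _
  have hn1 : (0 : ℝ) < n + 1 := by positivity
  have hηn : η * (n + 1) ≤ 1 := by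
    calc η * (n + 1) ≤ (√d * (e / (n + 1))) * (n + 1) := by gcongr
      _ = √d * e := by field_simp
      _ ≤ 1 := he1
  have hnn : (0 : ℝ) ≤ n := Nat.cast_nonneg n
  have hη1 : η ≤ 1 := by nlinarith
  have hηn' : n * η ≤ 1 := by nlinarith
  set l : ℝ := 2 ^ j with hl
  have hl0 : 0 < l := by positivity
  set c : ℕ → ℝ := fun i => clip j (inner ℝ (x.feat φ i) ν) with hc
  set p : ℕ → ℝ := fun i => M.deviation x (optValue φ w B) i with hp
  set p' : ℕ → ℝ := fun i => M.deviation x (optValue φ w' B) i with hp'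
  have hcl : ∀ i, |c i| ≤ l := fun i => abs_clip_le _ _
  have hpp : ∀ i, |p i - p' i| ≤ 2 * η := by
    intro i
    have h1 := hM.abs_stepMean_sub_le x w w' hB0 i
    have h2 := abs_optValue_sub_le hM.norm_feature_le w w' B (x.next i)
    calc |p i - p' i| = |(M.stepMean x (optValue φ w B) i - M.stepMean x (optValue φ w' B) i) -
          (optValue φ w B (x.next i) - optValue φ w' B (x.next i))| := by
          simp only [hp, hp', SSP.deviation]; ring_nf
      _ ≤ η + η := (abs_sub _ _).trans (add_le_add h1 h2)
      _ = 2 * η := by ring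
  change |∑ i ∈ Finset.range n, c i * p i| ≤ √((∑ i ∈ Finset.range n, c i ^ 2 * p i ^ 2) *
    iota d e δ B (n + 1)) + B * l * iota d e δ B (n + 1)
  change |∑ i ∈ Finset.range n, c i * p' i| ≤ 3 * √((∑ i ∈ Finset.range n, (c i * p' i) ^ 2) *
    confLevel d e δ B (n + 1)) + 4 * (l * (2 * B)) * confLevel d e δ B (n + 1) at hmain
  have hd2 : (2 : ℝ) ≤ d := by exact_mod_cast hd
  have hlog := one_le_log_logArg (n := n) hd he (by
    have : 1 ≤ √(d : ℝ) := by rw [Real.one_le_sqrt]; linarith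
    nlinarith) hδ hδ1 hB
  set L := confLevel d e δ B (n + 1) with hL
  set ι := iota d e δ B (n + 1) with hι
  have hL1 : 1 ≤ L := by rw [hL, confLevel]; nlinarith
  have hιL : 19 * L ≤ ι := by rw [hL, confLevel, hι, iota_eq]; nlinarith
  have hsum : |∑ i ∈ Finset.range n, c i * p i| ≤ |∑ i ∈ Finset.range n, c i * p' i| + 2 * l := by
    have h1 : ∑ i ∈ Finset.range n, c i * p i =
        ∑ i ∈ Finset.range n, c i * p' i + ∑ i ∈ Finset.range n, c i * (p i - p' i) := by
      rw [← Finset.sum_add_distrib]; exact Finset.sum_congr rfl fun i _ => by ring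
    rw [h1]
    refine (abs_add_le _ _).trans (add_le_add le_rfl ?_)
    calc |∑ i ∈ Finset.range n, c i * (p i - p' i)|
        ≤ ∑ i ∈ Finset.range n, l * (2 * η) := by
          refine (Finset.abs_sum_le_sum_abs _ _).trans (Finset.sum_le_sum fun i _ => ?_)
          rw [abs_mul]
          exact mul_le_mul (hcl i) (hpp i) (abs_nonneg _) hl0.le
      _ = l * (2 * (n * η)) := by rw [Finset.sum_const, Finset.card_range, nsmul_eq_mul]; ring
      _ ≤ 2 * l := by nlinarith
  set Q := ∑ i ∈ Finset.range n, c i ^ 2 * p i ^ 2 with hQ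
  have hQ0 : 0 ≤ Q := Finset.sum_nonneg fun i _ => by positivity
  have hQ' : ∑ i ∈ Finset.range n, (c i * p' i) ^ 2 ≤ 2 * Q + 8 * l ^ 2 := by
    have h1 : ∀ i ∈ Finset.range n, (c i * p' i) ^ 2 ≤
        2 * (c i ^ 2 * p i ^ 2) + 8 * (l ^ 2 * η) := by
      intro i _
      have a1 : c i ^ 2 ≤ l ^ 2 := by rw [← sq_abs]; gcongr; exact hcl i
      have a2 : (p i - p' i) ^ 2 ≤ 4 * η := by
        rw [← sq_abs]
        calc |p i - p' i| ^ 2 ≤ (2 * η) ^ 2 := by gcongr; exact hpp i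
          _ ≤ 4 * η := by nlinarith
      have a3 : c i ^ 2 * (p i - p' i) ^ 2 ≤ l ^ 2 * (4 * η) := by gcongr
      nlinarith [sq_nonneg (c i * (2 * p i - p' i)), sq_nonneg (c i)]
    calc _ ≤ ∑ i ∈ Finset.range n, (2 * (c i ^ 2 * p i ^ 2) + 8 * (l ^ 2 * η)) :=
          Finset.sum_le_sum h1
      _ = 2 * Q + 8 * (l ^ 2 * (n * η)) := by
          rw [Finset.sum_add_distrib, ← Finset.mul_sum, Finset.sum_const, Finset.card_range,
            nsmul_eq_mul]; ring
      _ ≤ 2 * Q + 8 * l ^ 2 := by nlinarith [sq_nonneg l]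
  have := confidence_radius_le hQ0 hQ' hl0 hL1 hιL hB
  linarith

variable {Ω : Type*} [mΩ : MeasurableSpace Ω] {Pr : Measure Ω} [IsProbabilityMeasure Pr]
  {ℱ : Filtration ℕ mΩ} {a : ℕ → Ω → A} {y : ℕ → Ω → Option S}
  {wt : ℕ → Ω → EuclideanSpace ℝ (Fin d)} {Bt : ℕ → Ω → ℝ}

theorem SSP.LinearOp.measure_clip_sum_gt_le [Nonempty A] [Finite A] (hM : M.LinearOp φ θ G)
    (h : M.IsInteraction φ e δ Pr ℱ a y wt Bt) {B L : ℝ} (hB : 0 < B) (hL : 1 ≤ L) (n : ℕ) (j : ℤ)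
    (ν w : EuclideanSpace ℝ (Fin d)) :
    Pr {ω | 3 * √((∑ i ∈ Finset.range n,
        (clip j (inner ℝ ((M.trajectory (a · ω) (y · ω)).feat φ i) ν) *
          M.deviation (M.trajectory (a · ω) (y · ω)) (optValue φ w B) i) ^ 2) * L) +
        4 * (2 ^ j * (2 * B)) * L <
      |∑ i ∈ Finset.range n, clip j (inner ℝ ((M.trajectory (a · ω) (y · ω)).feat φ i) ν) *
          M.deviation (M.trajectory (a · ω) (y · ω)) (optValue φ w B) i|} ≤
      ENNReal.ofReal (2 * (n + 1) * Real.exp (-L)) := by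
  have hj : (0 : ℝ) < 2 ^ j := by positivity
  obtain ⟨h1, -, h2, h3⟩ := h.expDominated
    (c := fun i ω => clip j (inner ℝ ((M.trajectory (a · ω) (y · ω)).feat φ i) ν))
    (fun i => by
      have h4 : Measurable[ℱ i] fun ω =>
          (inner ℝ ((M.trajectory (a · ω) (y · ω)).feat φ i) ν : ℝ) :=
        (h.measurable_feat hM.measurable_feature i).inner measurable_const
      exact (h4.max measurable_const).min measurable_const)
    (v := fun _ _ => optValue φ w B)
    (fun i => (hM.measurable_optValue_const w B).comp (@measurable_snd Ω (Option S) (ℱ i) _))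
    (b₁ := 2 ^ j) (b₂ := 2 * B) (fun i ω => abs_clip_le _ _)
    (fun _ _ o => optValue_nonneg hB.le o) (fun _ _ o => optValue_le hB.le o)
  exact measure_abs_sum_gt_le h2 h1 (by positivity) h3 n hL

theorem SSP.LinearOp.measure_not_netGood_le [Nonempty A] [Finite A] (hM : M.LinearOp φ θ G)
    (h : M.IsInteraction φ e δ Pr ℱ a y wt Bt) (hd : 2 ≤ d) (he : 0 < e) (he1 : e ≤ 1)
    (hδ : 0 < δ) (hδ1 : δ < 1) (n m : ℕ) :
    Pr {ω | ¬ M.NetGood φ e δ (M.trajectory (a · ω) (y · ω)) n (2 ^ m)} ≤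
      ENNReal.ofReal (δ / 2) * (ENNReal.ofReal (1 / ((n + 1) * (n + 2))) *
        ENNReal.ofReal (1 / ((m + 1) * (m + 2)))) := by
  set B : ℝ := 2 ^ m with hBdef
  have hB : 1 ≤ B := one_le_pow₀ (by norm_num)
  have hB0 : 0 < B := by linarith
  set Z := logArg d e δ B (n + 1) with hZ
  set L := confLevel d e δ B (n + 1) with hL
  have hlog := one_le_log_logArg (n := n) hd he he1 hδ hδ1 hB
  have hL1 : 1 ≤ L := by
    have : (0 : ℝ) ≤ d := Nat.cast_nonneg d
    rw [hL, confLevel]; nlinarith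
  have hn1 : (0 : ℝ) < n + 1 := by positivity
  obtain ⟨J, hJ, hJc⟩ := exists_finset_levels (d := d) (by omega) he hB0
  obtain ⟨F, hF, hFc⟩ := exists_finset_grid (d := d) (ξ := e / (n + 1)) (R := 6 * √d * B)
    (by positivity) (by positivity)
  obtain ⟨F', hF', hFc'⟩ := exists_finset_grid (d := d) (ξ := e / (n + 1)) (R := 3 * √d * B)
    (by positivity) (by positivity)
  have hsub : {ω | ¬ M.NetGood φ e δ (M.trajectory (a · ω) (y · ω)) n B} ⊆
      ⋃ j ∈ J, ⋃ ν ∈ F, ⋃ w ∈ F', {ω | 3 * √((∑ i ∈ Finset.range n,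
        (clip j (inner ℝ ((M.trajectory (a · ω) (y · ω)).feat φ i) ν) *
          M.deviation (M.trajectory (a · ω) (y · ω)) (optValue φ w B) i) ^ 2) * L) +
        4 * (2 ^ j * (2 * B)) * L <
      |∑ i ∈ Finset.range n, clip j (inner ℝ ((M.trajectory (a · ω) (y · ω)).feat φ i) ν) *
          M.deviation (M.trajectory (a · ω) (y · ω)) (optValue φ w B) i|} := by
    intro ω hω
    by_contra hcon
    simp only [Set.mem_iUnion, not_exists, Set.mem_ofPred_eq, not_lt] at hcon
    exact hω fun j hj ν hν w hw => hcon j ((hJ j).1 hj) ν (hF ν hν) w (hF' w hw)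
  have hZ0 : 0 < Z := by
    have := two_mul_le_logArg (n := n) hd he he1 hδ hδ1 hB
    linarith
  have hZ1 : 1 ≤ Z := by
    have := two_mul_le_logArg (n := n) hd he he1 hδ hδ1 hB
    have : (0 : ℝ) ≤ n := Nat.cast_nonneg n
    linarith
  -- With argument `Z`, there are at most `Z` levels, `Z^d` grid points for each of `ν` and `w`, and
  -- a factor `Z` from the martingale inequality. The exponent `2d + 7` thus leaves `Z^{-5}`, of
  -- which `Z^{-2}` suffices for the sum over times and estimates.
  have hexp : Real.exp (-L) = (Z ^ (2 * d + 7))⁻¹ := by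
    rw [Real.exp_neg, hL, confLevel]
    congr 1
    rw [show ((2 : ℝ) * d + 7) = ((2 * d + 7 : ℕ) : ℝ) by push_cast; ring, Real.exp_nat_mul,
      Real.exp_log hZ0]
  calc _ ≤ ∑ j ∈ J, ∑ ν ∈ F, ∑ w ∈ F', ENNReal.ofReal (2 * (n + 1) * Real.exp (-L)) := by
        refine (measure_mono hsub).trans ?_
        refine (measure_biUnion_finset_le _ _).trans (Finset.sum_le_sum fun j _ => ?_)
        refine (measure_biUnion_finset_le _ _).trans (Finset.sum_le_sum fun ν _ => ?_)
        refine (measure_biUnion_finset_le _ _).trans (Finset.sum_le_sum fun w _ => ?_)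
        exact hM.measure_clip_sum_gt_le h hB0 hL1 n j ν w
    _ = ENNReal.ofReal (J.card * (F.card * (F'.card * (2 * (n + 1) * Real.exp (-L))))) := by
        simp only [Finset.sum_const, nsmul_eq_mul]
        rw [ENNReal.ofReal_mul (p := (J.card : ℝ)) (by positivity),
          ENNReal.ofReal_mul (p := (F.card : ℝ)) (by positivity),
          ENNReal.ofReal_mul (p := (F'.card : ℝ)) (by positivity)]
        simp only [ENNReal.ofReal_natCast]
    _ ≤ ENNReal.ofReal (δ / 2 * (1 / ((n + 1) * (n + 2)) * (1 / ((m + 1) * (m + 2))))) := by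
        refine ENNReal.ofReal_le_ofReal ?_
        refine le_trans ?_ (inv_logArg_sq_le hd he he1 hδ hδ1 m)
        have c1 : (J.card : ℝ) ≤ Z := hJc.trans (card_levels_le_logArg hd he he1 hδ hδ1 hB)
        have c2 : (F.card : ℝ) ≤ Z ^ d := hFc.trans (by
          gcongr
          exact card_grid_le_logArg hd he he1 hδ hδ1 hB (by norm_num))
        have c3 : (F'.card : ℝ) ≤ Z ^ d := hFc'.trans (by
          gcongr
          exact card_grid_le_logArg hd he he1 hδ hδ1 hB (by norm_num))
        have c4 : 2 * ((n : ℝ) + 1) ≤ Z := two_mul_le_logArg hd he he1 hδ hδ1 hB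
        rw [hexp]
        calc (J.card : ℝ) * (F.card * (F'.card * (2 * (n + 1) * (Z ^ (2 * d + 7))⁻¹)))
            ≤ Z * (Z ^ d * (Z ^ d * (Z * (Z ^ (2 * d + 7))⁻¹))) := by gcongr
          _ = (Z ^ 5)⁻¹ := by
            rw [show 2 * d + 7 = d + d + 2 + 5 by ring, pow_add Z (d + d + 2), pow_add, pow_add]
            field_simp
          _ ≤ (Z ^ 2)⁻¹ := by
            exact inv_anti₀ (by positivity) (pow_le_pow_right₀ hZ1 (by norm_num))
    _ = _ := by
        rw [ENNReal.ofReal_mul (by positivity), ENNReal.ofReal_mul (by positivity)]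

theorem SSP.LinearOp.measure_exists_not_netGood_le [Nonempty A] [Finite A]
    (hM : M.LinearOp φ θ G)
    (h : M.IsInteraction φ e δ Pr ℱ a y wt Bt) (hd : 2 ≤ d) (he : 0 < e) (he1 : e ≤ 1)
    (hδ : 0 < δ) (hδ1 : δ < 1) :
    Pr {ω | ¬ ∀ n m : ℕ, M.NetGood φ e δ (M.trajectory (a · ω) (y · ω)) n (2 ^ m)} ≤
      ENNReal.ofReal (δ / 2) := by
  have hsub : {ω | ¬ ∀ n m : ℕ, M.NetGood φ e δ (M.trajectory (a · ω) (y · ω)) n (2 ^ m)} ⊆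
      ⋃ n : ℕ, ⋃ m : ℕ, {ω | ¬ M.NetGood φ e δ (M.trajectory (a · ω) (y · ω)) n (2 ^ m)} := by
    intro ω hω
    by_contra hcon
    simp only [Set.mem_iUnion, not_exists, Set.mem_ofPred_eq, not_not] at hcon
    exact hω hcon
  calc _ ≤ ∑' n : ℕ, ∑' m : ℕ, ENNReal.ofReal (δ / 2) *
        (ENNReal.ofReal (1 / ((n + 1) * (n + 2))) * ENNReal.ofReal (1 / ((m + 1) * (m + 2)))) := by
        refine (measure_mono hsub).trans ?_
        refine (measure_iUnion_le _).trans (ENNReal.tsum_le_tsum fun n => ?_)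
        refine (measure_iUnion_le _).trans (ENNReal.tsum_le_tsum fun m => ?_)
        exact hM.measure_not_netGood_le h hd he he1 hδ hδ1 n m
    _ = ENNReal.ofReal (δ / 2) * ((∑' n : ℕ, ENNReal.ofReal (1 / ((n + 1) * (n + 2)))) *
          ∑' m : ℕ, ENNReal.ofReal (1 / ((m + 1) * (m + 2)))) := by
        simp only [ENNReal.tsum_mul_left, ENNReal.tsum_mul_right]
    _ ≤ ENNReal.ofReal (δ / 2) * (1 * 1) := by
        gcongr <;> exact tsum_one_div_mul_le
    _ = _ := by simp

end Conf

end LinearSSP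

namespace LinearSSP

/-! ### Concentration for the learner's own value functions -/

/-- The logarithmic factor for the learner's own value functions. -/
noncomputable def ownLevel (δ : ℝ) (n : ℕ) : ℝ := Real.log (16 * (n + 1) ^ 3 / δ)

theorem one_le_ownLevel {δ : ℝ} (hδ : 0 < δ) (hδ1 : δ < 1) (n : ℕ) : 1 ≤ ownLevel δ n := by
  unfold ownLevel
  have h1 : (1 : ℝ) ≤ ((n : ℝ) + 1) ^ 3 :=
    one_le_pow₀ (by linarith [(Nat.cast_nonneg n : (0 : ℝ) ≤ n)])
  rw [Real.le_log_iff_exp_le (by positivity), le_div_iff₀ hδ]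
  have := Real.exp_one_lt_d9
  have := Real.exp_pos 1
  nlinarith

theorem measure_le_add_of_imp {Ω : Type*} [MeasurableSpace Ω] {μ : Measure Ω} {s t u : Set Ω}
    {p q : ℝ≥0∞} (ht : μ t ≤ p) (hu : μ u ≤ q) (h : ∀ ω ∈ s, ω ∈ t ∨ ω ∈ u) : μ s ≤ p + q :=
  (measure_mono (μ := μ) (t := t ∪ u) h).trans ((measure_union_le _ _).trans (add_le_add ht hu))

section Own

variable {S : Type*} {A : Type*} [MeasurableSpace S] [MeasurableSpace A]
  {M : SSP S A} {d : ℕ} {φ : S → A → EuclideanSpace ℝ (Fin d)} {e δ : ℝ}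

/-- Concentration of the deviations of the learner's own value functions at index `n`. -/
def SSP.OwnGood (M : SSP S A) (φ : S → A → EuclideanSpace ℝ (Fin d)) (δ b : ℝ)
    (x : Trajectory S A) (w : ℕ → EuclideanSpace ℝ (Fin d)) (B : ℕ → ℝ) (n : ℕ) : Prop :=
  |∑ i ∈ Finset.range n, M.deviation x (optValue φ (w i) (B i)) i| ≤
    3 * √((∑ i ∈ Finset.range n, M.deviation x (optValue φ (w i) (B i)) i ^ 2) * ownLevel δ n) +
      16 * b * ownLevel δ n ∧
  |∑ i ∈ Finset.range n, M.stepMean x (optValue φ (w i) (B i)) i *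
      M.deviation x (optValue φ (w i) (B i)) i| ≤
    3 * √((∑ i ∈ Finset.range n, (M.stepMean x (optValue φ (w i) (B i)) i *
      M.deviation x (optValue φ (w i) (B i)) i) ^ 2) * ownLevel δ n) +
      64 * b ^ 2 * ownLevel δ n

open Classical in
/-- The estimate truncated to `(0, 2b]`. -/
noncomputable def truncEstimate (b B : ℝ) : ℝ := if 0 < B ∧ B ≤ 2 * b then B else 1

theorem truncEstimate_mem {b : ℝ} (hb : 1 ≤ b) (B : ℝ) :
    0 < truncEstimate b B ∧ truncEstimate b B ≤ 2 * b := by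
  unfold truncEstimate
  split_ifs with h
  · exact h
  · exact ⟨one_pos, by linarith⟩

theorem measurable_truncEstimate (b : ℝ) : Measurable (truncEstimate b) :=
  Measurable.ite (p := fun B => 0 < B ∧ B ≤ 2 * b) measurableSet_Ioc measurable_id
    measurable_const

variable {θ : EuclideanSpace ℝ (Fin d)} {G : (Option S → ℝ) → EuclideanSpace ℝ (Fin d)}
  {Ω : Type*} [mΩ : MeasurableSpace Ω] {Pr : Measure Ω} [IsProbabilityMeasure Pr]
  {ℱ : Filtration ℕ mΩ} {a : ℕ → Ω → A} {y : ℕ → Ω → Option S}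
  {wt : ℕ → Ω → EuclideanSpace ℝ (Fin d)} {Bt : ℕ → Ω → ℝ}

theorem ownGood_of {x : Trajectory S A} {w : ℕ → EuclideanSpace ℝ (Fin d)} {B : ℕ → ℝ} {b : ℝ}
    {n : ℕ}
    (h1 : |∑ i ∈ Finset.range n, 1 * (M.stepMean x (optValue φ (w i) (B i)) i -
      optValue φ (w i) (B i) (x.next i))| ≤ 3 * √((∑ i ∈ Finset.range n,
      (1 * (M.stepMean x (optValue φ (w i) (B i)) i -
      optValue φ (w i) (B i) (x.next i))) ^ 2) * ownLevel δ n) + 4 * (1 * (4 * b)) * ownLevel δ n)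
    (h2 : |∑ i ∈ Finset.range n, M.stepMean x (optValue φ (w i) (B i)) i *
      (M.stepMean x (optValue φ (w i) (B i)) i -
      optValue φ (w i) (B i) (x.next i))| ≤ 3 * √((∑ i ∈ Finset.range n,
      (M.stepMean x (optValue φ (w i) (B i)) i * (M.stepMean x (optValue φ (w i) (B i)) i -
      optValue φ (w i) (B i) (x.next i))) ^ 2) * ownLevel δ n) +
      4 * (4 * b * (4 * b)) * ownLevel δ n) :
    M.OwnGood φ δ b x w B n := by
  simp only [one_mul] at h1
  refine ⟨h1.trans (le_of_eq ?_), h2.trans (le_of_eq ?_)⟩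
  · rw [show 4 * (4 * b) = 16 * b by ring]; rfl
  · rw [show 4 * (4 * b * (4 * b)) = 64 * b ^ 2 by ring]; rfl

/-- No net is needed here: the parameters in use at a step are fixed before the transition is drawn,
so the deviations are martingale differences for the run itself. -/
theorem SSP.LinearOp.measure_exists_not_ownGood_le [Nonempty A] [Finite A]
    (hM : M.LinearOp φ θ G) (h : M.IsInteraction φ e δ Pr ℱ a y wt Bt)
    (hδ : 0 < δ) (hδ1 : δ < 1) {b : ℝ} (hb : 1 ≤ b) :
    Pr {ω | ¬ ∀ n : ℕ, M.OwnGood φ δ b (M.trajectory (a · ω) (y · ω)) (wt · ω)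
      (fun i => truncEstimate b (Bt i ω)) n} ≤ ENNReal.ofReal (δ / 2) := by
  have hS : Nonempty S := ⟨M.init⟩
  -- The martingale inequality needs bounds valid everywhere, whereas `B_t ≤ 2b` is known only on
  -- the good event. Truncation supplies the bound and changes nothing on that event.
  have hBm : ∀ n, Measurable[ℱ n] fun ω => truncEstimate b (Bt n ω) :=
    fun n => (measurable_truncEstimate b).comp (h.measurable_estimate n)
  set v : ℕ → Ω → Option S → ℝ := fun n ω => optValue φ (wt n ω) (truncEstimate b (Bt n ω)) with hv
  have hvm : ∀ n, Measurable[(ℱ n).prod inferInstance] fun p : Ω × Option S => v n p.1 p.2 :=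
    fun n => @measurable_optValue S _ A _ _ _ d φ hM.measurable_feature Ω (ℱ n) (wt n)
      (fun ω => truncEstimate b (Bt n ω)) (h.measurable_weight n) (hBm n)
  have hv0 : ∀ n ω o, 0 ≤ v n ω o := fun n ω o => by
    simp only [hv]
    exact optValue_nonneg (truncEstimate_mem hb (Bt n ω)).1.le o
  have hv1 : ∀ n ω o, v n ω o ≤ 4 * b := fun n ω o => by
    have h1 := optValue_le (φ := φ) (w := wt n ω) (truncEstimate_mem hb (Bt n ω)).1.le o
    have h2 := (truncEstimate_mem hb (Bt n ω)).2
    simp only [hv]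
    linarith
  obtain ⟨p1, p2, p3, p4⟩ := h.expDominated (c := fun _ _ => 1) (fun _ => measurable_const) hvm
    (b₁ := 1) (by simp) hv0 hv1
  have hmb : ∀ n ω, |M.stepMean (M.trajectory (a · ω) (y · ω)) (v n ω) n| ≤ 4 * b := by
    intro n ω
    obtain ⟨q1, q2⟩ := hM.stepMean_nonneg_le (M.trajectory (a · ω) (y · ω)) (wt n ω)
      (truncEstimate_mem hb (Bt n ω)).1.le n
    have q3 := (truncEstimate_mem hb (Bt n ω)).2
    exact abs_le.2 ⟨by linarith, by linarith⟩
  -- The conditional mean is itself predictable, so it may serve as the multiplier in the second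
  -- martingale.
  obtain ⟨r1, -, r3, r4⟩ := h.expDominated
    (c := fun n ω => M.stepMean (M.trajectory (a · ω) (y · ω)) (v n ω) n) p2 hvm hmb hv0 hv1
  have hfix : ∀ n : ℕ, Pr {ω | ¬ M.OwnGood φ δ b (M.trajectory (a · ω) (y · ω)) (wt · ω)
      (fun i => truncEstimate b (Bt i ω)) n} ≤
      ENNReal.ofReal (δ / 2) * ENNReal.ofReal (1 / ((n + 1) * (n + 2))) := by
    intro n
    have hL := one_le_ownLevel hδ hδ1 n
    have t1 := measure_abs_sum_gt_le p3 p1 (by positivity) p4 n hL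
    have t2 := measure_abs_sum_gt_le r3 r1 (by positivity) r4 n hL
    have hexp : Real.exp (-ownLevel δ n) = δ / (16 * (n + 1) ^ 3) := by
      rw [Real.exp_neg, ownLevel, Real.exp_log (by positivity), inv_div]
    rw [hexp] at t1 t2
    refine (measure_le_add_of_imp t1 t2 fun ω hω => ?_).trans ?_
    · by_contra hcon
      obtain ⟨u1, u2⟩ := not_or.1 hcon
      exact hω (ownGood_of (not_lt.1 u1) (not_lt.1 u2))
    · rw [← ENNReal.ofReal_add (by positivity) (by positivity),
        ← ENNReal.ofReal_mul (by positivity)]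
      refine ENNReal.ofReal_le_ofReal ?_
      have hn : (0 : ℝ) ≤ n := Nat.cast_nonneg n
      have e1 : 2 * ((n : ℝ) + 1) * (δ / (16 * (n + 1) ^ 3)) +
          2 * (n + 1) * (δ / (16 * (n + 1) ^ 3)) = δ / 2 * (1 / (2 * (n + 1) ^ 2)) := by
        field_simp; norm_num
      rw [e1]
      have e2 : ((n : ℝ) + 1) * (n + 2) ≤ 2 * (n + 1) ^ 2 := by nlinarith
      exact mul_le_mul_of_nonneg_left (one_div_le_one_div_of_le (by positivity) e2) (by positivity)
  have hsub : {ω | ¬ ∀ n : ℕ, M.OwnGood φ δ b (M.trajectory (a · ω) (y · ω)) (wt · ω)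
      (fun i => truncEstimate b (Bt i ω)) n} ⊆ ⋃ n : ℕ,
      {ω | ¬ M.OwnGood φ δ b (M.trajectory (a · ω) (y · ω)) (wt · ω)
      (fun i => truncEstimate b (Bt i ω)) n} := by
    intro ω hω
    by_contra hcon
    simp only [Set.mem_iUnion, not_exists, Set.mem_ofPred_eq, not_not] at hcon
    exact hω hcon
  calc _ ≤ ∑' n : ℕ, ENNReal.ofReal (δ / 2) * ENNReal.ofReal (1 / ((n + 1) * (n + 2))) := by
        refine (measure_mono hsub).trans ?_
        exact (measure_iUnion_le _).trans (ENNReal.tsum_le_tsum hfix)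
    _ ≤ ENNReal.ofReal (δ / 2) * 1 := by
        rw [ENNReal.tsum_mul_left]
        gcongr
        exact tsum_one_div_mul_le
    _ = _ := mul_one _

end Own

end LinearSSP

namespace LinearSSP

/-! ### Optimism -/

section FixedPoint

variable {S : Type*} {A : Type*} [MeasurableSpace S] [MeasurableSpace A]
  {M : SSP S A} {d : ℕ} {φ : S → A → EuclideanSpace ℝ (Fin d)}
  {θ : EuclideanSpace ℝ (Fin d)} {G : (Option S → ℝ) → EuclideanSpace ℝ (Fin d)}

omit [MeasurableSpace S] [MeasurableSpace A] in
theorem tendsto_optValue [Nonempty A] [Finite A] {u : ℕ → EuclideanSpace ℝ (Fin d)}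
    {w : EuclideanSpace ℝ (Fin d)} {B : ℝ} {s : S}
    (h : ∀ a, Tendsto (fun k => (inner ℝ (φ s a) (u k) : ℝ)) atTop (𝓝 (inner ℝ (φ s a) w))) :
    Tendsto (fun k => optValue φ (u k) B (some s)) atTop (𝓝 (optValue φ w B (some s))) := by
  have := Fintype.ofFinite A
  have h1 : ∀ v : EuclideanSpace ℝ (Fin d), optValue φ v B (some s) =
      Finset.univ.inf' Finset.univ_nonempty
        (fun a => min (max (inner ℝ (φ s a) v : ℝ) 0) (2 * B)) := fun v =>
    (Finset.inf'_univ_eq_ciInf _).symm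
  simp only [h1]
  refine Tendsto.finset_inf'_nhds_apply _ fun a _ => ?_
  exact ((h a).max tendsto_const_nhds).min tendsto_const_nhds

/-- Value iteration in parameter space. -/
noncomputable def valueIter (φ : S → A → EuclideanSpace ℝ (Fin d)) (θ : EuclideanSpace ℝ (Fin d))
    (G : (Option S → ℝ) → EuclideanSpace ℝ (Fin d)) (B : ℝ) : ℕ → EuclideanSpace ℝ (Fin d)
  | 0 => 0
  | k + 1 => bellman φ θ G (valueIter φ θ G B k) B

/-- The minimum over actions is at most the value at the action of `π`, and clipping at `2B` only
lowers it; induction compares with the truncated cost of any policy. -/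
theorem SSP.LinearOp.valueIter_le_costUpTo [Nonempty A] [Finite A] (hM : M.LinearOp φ θ G)
    {B : ℝ} (hB : 0 ≤ B) (π : S → A) (k : ℕ) (s : S) :
    ENNReal.ofReal (optValue φ (valueIter φ θ G B k) B (some s)) ≤ M.costUpTo π k s := by
  have := M.isMarkov
  induction k generalizing s with
  | zero =>
    obtain ⟨a⟩ := ‹Nonempty A›
    have h1 := optValue_le_apply (φ := φ) (w := (0 : EuclideanSpace ℝ (Fin d))) (B := B) s a
    simp only [inner_zero_right, max_self] at h1
    rw [valueIter, ENNReal.ofReal_of_nonpos (h1.trans (min_le_left _ _))]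
    exact bot_le
  | succ k ih =>
    set V := optValue φ (valueIter φ θ G B k) B with hV
    have hm := hM.measurable_optValue_const (valueIter φ θ G B k) B
    have hint : Integrable V (M.trans (s, π s)) :=
      Integrable.of_bound hm.aestronglyMeasurable (2 * B) (Eventually.of_forall fun o =>
        abs_optValue_le hB o)
    have h1 := optValue_le_apply (φ := φ) (w := valueIter φ θ G B (k + 1)) (B := B) s (π s)
    have hc : 0 ≤ M.cost s (π s) := M.cmin_nonneg.trans (M.cmin_le_cost _ _)
    have hI : 0 ≤ ∫ x, V x ∂(M.trans (s, π s)) := integral_nonneg (optValue_nonneg hB)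
    rw [valueIter, hM.inner_bellman _ hB, max_eq_left (by positivity)] at h1
    calc ENNReal.ofReal (optValue φ (valueIter φ θ G B (k + 1)) B (some s))
        ≤ ENNReal.ofReal (M.cost s (π s) + ∫ x, V x ∂(M.trans (s, π s))) :=
          ENNReal.ofReal_le_ofReal (h1.trans (min_le_left _ _))
      _ = ENNReal.ofReal (M.cost s (π s)) + ∫⁻ x, ENNReal.ofReal (V x) ∂(M.trans (s, π s)) := by
          rw [ENNReal.ofReal_add hc hI, ofReal_integral_eq_lintegral_ofReal hint
            (Eventually.of_forall (optValue_nonneg hB))]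
      _ ≤ M.costUpTo π (k + 1) s := by
          rw [SSP.costUpTo]
          gcongr with x
          cases x with
          | none => simp [hV, optValue]
          | some s' => exact ih s'

/-- Value iteration from zero is monotone and bounded by `2B`, so it converges pointwise. Taking `θ
+ G W` for the limit `W` gives a parameter without any contraction property. Optimality of the limit
is not needed, only that it lies below every `V^π`. -/
theorem SSP.LinearOp.exists_fixed_point [Nonempty A] [Finite A] (hM : M.LinearOp φ θ G)
    {B : ℝ} (hB : 0 ≤ B) :
    ∃ w, bellman φ θ G w B = w ∧
      ∀ s, ENNReal.ofReal (optValue φ w B (some s)) ≤ M.Vstar s := by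
  have := M.isMarkov
  set u := valueIter φ θ G B with hu
  set V : ℕ → Option S → ℝ := fun k => optValue φ (u k) B with hV
  have hVm : ∀ k, Measurable (V k) := fun k => hM.measurable_optValue_const _ _
  have hV0 : ∀ k o, 0 ≤ V k o := fun k => optValue_nonneg hB
  have hV2 : ∀ k o, V k o ≤ 2 * B := fun k => optValue_le hB
  have hint : ∀ k q, Integrable (V k) (M.trans q) := fun k q =>
    Integrable.of_bound (hVm k).aestronglyMeasurable (2 * B) (Eventually.of_forall fun o =>
      abs_optValue_le hB o)
  have hinner : ∀ k s a, (inner ℝ (φ s a) (u (k + 1)) : ℝ) =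
      M.cost s a + ∫ x, V k x ∂(M.trans (s, a)) := fun k s a => hM.inner_bellman _ hB s a
  have hmono : ∀ k o, V k o ≤ V (k + 1) o := by
    intro k
    induction k with
    | zero =>
      rintro (_ | s)
      · exact le_rfl
      · obtain ⟨a⟩ := ‹Nonempty A›
        have h1 := optValue_le_apply (φ := φ) (w := (0 : EuclideanSpace ℝ (Fin d))) (B := B) s a
        simp only [inner_zero_right, max_self] at h1
        exact (h1.trans (min_le_left _ _)).trans (hV0 1 _)
    | succ k ih =>
      rintro (_ | s)
      · exact le_rfl
      · refine le_ciInf fun a => (optValue_le_apply s a).trans ?_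
        refine min_le_min_right _ (max_le_max_right _ ?_)
        rw [hinner, hinner]
        gcongr
        · exact hint _ _
        · exact hint _ _
        · exact fun o => ih o
  have hmon : ∀ o, Monotone fun k => V k o := fun o => monotone_nat_of_le_succ fun k => hmono k o
  set W : Option S → ℝ := fun o => ⨆ k, V k o with hW
  have hbdd : ∀ o, BddAbove (Set.range fun k => V k o) := fun o =>
    ⟨2 * B, by rintro _ ⟨k, rfl⟩; exact hV2 k o⟩
  have hlim : ∀ o, Tendsto (fun k => V k o) atTop (𝓝 (W o)) := fun o =>
    tendsto_atTop_ciSup (hmon o) (hbdd o)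
  have hWm : Measurable W := measurable_of_tendsto_metrizable hVm (tendsto_pi_nhds.2 hlim)
  have hWb : ∀ o, |W o| ≤ 2 * B := fun o => by
    rw [abs_of_nonneg (ge_of_tendsto' (hlim o) fun k => hV0 k o)]
    exact le_of_tendsto' (hlim o) fun k => hV2 k o
  set w := θ + G W with hw
  have hlin : ∀ s a, Tendsto (fun k => (inner ℝ (φ s a) (u (k + 1)) : ℝ)) atTop
      (𝓝 (inner ℝ (φ s a) w)) := by
    intro s a
    rw [hw, inner_add_right, ← hM.cost_eq, hM.inner_eq W _ hWm hWb]
    simp only [hinner]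
    refine tendsto_const_nhds.add ?_
    exact tendsto_integral_of_dominated_convergence (fun _ => 2 * B)
      (fun k => (hVm k).aestronglyMeasurable) (integrable_const _)
      (fun k => Eventually.of_forall fun o => abs_optValue_le hB o) (Eventually.of_forall hlim)
  -- The inner products converge by dominated convergence, and a minimum over finitely many actions
  -- is continuous; uniqueness of limits identifies the value function of `w` with the limit of
  -- value iteration.
  have hopt : optValue φ w B = W := by
    funext o
    cases o with
    | none => exact tendsto_nhds_unique (tendsto_const_nhds (x := (0 : ℝ))) (hlim none)
    | some s =>
      have h1 : Tendsto (fun k => V (k + 1) (some s)) atTop (𝓝 (optValue φ w B (some s))) :=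
        tendsto_optValue fun a => hlin s a
      exact tendsto_nhds_unique h1 ((tendsto_add_atTop_iff_nat 1).2 (hlim (some s)))
  refine ⟨w, by rw [bellman, hopt], fun s => ?_⟩
  refine le_iInf₂ fun π _ => ?_
  rw [hopt]
  have h2 : Tendsto (fun k => ENNReal.ofReal (V k (some s))) atTop
      (𝓝 (ENNReal.ofReal (W (some s)))) := ENNReal.tendsto_ofReal (hlim _)
  exact le_of_tendsto' h2 fun k => (hM.valueIter_le_costUpTo hB π k s).trans
    (le_iSup (fun n => M.costUpTo π n s) k)

end FixedPoint

/-! ### Existence and doubling bound for a recomputation. -/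

section Recompute

variable {S : Type*} {A : Type*} {d : ℕ} {φ : S → A → EuclideanSpace ℝ (Fin d)} {e δ : ℝ}
  {x : Trajectory S A}

/-- The set is bounded, and both sides of each constraint depend continuously on `w`, even though
`w` enters as parameter and through its value function at once. -/
theorem isCompact_feasible [Nonempty A] [Finite A] (hφ : ∀ s a, ‖φ s a‖ ≤ 1) (n : ℕ) (B : ℝ) :
    IsCompact (x.feasible φ e δ n B) := by
  have hc : ∀ o, Continuous fun w => optValue φ w B o := continuous_optValue hφ B
  have hr : ∀ i, Continuous fun w => x.resid φ (optValue φ w B) w i := fun i => by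
    unfold Trajectory.resid
    exact ((continuous_const.inner continuous_id).sub continuous_const).sub (hc _)
  refine (isCompact_closedBall (0 : EuclideanSpace ℝ (Fin d)) (3 * √d * B)).of_isClosed_subset ?_
    fun w hw => by simpa using hw.1
  have : x.feasible φ e δ n B = {w | ‖w‖ ≤ 3 * √d * B} ∩
      ⋂ j ∈ levels d e B, ⋂ ν ∈ grid d (e / (n + 1)) (6 * √d * B), {w |
      |∑ i ∈ Finset.range n,
          clip j (inner ℝ (x.feat φ i) ν) * x.resid φ (optValue φ w B) w i| ≤
        √((∑ i ∈ Finset.range n,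
            clip j (inner ℝ (x.feat φ i) ν) ^ 2 * x.resid φ (optValue φ w B) w i ^ 2) *
          iota d e δ B (n + 1)) + B * (2 : ℝ) ^ j * iota d e δ B (n + 1)} := by
    ext w
    simp only [Set.mem_inter_iff, Set.mem_iInter]
    rfl
  rw [this]
  refine (isClosed_le continuous_norm continuous_const).inter ?_
  refine isClosed_biInter fun j _ => isClosed_biInter fun ν _ => isClosed_le ?_ ?_
  · exact (continuous_finsetSum _ fun i _ => continuous_const.mul (hr i)).abs
  · refine (Continuous.sqrt ?_).add continuous_const
    exact (continuous_finsetSum _ fun i _ => continuous_const.mul ((hr i).pow 2)).mul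
      continuous_const

/-- Doubling stops because some feasible value stays below a fixed `b`; compactness gives a
minimiser at the first admissible estimate. -/
theorem exists_recomputed [Nonempty A] [Finite A] (hφ : ∀ s a, ‖φ s a‖ ≤ 1) {n : ℕ} {B₀ b : ℝ}
    (hB₀ : 1 ≤ B₀)
    (hfeas : ∀ m : ℕ, ∃ w ∈ x.feasible φ e δ n (2 ^ m * B₀),
      optValue φ w (2 ^ m * B₀) (some (x.state n)) ≤ b) :
    ∃ w B, x.Recomputed φ e δ n B₀ w B := by
  classical
  have hex : ∃ m : ℕ, ∃ w ∈ x.feasible φ e δ n (2 ^ m * B₀),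
      optValue φ w (2 ^ m * B₀) (some (x.state n)) ≤ 2 ^ m * B₀ := by
    obtain ⟨m, hm⟩ := pow_unbounded_of_one_lt b (one_lt_two)
    obtain ⟨w, hw, hwb⟩ := hfeas m
    refine ⟨m, w, hw, hwb.trans (hm.le.trans ?_)⟩
    exact le_mul_of_one_le_right (by positivity) hB₀
  obtain ⟨w₀, hw₀, hw₀b⟩ := Nat.find_spec hex
  set m := Nat.find hex with hm
  obtain ⟨w, hw, hmin⟩ := (isCompact_feasible (x := x) (e := e) (δ := δ) hφ n
    (2 ^ m * B₀)).exists_isMinOn ⟨w₀, hw₀⟩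
    (continuous_optValue hφ (2 ^ m * B₀) (some (x.state n))).continuousOn
  refine ⟨w, 2 ^ m * B₀, m, rfl, hw, fun w' hw' => hmin hw', (hmin hw₀).trans hw₀b, ?_⟩
  intro k hk w' hw'
  by_contra hcon
  exact Nat.find_min hex hk ⟨w', hw', not_lt.1 hcon⟩

/-- An estimate is doubled only if every feasible value exceeds it, while one feasible value is at
most `b`. So the last rejected estimate is below `b`, and the accepted one is at most `2b`. -/
theorem Trajectory.Recomputed.le_of_feasible {n : ℕ} {B₀ B V b : ℝ}
    {w : EuclideanSpace ℝ (Fin d)} (h : x.Recomputed φ e δ n B₀ w B) (hB₀ : B₀ ≤ 2 * b)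
    (hVb : V ≤ b)
    (hfeas : ∀ m : ℕ, ∃ w ∈ x.feasible φ e δ n (2 ^ m * B₀),
      optValue φ w (2 ^ m * B₀) (some (x.state n)) ≤ V) :
    optValue φ w B (some (x.state n)) ≤ V ∧ optValue φ w B (some (x.state n)) ≤ B ∧ B ≤ 2 * b := by
  obtain ⟨m, rfl, hw, hmin, hle, hlt⟩ := h
  refine ⟨?_, hle, ?_⟩
  · obtain ⟨w', hw', h'⟩ := hfeas m
    exact (hmin w' hw').trans h'
  · cases m with
    | zero => simpa using hB₀
    | succ m =>
      obtain ⟨w', hw', h'⟩ := hfeas m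
      have := hlt m (Nat.lt_succ_self m) w' hw'
      rw [pow_succ]
      linarith

end Recompute

end LinearSSP

namespace LinearSSP

/-! ### Runs on which all confidence sets are valid -/

section GoodRun

variable {S : Type*} {A : Type*} [MeasurableSpace S] [MeasurableSpace A]
  {M : SSP S A} {d : ℕ} {φ : S → A → EuclideanSpace ℝ (Fin d)} {e δ b : ℝ}
  {θ : EuclideanSpace ℝ (Fin d)} {G : (Option S → ℝ) → EuclideanSpace ℝ (Fin d)}
  {x : Trajectory S A} {w : ℕ → EuclideanSpace ℝ (Fin d)} {B : ℕ → ℝ} {τ : ℕ → ℕ}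

/-- A run on which the confidence sets contain the Bellman updates of the parameters and the
recomputed values are optimistic. -/
structure SSP.GoodRun (M : SSP S A) (φ : S → A → EuclideanSpace ℝ (Fin d))
    (θ : EuclideanSpace ℝ (Fin d)) (G : (Option S → ℝ) → EuclideanSpace ℝ (Fin d)) (e δ b : ℝ)
    (x : Trajectory S A) (w : ℕ → EuclideanSpace ℝ (Fin d)) (B : ℕ → ℝ) (τ : ℕ → ℕ) : Prop where
  cost_eq : ∀ i, x.cost i = M.cost (x.state i) (x.action i)
  state_zero : x.state 0 = M.init
  state_succ : ∀ i, x.state (i + 1) = (x.next i).getD M.init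
  tau_zero : τ 0 = 0
  tau_le : ∀ n, τ n ≤ n
  one_le : ∀ n, 1 ≤ B n
  le_two_mul : ∀ n, B n ≤ 2 * b
  mem_confSet : ∀ n, w n ∈ x.confSet φ e δ (τ n) (w n) (B n)
  bellman_mem_confSet : ∀ n, bellman φ θ G (w n) (B n) ∈ x.confSet φ e δ (τ n) (w n) (B n)
  argmin : ∀ n a, inner ℝ (φ (x.state n) (x.action n)) (w n) ≤ inner ℝ (φ (x.state n) a) (w n)
  optValue_state_lt : ∀ n, optValue φ (w n) (B n) (some (x.state n)) < 2 * B n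
  optValue_init_le : optValue φ (w 0) (B 0) (some M.init) ≤ (M.Vstar M.init).toReal
  step : ∀ n, (x.Trigger φ e n (τ n) (w n) (B n) ∧ τ (n + 1) = n + 1 ∧ B n ≤ B (n + 1) ∧
      optValue φ (w (n + 1)) (B (n + 1)) (some (x.state (n + 1))) ≤
        (M.Vstar (x.state (n + 1))).toReal ∧
      optValue φ (w (n + 1)) (B (n + 1)) (some (x.state (n + 1))) ≤ B (n + 1)) ∨
    (¬ x.Trigger φ e n (τ n) (w n) (B n) ∧ τ (n + 1) = τ n ∧ w (n + 1) = w n ∧ B (n + 1) = B n)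

omit [MeasurableSpace S] [MeasurableSpace A] in
theorem Trajectory.mem_feasible {n : ℕ} {u : EuclideanSpace ℝ (Fin d)} {B : ℝ} :
    u ∈ x.feasible φ e δ n B ↔ u ∈ x.confSet φ e δ n u B := by
  rw [Trajectory.feasible, Set.mem_ofPred_eq]

theorem SSP.toReal_Vstar_le (hb : M.Bstar ≠ ⊤) (s : S) : (M.Vstar s).toReal ≤ M.Bstar.toReal :=
  ENNReal.toReal_mono hb (le_iSup M.Vstar s)

/-- The Bellman fixed point belongs to its own confidence set, so feasibility and optimism hold
simultaneously at every estimate reached by doubling. -/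
theorem SSP.LinearOp.recomputed_spec [Nonempty A] [Finite A] (hM : M.LinearOp φ θ G) (hd : 2 ≤ d)
    (he : 0 < e) (he1 : √d * e ≤ 1) (hδ : 0 < δ) (hδ1 : δ < 1) (hbt : M.Bstar ≠ ⊤)
    (hx : ∀ i, x.cost i = M.cost (x.state i) (x.action i)) {n : ℕ}
    (hnet : ∀ m : ℕ, M.NetGood φ e δ x n (2 ^ m)) {k : ℕ}
    (hk : (2 : ℝ) ^ k ≤ 2 * M.Bstar.toReal) {w : EuclideanSpace ℝ (Fin d)} {B : ℝ}
    (h : (∃ w' B', x.Recomputed φ e δ n (2 ^ k) w' B') → x.Recomputed φ e δ n (2 ^ k) w B) :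
    (∃ m : ℕ, B = 2 ^ m) ∧ 2 ^ k ≤ B ∧ B ≤ 2 * M.Bstar.toReal ∧ w ∈ x.confSet φ e δ n w B ∧
      bellman φ θ G w B ∈ x.confSet φ e δ n w B ∧
      optValue φ w B (some (x.state n)) ≤ (M.Vstar (x.state n)).toReal ∧
      optValue φ w B (some (x.state n)) ≤ B := by
  have hfeas : ∀ m : ℕ, ∃ u ∈ x.feasible φ e δ n (2 ^ m * 2 ^ k),
      optValue φ u (2 ^ m * 2 ^ k) (some (x.state n)) ≤ (M.Vstar (x.state n)).toReal := by
    intro m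
    have h1 : (1 : ℝ) ≤ 2 ^ m * 2 ^ k := by
      rw [← pow_add]; exact one_le_pow₀ (by norm_num)
    obtain ⟨u, hu, hV⟩ := hM.exists_fixed_point (B := 2 ^ m * 2 ^ k) (by linarith)
    refine ⟨u, ?_, ?_⟩
    · have h2 : ‖u‖ ≤ 3 * √d * (2 ^ m * 2 ^ k) := by
        rw [← hu]; exact hM.norm_bellman_le u h1
      have h3 := hM.bellman_mem_confSet hd he he1 hδ hδ1 hx h1
        (by rw [← pow_add]; exact hnet _) h2
      rw [hu] at h3
      exact Trajectory.mem_feasible.2 h3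
    · refine (ENNReal.ofReal_le_iff_le_toReal ?_).1 (hV _)
      exact ne_top_of_le_ne_top hbt (le_iSup M.Vstar _)
  have hr := h (exists_recomputed hM.norm_feature_le (one_le_pow₀ (by norm_num)) hfeas)
  obtain ⟨h1, h2, h3⟩ := hr.le_of_feasible hk (SSP.toReal_Vstar_le hbt _) hfeas
  obtain ⟨m, hm, hmem, -⟩ := hr
  rw [Trajectory.mem_feasible] at hmem
  have hB : B = 2 ^ (m + k) := by rw [hm, pow_add]
  have hB1 : 1 ≤ B := by rw [hB]; exact one_le_pow₀ (by norm_num)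
  refine ⟨⟨_, hB⟩, ?_, h3, hmem, ?_, h1, h2⟩
  · rw [hB]; exact pow_le_pow_right₀ (by norm_num) (by omega)
  · exact hM.bellman_mem_confSet hd he he1 hδ hδ1 hx hB1 (by rw [hB]; exact hnet _) hmem.1

/-- Induction along the run. All estimates are powers of two, so the concentration events indexed by
`m` cover them. At the current state the value is strictly below `2B`: a recomputation gives at most
`B`, and without one the overestimate condition has just failed. -/
theorem SSP.LinearOp.exists_goodRun [Nonempty A] [Finite A] (hM : M.LinearOp φ θ G) (hd : 2 ≤ d)
    (he : 0 < e) (he1 : √d * e ≤ 1) (hδ : 0 < δ) (hδ1 : δ < 1) (hbt : M.Bstar ≠ ⊤)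
    (hb1 : 1 ≤ M.Bstar.toReal) {a : ℕ → A} {y : ℕ → Option S}
    (hnet : ∀ n m : ℕ, M.NetGood φ e δ (M.trajectory a y) n (2 ^ m))
    (hrun : IsRun φ e δ (M.trajectory a y) w B) :
    ∃ τ, M.GoodRun φ θ G e δ M.Bstar.toReal (M.trajectory a y) w B τ := by
  obtain ⟨τ, h0, hinit, htrig, hnot, hargmin⟩ := hrun
  set x := M.trajectory a y with hxdef
  have hx : ∀ i, x.cost i = M.cost (x.state i) (x.action i) := fun _ => rfl
  have hs : ∀ i, x.state (i + 1) = (x.next i).getD M.init := fun _ => rfl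
  have h00 := hM.recomputed_spec hd he he1 hδ hδ1 hbt hx (hnet 0) (k := 0) (w := w 0) (B := B 0)
    (by norm_num; linarith) (by simpa using hinit)
  have inv : ∀ n, (∃ m : ℕ, B n = 2 ^ m) ∧ B n ≤ 2 * M.Bstar.toReal ∧ τ n ≤ n ∧
      w n ∈ x.confSet φ e δ (τ n) (w n) (B n) ∧
      bellman φ θ G (w n) (B n) ∈ x.confSet φ e δ (τ n) (w n) (B n) ∧
      optValue φ (w n) (B n) (some (x.state n)) < 2 * B n := by
    intro n
    induction n with
    | zero =>
      obtain ⟨⟨m, hm⟩, h1, h2, h3, h4, h5, h6⟩ := h00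
      rw [h0]
      refine ⟨⟨m, hm⟩, h2, le_rfl, h3, h4, ?_⟩
      norm_num at h1; linarith
    | succ n ih =>
      obtain ⟨⟨k, hk⟩, hk2, ht, hc1, hc2, hlt⟩ := ih
      by_cases hT : x.Trigger φ e n (τ n) (w n) (B n)
      · obtain ⟨ht1, hr⟩ := htrig n hT
        rw [hk] at hr
        obtain ⟨hm, h1, h2, h3, h4, h5, h6⟩ := hM.recomputed_spec hd he he1 hδ hδ1 hbt hx
          (hnet (n + 1)) (by rw [← hk]; exact hk2) hr
        rw [ht1]
        refine ⟨hm, h2, le_rfl, h3, h4, ?_⟩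
        have : (0 : ℝ) < 2 ^ k := by positivity
        linarith
      · obtain ⟨ht1, hw1, hB1⟩ := hnot n hT
        rw [ht1, hw1, hB1]
        refine ⟨⟨k, hk⟩, hk2, by omega, hc1, hc2, ?_⟩
        unfold Trajectory.Trigger at hT
        push Not at hT
        obtain ⟨hT1, hT2, -⟩ := hT
        rw [hs]
        obtain ⟨s, hs'⟩ := Option.ne_none_iff_exists'.1 hT1
        rw [hs'] at hT2 ⊢
        have hB0 : (0 : ℝ) ≤ B n := by rw [hk]; positivity
        exact lt_of_le_of_ne (optValue_le hB0 _) hT2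
  refine ⟨τ, ⟨hx, rfl, hs, h0, fun n => (inv n).2.2.1, fun n => ?_, fun n => (inv n).2.1,
    fun n => (inv n).2.2.2.1, fun n => (inv n).2.2.2.2.1, hargmin,
    fun n => (inv n).2.2.2.2.2, h00.2.2.2.2.2.1, fun n => ?_⟩⟩
  · obtain ⟨m, hm⟩ := (inv n).1
    rw [hm]; exact one_le_pow₀ (by norm_num)
  · obtain ⟨⟨k, hk⟩, hk2, -⟩ := inv n
    by_cases hT : x.Trigger φ e n (τ n) (w n) (B n)
    · left
      obtain ⟨ht1, hr⟩ := htrig n hT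
      rw [hk] at hr
      obtain ⟨hm, h1, h2, h3, h4, h5, h6⟩ := hM.recomputed_spec hd he he1 hδ hδ1 hbt hx
        (hnet (n + 1)) (by rw [← hk]; exact hk2) hr
      exact ⟨hT, ht1, by rw [hk]; exact h1, h5, h6⟩
    · exact Or.inr ⟨hT, hnot n hT⟩

end GoodRun

end LinearSSP

namespace LinearSSP

/-! ### Bellman errors under the confidence constraints -/

section BellmanGap

variable {S : Type*} {A : Type*} [MeasurableSpace S] [MeasurableSpace A] [Nonempty A] [Finite A]
  {M : SSP S A} {d : ℕ} {φ : S → A → EuclideanSpace ℝ (Fin d)} {e δ : ℝ}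
  {θ : EuclideanSpace ℝ (Fin d)} {G : (Option S → ℝ) → EuclideanSpace ℝ (Fin d)}
  {x : Trajectory S A} {w : EuclideanSpace ℝ (Fin d)} {B : ℝ} {n : ℕ}

/-- The Bellman error `U V_{w,B} - w`. -/
noncomputable def bellmanGap (φ : S → A → EuclideanSpace ℝ (Fin d))
    (θ : EuclideanSpace ℝ (Fin d)) (G : (Option S → ℝ) → EuclideanSpace ℝ (Fin d))
    (w : EuclideanSpace ℝ (Fin d)) (B : ℝ) : EuclideanSpace ℝ (Fin d) :=
  bellman φ θ G w B - w

omit [Nonempty A] [Finite A] in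
theorem SSP.LinearOp.abs_inner_feat_le (hM : M.LinearOp φ θ G) (i : ℕ)
    (u : EuclideanSpace ℝ (Fin d)) : |(inner ℝ (x.feat φ i) u : ℝ)| ≤ ‖u‖ := by
  refine (abs_real_inner_le_norm _ _).trans ?_
  exact mul_le_of_le_one_left (norm_nonneg _) (hM.norm_feature_le _ _)

omit [Nonempty A] [Finite A] in
theorem SSP.LinearOp.abs_inner_feat_sub_le (hM : M.LinearOp φ θ G) (i : ℕ)
    (u v : EuclideanSpace ℝ (Fin d)) :
    |(inner ℝ (x.feat φ i) u : ℝ) - inner ℝ (x.feat φ i) v| ≤ ‖u - v‖ := by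
  rw [← inner_sub_right]
  exact hM.abs_inner_feat_le i _

theorem SSP.LinearOp.inner_feat_add_gap (hM : M.LinearOp φ θ G)
    (hx : ∀ i, x.cost i = M.cost (x.state i) (x.action i)) (hB : 0 ≤ B) (i : ℕ) :
    inner ℝ (x.feat φ i) w + inner ℝ (x.feat φ i) (bellmanGap φ θ G w B) =
      x.cost i + M.stepMean x (optValue φ w B) i := by
  rw [← inner_add_right, bellmanGap, add_sub_cancel, hx]
  exact hM.inner_bellman w hB _ _

theorem SSP.LinearOp.resid_bellman (hM : M.LinearOp φ θ G)
    (hx : ∀ i, x.cost i = M.cost (x.state i) (x.action i)) (hB : 0 ≤ B) (i : ℕ) :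
    x.resid φ (optValue φ w B) (bellman φ θ G w B) i = M.deviation x (optValue φ w B) i := by
  unfold Trajectory.resid Trajectory.feat SSP.deviation SSP.stepMean
  rw [hM.inner_bellman w hB, hx]; ring

theorem SSP.LinearOp.resid_self (hM : M.LinearOp φ θ G)
    (hx : ∀ i, x.cost i = M.cost (x.state i) (x.action i)) (hB : 0 ≤ B) (i : ℕ) :
    x.resid φ (optValue φ w B) w i = M.deviation x (optValue φ w B) i -
      inner ℝ (x.feat φ i) (bellmanGap φ θ G w B) := by
  have := hM.inner_feat_add_gap (w := w) hx hB i
  unfold Trajectory.resid SSP.deviation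
  linarith

theorem SSP.LinearOp.abs_deviation_le (hM : M.LinearOp φ θ G) (hB : 0 ≤ B) (i : ℕ) :
    |M.deviation x (optValue φ w B) i| ≤ 2 * B := by
  have h1 := hM.stepMean_nonneg_le x w hB i
  have h2 := optValue_nonneg (φ := φ) (w := w) hB (x.next i)
  have h3 := optValue_le (φ := φ) (w := w) hB (x.next i)
  unfold SSP.deviation
  rw [abs_le]; constructor <;> linarith

omit [Nonempty A] [Finite A] in
theorem SSP.deviation_sq (M : SSP S A) (x : Trajectory S A) (v : Option S → ℝ) (i : ℕ) :
    M.deviation x v i ^ 2 =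
      v (x.next i) ^ 2 - M.stepMean x v i ^ 2 + 2 * (M.stepMean x v i * M.deviation x v i) := by
  unfold SSP.deviation; ring

/-- Difference of squares: approximate Bellman consistency bounds `V - PV` by the cost plus the
Bellman error, and `V + PV ≤ 4B`. -/
theorem SSP.LinearOp.optValue_sq_sub_le (hM : M.LinearOp φ θ G)
    (hx : ∀ i, x.cost i = M.cost (x.state i) (x.action i)) (hc : ∀ i, 0 ≤ x.cost i)
    (hB : 0 ≤ B) (i : ℕ) :
    optValue φ w B (some (x.state i)) ^ 2 - M.stepMean x (optValue φ w B) i ^ 2 ≤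
      4 * B * (x.cost i + |(inner ℝ (x.feat φ i) (bellmanGap φ θ G w B) : ℝ)|) := by
  have h1 := hM.inner_feat_add_gap (w := w) hx hB i
  have h2 := hM.stepMean_nonneg_le x w hB i
  have h3 := optValue_nonneg (φ := φ) (w := w) hB (some (x.state i))
  have h4 := optValue_le (φ := φ) (w := w) hB (some (x.state i))
  have h5 : optValue φ w B (some (x.state i)) ≤ max (inner ℝ (x.feat φ i) w : ℝ) 0 :=
    (optValue_le_apply (x.state i) (x.action i)).trans (min_le_left _ _)
  set p := M.stepMean x (optValue φ w B) i
  set V := optValue φ w B (some (x.state i))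
  set g : ℝ := inner ℝ (x.feat φ i) (bellmanGap φ θ G w B)
  have h6 := neg_abs_le g
  have h7 := abs_nonneg g
  have hci := hc i
  have h8 : V - p ≤ x.cost i + |g| := by
    have : V ≤ x.cost i + p + |g| := h5.trans (max_le (by linarith) (by linarith))
    linarith
  have h9 : (V - p) * (V + p) ≤ (x.cost i + |g|) * (4 * B) := by
    rcases le_total 0 (V - p) with h | h
    · exact mul_le_mul h8 (by linarith) (by linarith) (by linarith)
    · exact (mul_nonpos_of_nonpos_of_nonneg h (by linarith)).trans (by positivity)
  nlinarith

/-- The conditional mean `P_i V` is itself linear in `φ_i`, with parameter `G V`. The constraint of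
`Ω` for that vector, at the highest level where clipping is inactive, is therefore the required
concentration inequality. -/
theorem SSP.LinearOp.abs_sum_stepMean_mul_deviation_le (hM : M.LinearOp φ θ G) (hd : 2 ≤ d)
    (he : 0 < e) (he1 : √d * e ≤ 1) (hx : ∀ i, x.cost i = M.cost (x.state i) (x.action i))
    (hB : 1 ≤ B) (hI : 0 ≤ iota d e δ B (n + 1))
    (hU : bellman φ θ G w B ∈ x.confSet φ e δ n w B) :
    |∑ i ∈ Finset.range n, M.stepMean x (optValue φ w B) i * M.deviation x (optValue φ w B) i| ≤
      3 * B * √((∑ i ∈ Finset.range n, M.deviation x (optValue φ w B) i ^ 2) *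
        iota d e δ B (n + 1)) + 12 * √d * B ^ 2 * iota d e δ B (n + 1) + 2 * B := by
  have hB0 : (0 : ℝ) ≤ B := by linarith
  have hd1 : (1 : ℝ) ≤ √d := Real.one_le_sqrt.2 (by exact_mod_cast (by omega : 1 ≤ d))
  have hdB : 1 ≤ √d * B := by nlinarith
  have hn : (0 : ℝ) ≤ n := Nat.cast_nonneg n
  have he2 : e ≤ 1 := by nlinarith
  set I := iota d e δ B (n + 1) with hIdef
  set g := G (optValue φ w B) with hg
  have hgn : ‖g‖ ≤ 6 * √d * B := by
    have := hM.norm_op_le w hB0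
    rw [← hg] at this; linarith
  obtain ⟨g', hg', -, hnear⟩ := exists_mem_grid_near (ξ := e / (n + 1)) (by positivity) hgn
  set η := ‖g - g'‖ with hη
  have hη0 : 0 ≤ η := norm_nonneg _
  have hηn : η * (n + 1) ≤ 1 := by
    calc η * (n + 1) ≤ (√d * (e / (n + 1))) * (n + 1) := by gcongr
      _ = √d * e := by field_simp
      _ ≤ 1 := he1
  have hη1 : η ≤ 1 := by nlinarith
  obtain ⟨hj, hj1, hj2⟩ := mem_levels_ceil_logb (d := d) (e := e) (B := B) (x := 6 * √d * B) he
    (by linarith) le_rfl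
  have hp : ∀ i, M.stepMean x (optValue φ w B) i = inner ℝ (x.feat φ i) g := fun i =>
    (hM.inner_op w hB0 _ _).symm
  have hyp : ∀ i, |M.stepMean x (optValue φ w B) i - inner ℝ (x.feat φ i) g'| ≤ η := fun i => by
    rw [hp]; exact hM.abs_inner_feat_sub_le i g g'
  have hy : ∀ i, |(inner ℝ (x.feat φ i) g' : ℝ)| ≤ 3 * B := fun i => by
    have h1 := hM.stepMean_nonneg_le x w hB0 i
    have h2 := abs_le.1 (hyp i)
    rw [abs_le]; constructor <;> linarith
  have hclip : ∀ i, clip ⌈Real.logb 2 (6 * √d * B)⌉ (inner ℝ (x.feat φ i) g') =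
      inner ℝ (x.feat φ i) g' := fun i => by
    refine clip_of_abs_le (le_trans ((hy i).trans ?_) hj1)
    nlinarith
  have hmain := hU.2 _ hj g' hg'
  simp only [hclip, hM.resid_bellman hx hB0] at hmain
  rw [← hIdef] at hmain
  have h1 : ∑ i ∈ Finset.range n, (inner ℝ (x.feat φ i) g' : ℝ) ^ 2 *
      M.deviation x (optValue φ w B) i ^ 2 ≤
      (3 * B) ^ 2 * ∑ i ∈ Finset.range n, M.deviation x (optValue φ w B) i ^ 2 := by
    rw [Finset.mul_sum]
    refine Finset.sum_le_sum fun i _ => mul_le_mul_of_nonneg_right ?_ (sq_nonneg _)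
    exact sq_le_sq' (by linarith [(abs_le.1 (hy i)).1]) (abs_le.1 (hy i)).2
  have h2 : √((∑ i ∈ Finset.range n, (inner ℝ (x.feat φ i) g' : ℝ) ^ 2 *
      M.deviation x (optValue φ w B) i ^ 2) * I) ≤
      3 * B * √((∑ i ∈ Finset.range n, M.deviation x (optValue φ w B) i ^ 2) * I) := by
    calc _ ≤ √((3 * B) ^ 2 *
          ((∑ i ∈ Finset.range n, M.deviation x (optValue φ w B) i ^ 2) * I)) := by
          refine Real.sqrt_le_sqrt ?_
          rw [← mul_assoc]
          exact mul_le_mul_of_nonneg_right h1 hI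
      _ = _ := by rw [Real.sqrt_mul (by positivity), Real.sqrt_sq (by positivity)]
  have h3 : |∑ i ∈ Finset.range n, M.stepMean x (optValue φ w B) i *
      M.deviation x (optValue φ w B) i - ∑ i ∈ Finset.range n, (inner ℝ (x.feat φ i) g' : ℝ) *
      M.deviation x (optValue φ w B) i| ≤ 2 * B := by
    rw [← Finset.sum_sub_distrib]
    calc _ ≤ ∑ i ∈ Finset.range n, η * (2 * B) := by
          refine (Finset.abs_sum_le_sum_abs _ _).trans (Finset.sum_le_sum fun i _ => ?_)
          rw [← sub_mul, abs_mul]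
          exact mul_le_mul (hyp i) (hM.abs_deviation_le hB0 i) (abs_nonneg _) hη0
      _ = (n * η) * (2 * B) := by rw [Finset.sum_const, Finset.card_range, nsmul_eq_mul]; ring
      _ ≤ 1 * (2 * B) := by gcongr; nlinarith
      _ = 2 * B := one_mul _
  have h4 := abs_sub_abs_le_abs_sub (∑ i ∈ Finset.range n, M.stepMean x (optValue φ w B) i *
      M.deviation x (optValue φ w B) i) (∑ i ∈ Finset.range n, (inner ℝ (x.feat φ i) g' : ℝ) *
      M.deviation x (optValue φ w B) i)
  have h5 : B * 2 ^ ⌈Real.logb 2 (6 * √d * B)⌉ * I ≤ 12 * √d * B ^ 2 * I := by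
    refine mul_le_mul_of_nonneg_right ?_ hI
    nlinarith
  linarith

/-- A deviation squared is `V(s')² - (PV)²` plus a cross term. For one fixed value function `V(s')²
- V(s)²` telescopes, so the sum is paid for by cost and Bellman error, independently of the horizon.
-/
theorem SSP.LinearOp.sum_deviation_sq_le (hM : M.LinearOp φ θ G) (hd : 2 ≤ d)
    (he : 0 < e) (he1 : √d * e ≤ 1) (hx : ∀ i, x.cost i = M.cost (x.state i) (x.action i))
    (hc : ∀ i, 0 ≤ x.cost i) (hs : ∀ i, x.state (i + 1) = (x.next i).getD M.init)
    (hB : 1 ≤ B) (hI : 12 ≤ iota d e δ B (n + 1))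
    (hU : bellman φ θ G w B ∈ x.confSet φ e δ n w B) :
    ∑ i ∈ Finset.range n, M.deviation x (optValue φ w B) i ^ 2 ≤
      6 * B * (∑ i ∈ Finset.range n, x.cost i +
        ∑ i ∈ Finset.range n, |(inner ℝ (x.feat φ i) (bellmanGap φ θ G w B) : ℝ)|) +
      91 * √d * B ^ 2 * iota d e δ B (n + 1) := by
  have hB0 : (0 : ℝ) ≤ B := by linarith
  have hd1 : (1 : ℝ) ≤ √d := Real.one_le_sqrt.2 (by exact_mod_cast (by omega : 1 ≤ d))
  have h1 := hM.abs_sum_stepMean_mul_deviation_le hd he he1 hx hB (by linarith) hU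
  set I := iota d e δ B (n + 1)
  set V := optValue φ w B with hV
  set Q := ∑ i ∈ Finset.range n, M.deviation x V i ^ 2 with hQ
  have hQ0 : 0 ≤ Q := Finset.sum_nonneg fun i _ => sq_nonneg _
  set C := ∑ i ∈ Finset.range n, x.cost i
  set X := ∑ i ∈ Finset.range n, |(inner ℝ (x.feat φ i) (bellmanGap φ θ G w B) : ℝ)|
  have hV0 : ∀ o, 0 ≤ V o := optValue_nonneg hB0
  have hVB : ∀ o, V o ≤ 2 * B := optValue_le hB0
  -- At an episode end the successor is the goal, with value zero, while the next state is the
  -- initial one; the inequality goes the right way, so the sum telescopes across episodes.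
  have h2 : ∀ i, V (x.next i) ≤ V (some (x.state (i + 1))) := fun i => by
    rw [hs]
    cases h : x.next i with
    | none => exact hV0 _
    | some s => exact le_rfl
  have h3 : ∀ i, M.deviation x V i ^ 2 ≤
      (V (some (x.state (i + 1))) ^ 2 - V (some (x.state i)) ^ 2) +
      4 * B * (x.cost i + |(inner ℝ (x.feat φ i) (bellmanGap φ θ G w B) : ℝ)|) +
      2 * (M.stepMean x V i * M.deviation x V i) := fun i => by
    have e1 := M.deviation_sq x V i
    have e2 := hM.optValue_sq_sub_le (w := w) hx hc hB0 i
    have e3 : V (x.next i) ^ 2 ≤ V (some (x.state (i + 1))) ^ 2 :=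
      pow_le_pow_left₀ (hV0 _) (h2 i) 2
    rw [← hV] at e2
    linarith
  have h4 := Finset.sum_le_sum fun i (_ : i ∈ Finset.range n) => h3 i
  rw [Finset.sum_add_distrib, Finset.sum_add_distrib, Finset.sum_range_sub
    (fun i => V (some (x.state i)) ^ 2), ← Finset.mul_sum, ← Finset.mul_sum,
    Finset.sum_add_distrib] at h4
  have h5 : V (some (x.state n)) ^ 2 ≤ (2 * B) ^ 2 := pow_le_pow_left₀ (hV0 _) (hVB _) 2
  have h6 := le_abs_self (∑ i ∈ Finset.range n, M.stepMean x V i * M.deviation x V i)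
  have h7 : √(Q * I) = √Q * √I := Real.sqrt_mul hQ0 _
  have h8 : 6 * B * (√Q * √I) ≤ Q / 3 + 27 * B ^ 2 * I := by
    have a1 := Real.sq_sqrt hQ0
    have a2 := Real.sq_sqrt (by linarith : 0 ≤ I)
    have a3 := sq_nonneg (√Q - 9 * (B * √I))
    have a4 : (B * √I) ^ 2 = B ^ 2 * I := by rw [mul_pow, a2]
    nlinarith
  have h9 : Q ≤ 4 * B ^ 2 + 4 * B * (C + X) +
      2 * (3 * B * (√Q * √I) + 12 * √d * B ^ 2 * I + 2 * B) := by
    have := sq_nonneg (V (some (x.state 0)))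
    rw [h7] at h1
    linarith
  have b1 : B ≤ B ^ 2 := by nlinarith
  have b2 : B ^ 2 * 12 ≤ B ^ 2 * I := by gcongr
  have b3 : 1 * (B ^ 2 * I) ≤ √d * (B ^ 2 * I) := by
    have : 0 ≤ I := by linarith
    gcongr
  have b4 : √d * B ^ 2 * I = √d * (B ^ 2 * I) := by ring
  nlinarith

end BellmanGap

end LinearSSP

namespace LinearSSP

/-! ### Clipped quadratic forms of a Bellman error at the last recomputation. -/

section ClippedSum

/-- The unknown `F` occurs also under a square root on the right; the arithmetic–geometric mean
inequality absorbs half of it on the left. -/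
theorem clipped_sum_bound {F l s I B Q R : ℝ} (hF : 0 ≤ F) (hl : 0 < l) (hs : 0 ≤ s) (hB : B ≤ s)
    (hQ : 0 ≤ Q) (hI : 12 ≤ I) (hs1 : 1 ≤ s)
    (hR : R ≤ √(2 * l ^ 2 * Q * I) + √(12 * l * s * F * I) + √(12 * l ^ 2 * s * I))
    (h : F ≤ l * √(Q * I) + R + 2 * (B * l * I) + l) :
    F ≤ l * (5 * √(Q * I) + 34 * s * I) := by
  have hq : √(2 * l ^ 2 * Q * I) ≤ 3 / 2 * (l * √(Q * I)) := by
    apply Real.sqrt_le_iff.2 ⟨by positivity, ?_⟩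
    rw [mul_pow, mul_pow, Real.sq_sqrt (by positivity)]
    have : 0 ≤ l ^ 2 * (Q * I) := by positivity
    nlinarith
  have h2 : √(12 * l * s * F * I) ≤ F / 2 + 6 * (l * s * I) := by
    apply Real.sqrt_le_iff.2 ⟨by positivity, ?_⟩
    nlinarith [sq_nonneg (F / 2 - 6 * (l * s * I))]
  have hsI : 12 ≤ s * I := by nlinarith
  have h3 : √(12 * l ^ 2 * s * I) ≤ l * (s * I) := by
    apply Real.sqrt_le_iff.2 ⟨by positivity, ?_⟩
    have : l ^ 2 * (s * I) * 12 ≤ l ^ 2 * (s * I) * (s * I) := by gcongr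
    nlinarith
  have h4 : B * l * I ≤ s * l * I := by gcongr
  have h5 : l * 12 ≤ l * (s * I) := by gcongr
  nlinarith

variable {S : Type*} {A : Type*} [MeasurableSpace S] [MeasurableSpace A] [Nonempty A] [Finite A]
  {M : SSP S A} {d : ℕ} {φ : S → A → EuclideanSpace ℝ (Fin d)} {e δ : ℝ}
  {θ : EuclideanSpace ℝ (Fin d)} {G : (Option S → ℝ) → EuclideanSpace ℝ (Fin d)}
  {x : Trajectory S A} {w : EuclideanSpace ℝ (Fin d)} {B : ℝ} {n : ℕ}

omit [MeasurableSpace S] [MeasurableSpace A] [Nonempty A] [Finite A] in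
theorem norm_bellmanGap_le (hw : ‖w‖ ≤ 3 * √d * B) (hU : ‖bellman φ θ G w B‖ ≤ 3 * √d * B) :
    ‖bellmanGap φ θ G w B‖ ≤ 6 * √d * B := by
  have := norm_sub_le (bellman φ θ G w B) w
  unfold bellmanGap
  linarith

/-- Clipped squared sums of residuals of the parameter itself. -/
theorem sum_clip_sq_resid_le {N : ℕ} {c y z g : ℕ → ℝ} {l s η R : ℝ} (hs : 0 ≤ s)
    (hl : 0 ≤ l) (hR : 0 ≤ R)
    (hc : ∀ i, |c i| ≤ l) (hcz : ∀ i, 0 ≤ c i * z i)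
    (hg : ∀ i, |g i| ≤ R) (hgz : ∀ i, |g i - z i| ≤ η) (hη : N * η ≤ 1) (hRs : R = 6 * s) :
    ∑ i ∈ Finset.range N, c i ^ 2 * (y i - g i) ^ 2 ≤
      2 * l ^ 2 * ∑ i ∈ Finset.range N, y i ^ 2 +
      (12 * l * s * (∑ i ∈ Finset.range N, c i * z i) + 12 * l ^ 2 * s) := by
  have h1 : ∀ i, c i ^ 2 * (y i - g i) ^ 2 ≤
      2 * l ^ 2 * y i ^ 2 + 12 * l * s * (c i * z i) + 12 * l ^ 2 * s * η := fun i => by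
    have e0 : c i ^ 2 ≤ l ^ 2 := sq_le_sq' (abs_le.1 (hc i)).1 (abs_le.1 (hc i)).2
    have e1 : c i ^ 2 * y i ^ 2 ≤ l ^ 2 * y i ^ 2 := by gcongr
    have e2 : |c i| * |g i| ≤ c i * z i + l * η := by
      calc |c i| * |g i| = |c i * g i| := (abs_mul _ _).symm
        _ = |c i * z i + c i * (g i - z i)| := by congr 1; ring
        _ ≤ |c i * z i| + |c i * (g i - z i)| := abs_add_le _ _
        _ ≤ c i * z i + l * η := by
          rw [abs_of_nonneg (hcz i), abs_mul]
          gcongr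
          · exact hc i
          · exact hgz i
    -- The extra square `c² g²` is at most `l R` times `|c g|`, which is the summand of the form
    -- being bounded, up to rounding. This makes the inequality for that form self-bounding.
    have e3 : c i ^ 2 * g i ^ 2 ≤ l * R * (c i * z i + l * η) := by
      calc c i ^ 2 * g i ^ 2 = (|c i| * |g i|) * (|c i| * |g i|) := by
            rw [← sq_abs (c i), ← sq_abs (g i)]; ring
        _ ≤ (l * R) * (|c i| * |g i|) := by
            gcongr
            · exact hc i
            · exact hg i
        _ ≤ _ := by gcongr
    have e4 : c i ^ 2 * (y i - g i) ^ 2 ≤ 2 * (c i ^ 2 * y i ^ 2) + 2 * (c i ^ 2 * g i ^ 2) := by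
      have := mul_nonneg (sq_nonneg (c i)) (sq_nonneg (y i + g i))
      nlinarith
    rw [hRs] at e3
    nlinarith
  refine (Finset.sum_le_sum fun i _ => h1 i).trans ?_
  rw [Finset.sum_add_distrib, Finset.sum_add_distrib, ← Finset.mul_sum, ← Finset.mul_sum,
    Finset.sum_const, Finset.card_range, nsmul_eq_mul]
  have : 12 * l ^ 2 * s * (N * η) ≤ 12 * l ^ 2 * s * 1 := by gcongr
  linarith

/-- Here `y` are deviations, `g` the inner products with the Bellman error and `z` those with its
grid point. The two constraints concern `y` and `y - g`; their difference isolates `∑ clip(z) g`. -/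
theorem sum_clip_le_of_residuals (j : ℤ) {n : ℕ} {z g y : ℕ → ℝ} {s η I B : ℝ} (hs1 : 1 ≤ s)
    (hBs : B ≤ s) (hI : 12 ≤ I) (hg : ∀ i, |g i| ≤ 6 * s)
    (hgz : ∀ i, |g i - z i| ≤ η) (hηn : n * η ≤ 1)
    (hm1 : |∑ i ∈ Finset.range n, clip j (z i) * y i| ≤
      √((∑ i ∈ Finset.range n, clip j (z i) ^ 2 * y i ^ 2) * I) + B * 2 ^ j * I)
    (hm2 : |∑ i ∈ Finset.range n, clip j (z i) * (y i - g i)| ≤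
      √((∑ i ∈ Finset.range n, clip j (z i) ^ 2 * (y i - g i) ^ 2) * I) + B * 2 ^ j * I) :
    ∑ i ∈ Finset.range n, clip j (g i) * g i ≤
      2 ^ j * (5 * √((∑ i ∈ Finset.range n, y i ^ 2) * I) + 36 * s * I) := by
  have hl0 : (0 : ℝ) < 2 ^ j := by positivity
  have hcl : ∀ i, |clip j (z i)| ≤ 2 ^ j := fun i => abs_clip_le j _
  have hF0 : 0 ≤ ∑ i ∈ Finset.range n, clip j (z i) * z i :=
    Finset.sum_nonneg fun i _ => clip_mul_self_nonneg j _
  have h2 := sum_clip_sq_resid_le (N := n) (c := fun i => clip j (z i)) (y := y) (z := z) (g := g)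
    (l := 2 ^ j) (s := s) (η := η) (R := 6 * s) (by linarith) hl0.le (by linarith) hcl
    (fun i => clip_mul_self_nonneg j _) hg hgz hηn rfl
  have hQ0 : 0 ≤ ∑ i ∈ Finset.range n, y i ^ 2 := Finset.sum_nonneg fun i _ => sq_nonneg _
  have h1 : ∑ i ∈ Finset.range n, clip j (z i) ^ 2 * y i ^ 2 ≤
      (2 ^ j) ^ 2 * ∑ i ∈ Finset.range n, y i ^ 2 := by
    rw [Finset.mul_sum]
    refine Finset.sum_le_sum fun i _ => mul_le_mul_of_nonneg_right ?_ (sq_nonneg _)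
    exact sq_le_sq' (abs_le.1 (hcl i)).1 (abs_le.1 (hcl i)).2
  have h4 : ∑ i ∈ Finset.range n, clip j (z i) * z i ≤
      ∑ i ∈ Finset.range n, clip j (z i) * g i + 2 ^ j := by
    have : ∑ i ∈ Finset.range n, clip j (z i) * (z i - g i) ≤ ∑ _i ∈ Finset.range n, 2 ^ j * η := by
      refine Finset.sum_le_sum fun i _ => ?_
      refine (le_abs_self _).trans ?_
      rw [abs_mul, abs_sub_comm (z i)]
      exact mul_le_mul (hcl i) (hgz i) (abs_nonneg _) hl0.le
    rw [Finset.sum_const, Finset.card_range, nsmul_eq_mul] at this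
    simp only [mul_sub, Finset.sum_sub_distrib] at this
    nlinarith
  have h5 : ∑ i ∈ Finset.range n, clip j (z i) * g i =
      ∑ i ∈ Finset.range n, clip j (z i) * y i -
        ∑ i ∈ Finset.range n, clip j (z i) * (y i - g i) := by
    rw [← Finset.sum_sub_distrib]
    exact Finset.sum_congr rfl fun i _ => by ring
  have h7 : ∑ i ∈ Finset.range n, clip j (g i) * g i ≤
      ∑ i ∈ Finset.range n, clip j (z i) * z i + 2 * 2 ^ j := by
    have : ∑ i ∈ Finset.range n, clip j (g i) * g i ≤
        ∑ i ∈ Finset.range n, (clip j (z i) * z i + 2 * 2 ^ j * η) := by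
      refine Finset.sum_le_sum fun i _ => (clip_mul_self_sub_le j (g i) (z i)).trans ?_
      have := hgz i
      gcongr
    rw [Finset.sum_add_distrib, Finset.sum_const, Finset.card_range, nsmul_eq_mul] at this
    nlinarith
  rw [h5] at h4
  generalize ∑ i ∈ Finset.range n, clip j (z i) * z i = F at *
  generalize ∑ i ∈ Finset.range n, y i ^ 2 = Q at *
  generalize ∑ i ∈ Finset.range n, clip j (z i) * y i = a1 at *
  generalize ∑ i ∈ Finset.range n, clip j (z i) * (y i - g i) = a2 at *
  generalize ∑ i ∈ Finset.range n, clip j (z i) ^ 2 * (y i - g i) ^ 2 = q2 at *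
  generalize ∑ i ∈ Finset.range n, clip j (z i) ^ 2 * y i ^ 2 = q1 at *
  generalize ∑ i ∈ Finset.range n, clip j (g i) * g i = Fg at *
  generalize (2 : ℝ) ^ j = l at *
  have hI0 : 0 ≤ I := by linarith
  have e1 : √(q1 * I) ≤ l * √(Q * I) := by
    calc _ ≤ √(l ^ 2 * (Q * I)) := by
          refine Real.sqrt_le_sqrt ?_
          rw [← mul_assoc]
          exact mul_le_mul_of_nonneg_right h1 hI0
      _ = _ := by rw [Real.sqrt_mul (by positivity), Real.sqrt_sq hl0.le]
  have e3 : √(q2 * I) ≤ √(2 * l ^ 2 * Q * I) + √(12 * l * s * F * I) + √(12 * l ^ 2 * s * I) := by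
    refine (Real.sqrt_le_sqrt (mul_le_mul_of_nonneg_right h2 hI0)).trans ?_
    rw [add_mul, add_mul]
    refine (sqrt_add_le (by positivity) (by positivity)).trans ?_
    rw [add_assoc]
    refine add_le_add le_rfl ?_
    exact sqrt_add_le (by positivity) (by positivity)
  have h6 := clipped_sum_bound hF0 hl0 (by linarith) hBs hQ0 hI hs1 e3 (by
      have := le_abs_self a1
      have := neg_abs_le a2
      linarith)
  have h8 : l * 1 ≤ l * (s * I) := by
    refine mul_le_mul_of_nonneg_left ?_ hl0.le
    nlinarith
  nlinarith

theorem SSP.LinearOp.sum_clip_gap_le_of_sq (hM : M.LinearOp φ θ G) (hd : 2 ≤ d)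
    (he : 0 < e) (he1 : √d * e ≤ 1) (hx : ∀ i, x.cost i = M.cost (x.state i) (x.action i))
    (hB : 1 ≤ B) (hI : 12 ≤ iota d e δ B (n + 1)) (hw : w ∈ x.confSet φ e δ n w B)
    (hU : bellman φ θ G w B ∈ x.confSet φ e δ n w B) {j : ℤ} (hj : j ∈ levels d e B) :
    ∑ i ∈ Finset.range n, clip j (inner ℝ (x.feat φ i) (bellmanGap φ θ G w B)) *
        inner ℝ (x.feat φ i) (bellmanGap φ θ G w B) ≤
      2 ^ j * (5 * √((∑ i ∈ Finset.range n, M.deviation x (optValue φ w B) i ^ 2) *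
        iota d e δ B (n + 1)) + 36 * (√d * B) * iota d e δ B (n + 1)) := by
  have hB0 : (0 : ℝ) ≤ B := by linarith
  have hd1 : (1 : ℝ) ≤ √d := Real.one_le_sqrt.2 (by exact_mod_cast (by omega : 1 ≤ d))
  have hn : (0 : ℝ) ≤ n := Nat.cast_nonneg n
  have hν := norm_bellmanGap_le hw.1 hU.1
  obtain ⟨ν', hν', -, hnear⟩ := exists_mem_grid_near (ξ := e / (n + 1)) (by positivity) hν
  have hη0 : 0 ≤ ‖bellmanGap φ θ G w B - ν'‖ := norm_nonneg _
  have hηn1 : ‖bellmanGap φ θ G w B - ν'‖ * (n + 1) ≤ 1 := by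
    calc _ ≤ (√d * (e / (n + 1))) * (n + 1) := by gcongr
      _ = √d * e := by field_simp
      _ ≤ 1 := he1
  have hηn : n * ‖bellmanGap φ θ G w B - ν'‖ ≤ 1 := by linarith
  have hm1 := hU.2 j hj ν' hν'
  have hm2 := hw.2 j hj ν' hν'
  simp only [hM.resid_bellman hx hB0] at hm1
  simp only [hM.resid_self hx hB0] at hm2
  refine sum_clip_le_of_residuals j (one_le_mul_of_one_le_of_one_le hd1 hB)
    (le_mul_of_one_le_left hB0 hd1) hI (fun i => ?_)
    (fun i => hM.abs_inner_feat_sub_le i _ ν') hηn hm1 hm2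
  exact ((hM.abs_inner_feat_le i _).trans hν).trans (le_of_eq (by ring))

/-- Used at the lowest level, where `2^j ≤ 2e`: the additive errors then sum to at most twice the
total cost. -/
theorem le_zpow_neg_mul_clip_add (j : ℤ) (y : ℝ) :
    |y| ≤ (2 ^ j)⁻¹ * (clip j y * y) + 2 ^ j := by
  rw [clip_mul_self]
  have hl : (0 : ℝ) < 2 ^ j := by positivity
  rcases le_total (|y|) (2 ^ j) with h | h
  · have : 0 ≤ (2 ^ j : ℝ)⁻¹ * min (2 ^ j * |y|) (y ^ 2) := by positivity
    linarith
  · have h1 : 2 ^ j * |y| ≤ y ^ 2 := by rw [← sq_abs, sq]; gcongr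
    rw [min_eq_left h1, ← mul_assoc, inv_mul_cancel₀ hl.ne']
    linarith

/-- Here `Q` is the sum of squared deviations and `X` the total absolute Bellman error. Each bounds
the other, `X` with only `√Q`, so the system closes in terms of the cost `C`. -/
theorem solve_sq_bound {Q C X s I B : ℝ} (hQ : 0 ≤ Q) (hI : 12 ≤ I) (hB : 1 ≤ B) (hBs : B ≤ s)
    (hC : 0 ≤ C) (h1 : Q ≤ 6 * B * (C + X) + 91 * (s * B) * I)
    (h2 : X ≤ 5 * √(Q * I) + 36 * s * I + 2 * C) :
    5 * √(Q * I) + 36 * s * I ≤ 30 * √(B * C * I) + 231 * s * I := by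
  have hs0 : 0 ≤ s := by linarith
  have e1 : √(Q * I) = √Q * √I := Real.sqrt_mul hQ _
  have e2 : 30 * B * (√Q * √I) ≤ Q / 2 + 450 * (B ^ 2 * I) := by
    have a1 := Real.sq_sqrt hQ
    have a2 := Real.sq_sqrt (by linarith : 0 ≤ I)
    have a3 := sq_nonneg (√Q - 30 * (B * √I))
    have a4 : (B * √I) ^ 2 = B ^ 2 * I := by rw [mul_pow, a2]
    nlinarith
  have e3 : B ^ 2 * I ≤ s * B * I := by rw [sq]; gcongr
  have e4 : 6 * B * (C + X) ≤ 6 * B * (3 * C + 5 * (√Q * √I) + 36 * s * I) := by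
    rw [e1] at h2
    exact mul_le_mul_of_nonneg_left (by linarith) (by linarith)
  have e5 : Q ≤ 36 * (B * C) + 1514 * (s * B * I) := by nlinarith
  have e6 : Q * I ≤ 36 * (B * C * I) + 1514 * (s * I) ^ 2 := by
    have : Q * I ≤ (36 * (B * C) + 1514 * (s * B * I)) * I := by gcongr
    have : s * B * I * I ≤ s * s * I * I := by gcongr
    nlinarith
  have e7 : √(Q * I) ≤ 6 * √(B * C * I) + 39 * (s * I) := by
    apply Real.sqrt_le_iff.2 ⟨by positivity, ?_⟩
    have := Real.sq_sqrt (by positivity : 0 ≤ B * C * I)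
    have : 0 ≤ √(B * C * I) * (s * I) := by positivity
    nlinarith [sq_nonneg (s * I)]
  linarith

/-- The same estimate is used twice: at the lowest level it bounds the total Bellman error and hence
the variance, which is then inserted at the given level `j`. -/
theorem SSP.LinearOp.sum_clip_gap_le (hM : M.LinearOp φ θ G) (hd : 2 ≤ d)
    (he : 0 < e) (he1 : √d * e ≤ 1) (hx : ∀ i, x.cost i = M.cost (x.state i) (x.action i))
    (hs : ∀ i, x.state (i + 1) = (x.next i).getD M.init) (hc : ∀ i, e ≤ x.cost i)
    (hB : 1 ≤ B) (hI : 12 ≤ iota d e δ B (n + 1)) (hw : w ∈ x.confSet φ e δ n w B)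
    (hU : bellman φ θ G w B ∈ x.confSet φ e δ n w B) {j : ℤ} (hj : j ∈ levels d e B) :
    ∑ i ∈ Finset.range n, clip j (inner ℝ (x.feat φ i) (bellmanGap φ θ G w B)) *
        inner ℝ (x.feat φ i) (bellmanGap φ θ G w B) ≤
      2 ^ j * (30 * √(B * (∑ i ∈ Finset.range n, x.cost i) * iota d e δ B (n + 1)) +
        231 * (√d * B) * iota d e δ B (n + 1)) := by
  have hd1 : (1 : ℝ) ≤ √d := Real.one_le_sqrt.2 (by exact_mod_cast (by omega : 1 ≤ d))
  refine (hM.sum_clip_gap_le_of_sq hd he he1 hx hB hI hw hU hj).trans ?_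
  have hQ := hM.sum_deviation_sq_le hd he he1 hx (fun i => he.le.trans (hc i)) hs hB hI hU
  obtain ⟨hj0, h1, h2⟩ := mem_levels_ceil_logb (d := d) (e := e) (B := B) (x := e) he le_rfl
    (by nlinarith)
  have hF := hM.sum_clip_gap_le_of_sq hd he he1 hx hB hI hw hU hj0
  set I := iota d e δ B (n + 1)
  set j0 := ⌈Real.logb 2 e⌉
  have hl0 : (0 : ℝ) < 2 ^ j0 := by positivity
  refine mul_le_mul_of_nonneg_left ?_ (by positivity)
  have hCn : n * e ≤ ∑ i ∈ Finset.range n, x.cost i := by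
    have := Finset.sum_le_sum fun i (_ : i ∈ Finset.range n) => hc i
    rwa [Finset.sum_const, Finset.card_range, nsmul_eq_mul] at this
  refine solve_sq_bound (X := ∑ i ∈ Finset.range n,
    |(inner ℝ (x.feat φ i) (bellmanGap φ θ G w B) : ℝ)|)
    (Finset.sum_nonneg fun i _ => sq_nonneg _) hI hB (by nlinarith)
    (Finset.sum_nonneg fun i _ => he.le.trans (hc i)) ?_ ?_
  · refine hQ.trans (le_of_eq ?_); ring
  · have h3 := Finset.sum_le_sum fun i (_ : i ∈ Finset.range n) =>
      le_zpow_neg_mul_clip_add j0 (inner ℝ (x.feat φ i) (bellmanGap φ θ G w B))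
    rw [Finset.sum_add_distrib, ← Finset.mul_sum, Finset.sum_const, Finset.card_range,
      nsmul_eq_mul] at h3
    have h4 := mul_le_mul_of_nonneg_left hF (inv_nonneg.2 hl0.le)
    rw [← mul_assoc, inv_mul_cancel₀ hl0.ne', one_mul] at h4
    have h5 : (n : ℝ) * 2 ^ j0 ≤ n * (2 * e) := by gcongr
    linarith

end ClippedSum

end LinearSSP

namespace LinearSSP

/-! ### Bellman errors along a good run -/

theorem iota_mono {d : ℕ} {e δ B B' t t' : ℝ} (hd : 2 ≤ d) (he : 0 < e) (hδ : 0 < δ)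
    (hB : 0 < B) (hBB : B ≤ B') (ht : 0 < t) (htt : t ≤ t') :
    iota d e δ B t ≤ iota d e δ B' t' := by
  have hd0 : (0 : ℝ) < d := by exact_mod_cast (by omega : 0 < d)
  have hB' : 0 ≤ B' := hB.le.trans hBB
  unfold iota
  gcongr

theorem twelve_le_iota {d n : ℕ} {e δ B : ℝ} (hd : 2 ≤ d) (he : 0 < e) (he1 : √d * e ≤ 1)
    (hδ : 0 < δ) (hδ1 : δ < 1) (hB : 1 ≤ B) : 12 ≤ iota d e δ B (n + 1) := by
  have hd1 : (1 : ℝ) ≤ √d := Real.one_le_sqrt.2 (by exact_mod_cast (by omega : 1 ≤ d))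
  have h := one_le_log_logArg (n := n) hd he (by nlinarith) hδ hδ1 hB
  have hd2 : (2 : ℝ) ≤ d := by exact_mod_cast hd
  rw [iota_eq]
  nlinarith

/-- The bound of the potential of a Bellman error, relative to the clipping level. -/
noncomputable def gapBound (d : ℕ) (b C I : ℝ) : ℝ :=
  8 * d ^ 2 * (30 * √(2 * b * C * I) + 470 * √d * b * I + 288 * d * b ^ 2)

theorem gapBound_mono {d : ℕ} {b C C' I I' : ℝ} (hb : 0 ≤ b) (hC : 0 ≤ C) (hCC : C ≤ C')
    (hI : 0 ≤ I) (hII : I ≤ I') : gapBound d b C I ≤ gapBound d b C' I' := by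
  have hC' : 0 ≤ C' := hC.trans hCC
  unfold gapBound
  gcongr

/-- The chain is: rounding to the grid, the lazy update inequality, rounding back, and the bound at
the last recomputation. The regulariser with `‖ν‖² ≤ 144 d b²` produces the `d b²` term of
`gapBound`. -/
theorem potential_arith {d : ℕ} {b B C C' I I' l F F' Φ Φ' Ψ' N : ℝ} (hd : 2 ≤ d) (hl : 0 < l)
    (hB : 1 ≤ B) (hBb : B ≤ 2 * b) (hC : 0 ≤ C) (hCC : C ≤ C') (hI : 12 ≤ I) (hII : I ≤ I')
    (hN : N ≤ (6 * √d * B) ^ 2)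
    (hF : F ≤ l * (30 * √(B * C * I) + 231 * (√d * B) * I))
    (h1 : Φ ≤ Φ' + 2 * l + l * N) (h2 : Φ' ≤ 8 * d ^ 2 * Ψ') (h3 : Ψ' ≤ F' + l * N)
    (h4 : F' ≤ F + 2 * l) :
    Φ ≤ l * gapBound d b C' I' := by
  have hd2 : (2 : ℝ) ≤ d := by exact_mod_cast hd
  have hsd := Real.sq_sqrt (by linarith : (0 : ℝ) ≤ d)
  have hd1 : (1 : ℝ) ≤ √d := Real.one_le_sqrt.2 (by linarith)
  have hb : 0 < b := by linarith
  have hC' : 0 ≤ C' := hC.trans hCC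
  have e1 : √(B * C * I) ≤ √(2 * b * C' * I') := by gcongr
  have e2 : (√d * B) * I ≤ √d * (2 * b) * I' := by gcongr
  have e3 : N ≤ 144 * d * b ^ 2 := by
    refine hN.trans ?_
    calc (6 * √d * B) ^ 2 ≤ (6 * √d * (2 * b)) ^ 2 := by gcongr
      _ = 144 * √d ^ 2 * b ^ 2 := by ring
      _ = _ := by rw [hsd]
  have e4 : 6 ≤ √d * b * I' := by
    have : 1 * (1 / 2) * 12 ≤ √d * b * I' := by
      gcongr
      · linarith
      · linarith
    linarith
  set P := 30 * √(2 * b * C' * I') + 462 * (√d * b * I') with hP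
  have e5 : F ≤ l * P := hF.trans (mul_le_mul_of_nonneg_left (by linarith) hl.le)
  have e6 : l * N ≤ l * (144 * d * b ^ 2) := mul_le_mul_of_nonneg_left e3 hl.le
  have e7 : Ψ' ≤ l * (P + 2 + 144 * d * b ^ 2) := by linarith
  have hd32 : (1 : ℝ) ≤ 8 * d ^ 2 := by nlinarith
  have e8 : Φ ≤ 8 * d ^ 2 * (l * (P + 2 + 144 * d * b ^ 2)) + l * (2 + 144 * d * b ^ 2) := by
    have := mul_le_mul_of_nonneg_left e7 (by linarith : (0 : ℝ) ≤ 8 * d ^ 2)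
    linarith
  have e9 : l * (2 + 144 * d * b ^ 2) ≤ 8 * d ^ 2 * (l * (2 + 144 * d * b ^ 2)) :=
    le_mul_of_one_le_left (by positivity) hd32
  have e10 : l * (P + 2 + 144 * d * b ^ 2) + l * (2 + 144 * d * b ^ 2) ≤
      l * (30 * √(2 * b * C' * I') + 470 * √d * b * I' + 288 * d * b ^ 2) := by
    rw [← mul_add]
    refine mul_le_mul_of_nonneg_left ?_ hl.le
    linarith
  have e11 := mul_le_mul_of_nonneg_left e10 (by linarith : (0 : ℝ) ≤ 8 * d ^ 2)
  have e12 : l * gapBound d b C' I' = 8 * d ^ 2 *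
      (l * (30 * √(2 * b * C' * I') + 470 * √d * b * I' + 288 * d * b ^ 2)) := by
    unfold gapBound; ring
  rw [e12]
  linarith

section GoodRunGap

variable {S : Type*} {A : Type*} [MeasurableSpace S] [MeasurableSpace A] [Nonempty A] [Finite A]
  {M : SSP S A} {d : ℕ} {φ : S → A → EuclideanSpace ℝ (Fin d)} {e δ b : ℝ}
  {θ : EuclideanSpace ℝ (Fin d)} {G : (Option S → ℝ) → EuclideanSpace ℝ (Fin d)}
  {x : Trajectory S A} {w : ℕ → EuclideanSpace ℝ (Fin d)} {B : ℕ → ℝ} {τ : ℕ → ℕ}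

omit [Nonempty A] [Finite A] in
theorem SSP.LinearOp.sum_clip_le_add (hM : M.LinearOp φ θ G) (j : ℤ) {n m : ℕ} (hm : m ≤ n)
    {ν ν' : EuclideanSpace ℝ (Fin d)} (h : n * ‖ν - ν'‖ ≤ 1) :
    ∑ i ∈ Finset.range m, clip j (inner ℝ (x.feat φ i) ν) * inner ℝ (x.feat φ i) ν ≤
      ∑ i ∈ Finset.range m, clip j (inner ℝ (x.feat φ i) ν') * inner ℝ (x.feat φ i) ν' +
        2 * 2 ^ j := by
  have hl0 : (0 : ℝ) < 2 ^ j := by positivity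
  have h1 : ∑ i ∈ Finset.range m, clip j (inner ℝ (x.feat φ i) ν) * inner ℝ (x.feat φ i) ν ≤
      ∑ i ∈ Finset.range m, (clip j (inner ℝ (x.feat φ i) ν') * inner ℝ (x.feat φ i) ν' +
        2 * 2 ^ j * ‖ν - ν'‖) := by
    refine Finset.sum_le_sum fun i _ =>
      (clip_mul_self_sub_le j _ (inner ℝ (x.feat φ i) ν')).trans ?_
    have := hM.abs_inner_feat_sub_le (x := x) i ν ν'
    gcongr
  rw [Finset.sum_add_distrib, Finset.sum_const, Finset.card_range, nsmul_eq_mul] at h1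
  have h2 : (m : ℝ) * ‖ν - ν'‖ ≤ 1 :=
    (mul_le_mul_of_nonneg_right (by exact_mod_cast hm) (norm_nonneg _)).trans h
  nlinarith

omit [Nonempty A] [Finite A] in
theorem SSP.GoodRun.eq_or_not_trigger (h : M.GoodRun φ θ G e δ b x w B τ) (n : ℕ) :
    τ n = n ∨ ∃ m, n = m + 1 ∧ ¬ x.Trigger φ e m (τ n) (w n) (B n) := by
  cases n with
  | zero => exact Or.inl h.tau_zero
  | succ m =>
    rcases h.step m with ⟨-, h1, -⟩ | ⟨h0, h1, h2, h3⟩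
    · exact Or.inl h1
    · right
      rw [h1, h2, h3]
      exact ⟨m, rfl, h0⟩

/-- The confidence constraints hold at the last recomputation time `τ n` only; since then the
parameters are unchanged and the lazy condition has just failed, so the potential has grown by at
most `8 d²` at nearby grid points. -/
theorem SSP.GoodRun.potential_le (h : M.GoodRun φ θ G e δ b x w B τ) (hM : M.LinearOp φ θ G)
    (hd : 2 ≤ d) (he : 0 < e) (he1 : √d * e ≤ 1) (hδ : 0 < δ) (hδ1 : δ < 1)
    (hc : ∀ i, e ≤ x.cost i) (n : ℕ) {j : ℤ} (hj : j ∈ levels d e (B n)) :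
    x.potential φ j n (bellmanGap φ θ G (w n) (B n)) ≤
      2 ^ j * gapBound d b (∑ i ∈ Finset.range n, x.cost i) (iota d e δ (2 * b) (n + 1)) := by
  have hB := h.one_le n
  have hBb := h.le_two_mul n
  have hτ := h.tau_le n
  have hI := twelve_le_iota (n := τ n) hd he he1 hδ hδ1 hB
  have hF := hM.sum_clip_gap_le hd he he1 h.cost_eq h.state_succ hc hB hI (h.mem_confSet n)
    (h.bellman_mem_confSet n) hj
  have hν : ‖bellmanGap φ θ G (w n) (B n)‖ ≤ 6 * √d * B n :=
    norm_bellmanGap_le (h.mem_confSet n).1 (h.bellman_mem_confSet n).1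
  have hl0 : (0 : ℝ) < 2 ^ j := by positivity
  have hII : iota d e δ (B n) (τ n + 1) ≤ iota d e δ (2 * b) (n + 1) :=
    iota_mono hd he hδ (by linarith) hBb (by positivity)
      (by have : (τ n : ℝ) ≤ n := by exact_mod_cast hτ
          linarith)
  have hC0 : ∀ i, 0 ≤ x.cost i := fun i => he.le.trans (hc i)
  have hCC : ∑ i ∈ Finset.range (τ n), x.cost i ≤ ∑ i ∈ Finset.range n, x.cost i :=
    Finset.sum_le_sum_of_subset_of_nonneg (Finset.range_mono hτ) fun i _ _ => hC0 i
  have hC := Finset.sum_nonneg fun i (_ : i ∈ Finset.range (τ n)) => hC0 i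
  set ν := bellmanGap φ θ G (w n) (B n)
  have hνsq : ‖ν‖ ^ 2 ≤ (6 * √d * B n) ^ 2 := by gcongr
  rcases h.eq_or_not_trigger n with h0 | ⟨m, hm, hT⟩
  · rw [h0] at hF hI hII hCC hC
    have hp : 0 ≤ x.potential φ j n ν := seqPotential_nonneg (φ := x.feat φ) j n ν
    refine potential_arith hd hl0 hB hBb hC hCC hI hII hνsq hF (Φ' := x.potential φ j n ν)
      (Ψ' := x.potential φ j n ν) ?_ ?_ (F' := ∑ i ∈ Finset.range n,
        clip j (inner ℝ (x.feat φ i) ν) * inner ℝ (x.feat φ i) ν) le_rfl (by linarith)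
    · have : 0 ≤ 2 ^ j * ‖ν‖ ^ 2 := by positivity
      linarith
    · have hd2 : (2 : ℝ) ≤ d := by exact_mod_cast hd
      exact le_mul_of_one_le_left hp (by nlinarith)
  -- With `n = m + 1`, the test at index `m` concerns the potential after `m + 1` transitions on the
  -- grid of mesh `e / (m + 2)`, exactly the potential at index `n`.
  · obtain ⟨ν', hν', hν'ν, hnear⟩ := exists_mem_grid_near (ξ := e / (m + 2)) (by positivity) hν
    have hηn : n * ‖ν - ν'‖ ≤ 1 := by
      have hm0 : (0 : ℝ) ≤ m := Nat.cast_nonneg m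
      calc (n : ℝ) * ‖ν - ν'‖ ≤ (m + 2) * (√d * (e / (m + 2))) := by
            gcongr
            rw [hm]; push_cast; linarith
        _ = √d * e := by field_simp
        _ ≤ 1 := he1
    have hT2 : x.potential φ j n ν' ≤ 8 * d ^ 2 * x.potential φ j (τ n) ν' := by
      unfold Trajectory.Trigger at hT
      push Not at hT
      have := hT.2.2 j hj ν' hν'
      rwa [← hm] at this
    have hsq : ‖ν'‖ ^ 2 ≤ ‖ν‖ ^ 2 := by gcongr
    refine potential_arith hd hl0 hB hBb hC hCC hI hII hνsq hF ?_ hT2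
      (F' := ∑ i ∈ Finset.range (τ n), clip j (inner ℝ (x.feat φ i) ν') * inner ℝ (x.feat φ i) ν')
      ?_ ?_
    · have h1 := hM.sum_clip_le_add (x := x) j le_rfl hηn
      have : 0 ≤ 2 ^ j * ‖ν'‖ ^ 2 := by positivity
      unfold Trajectory.potential
      linarith
    · unfold Trajectory.potential
      gcongr
    · refine hM.sum_clip_le_add (x := x) j hτ ?_
      rw [norm_sub_rev]; exact hηn

end GoodRunGap

end LinearSSP

namespace LinearSSP

theorem potentialBound_mono {d T T' : ℕ} {e : ℝ} (hd : 0 < d) (he : 0 < e) (h : T ≤ T') :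
    potentialBound d T e ≤ potentialBound d T' e := by
  have hd1 : (1 : ℝ) ≤ d := by exact_mod_cast hd
  have h1 : 0 ≤ Real.log (d + 2 * (T : ℝ) ^ 2 / e) := by
    apply Real.log_nonneg
    have : 0 ≤ 2 * (T : ℝ) ^ 2 / e := by positivity
    linarith
  have h2 : (Nat.log 2 T : ℝ) ≤ Nat.log 2 T' := by exact_mod_cast Nat.log_mono_right h
  unfold potentialBound
  gcongr

/-! ### Relative growth of the potential. -/

section PotentialGrowth

variable {d : ℕ} {φ : ℕ → EuclideanSpace ℝ (Fin d)}

/-- The summand of the generalised elliptical potential lemma. -/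
noncomputable def growth (φ : ℕ → EuclideanSpace ℝ (Fin d)) (j : ℤ) (t : ℕ)
    (ν : EuclideanSpace ℝ (Fin d)) : ℝ :=
  min 1 (clip j (inner ℝ (φ t) ν) * inner ℝ (φ t) ν / seqPotential φ j t ν)

theorem growth_nonneg (j : ℤ) (t : ℕ) (ν : EuclideanSpace ℝ (Fin d)) : 0 ≤ growth φ j t ν :=
  le_min zero_le_one (div_nonneg (clip_mul_self_nonneg _ _) (seqPotential_nonneg _ _ _))

theorem seqPotential_pos {j : ℤ} {n : ℕ} {ν : EuclideanSpace ℝ (Fin d)} (hν : ν ≠ 0) :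
    0 < seqPotential φ j n ν :=
  add_pos_of_nonneg_of_pos (Finset.sum_nonneg fun _ _ => clip_mul_self_nonneg _ _)
    (mul_pos (by positivity) (by positivity))

/-- If the potential grows by a factor of at least `e`, then the growth terms sum up to one. -/
theorem one_le_sum_growth {j : ℤ} {ν : EuclideanSpace ℝ (Fin d)} {m n : ℕ} (hmn : m ≤ n)
    (h : 32 * seqPotential φ j m ν < seqPotential φ j n ν) :
    1 ≤ ∑ t ∈ Finset.Ico m n, growth φ j t ν := by
  have hν : ν ≠ 0 := by
    rintro rfl
    have h1 := seqPotential_nonneg (φ := φ) j m 0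
    have : seqPotential φ j n 0 = 0 := by simp [seqPotential]
    linarith
  by_contra hlt
  push Not at hlt
  have hr : ∀ t ∈ Finset.Ico m n, growth φ j t ν < 1 := fun t ht =>
    (Finset.single_le_sum (fun s _ => growth_nonneg j s ν) ht).trans_lt hlt
  -- If the growth terms sum to less than one, none is truncated, each multiplies the potential by
  -- `1 + growth ≤ exp growth`, and the total factor stays below `exp 1 < 32`.
  have hgrow : ∀ k, m ≤ k → k ≤ n →
      seqPotential φ j k ν ≤
        seqPotential φ j m ν * Real.exp (∑ t ∈ Finset.Ico m k, growth φ j t ν) := by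
    intro k hk
    induction k, hk using Nat.le_induction with
    | base => simp
    | succ k hk ih =>
      intro hkn
      have hp := seqPotential_pos (φ := φ) (j := j) (n := k) hν
      have h1 := hr k (Finset.mem_Ico.2 ⟨hk, hkn⟩)
      have h2 : growth φ j k ν =
          clip j (inner ℝ (φ k) ν) * inner ℝ (φ k) ν / seqPotential φ j k ν := by
        unfold growth at h1 ⊢
        rcases min_lt_iff.1 h1 with h | h
        · exact absurd h (lt_irrefl _)
        · exact min_eq_right h.le
      have h3 : seqPotential φ j (k + 1) ν = seqPotential φ j k ν * (growth φ j k ν + 1) := by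
        rw [seqPotential_succ, h2]; field_simp; ring
      rw [Finset.sum_Ico_succ_top hk, Real.exp_add, ← mul_assoc, h3]
      have := growth_nonneg (φ := φ) j k ν
      exact mul_le_mul (ih (by omega)) (Real.add_one_le_exp _) (by positivity)
        (mul_nonneg (seqPotential_nonneg _ _ _) (Real.exp_pos _).le)
  have h4 := hgrow n hmn le_rfl
  have hp := seqPotential_pos (φ := φ) (j := j) (n := m) hν
  have h5 : Real.exp (∑ t ∈ Finset.Ico m n, growth φ j t ν) ≤ 32 := by
    refine (Real.exp_le_exp.2 hlt.le).trans ?_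
    have := Real.exp_one_lt_d9
    linarith
  nlinarith

/-- When `2^j` is comparable to `|y|`, the bound `p ≤ 2^j Γ` is itself proportional to `|y|`, so
`|y| = y² / |y| ≤ 2Γ y² / p`: an error is at most `2Γ` times its relative growth. -/
theorem abs_le_of_potential_le {y p Γ e : ℝ} {j : ℤ} (he : 0 ≤ e) (hp : 0 < p)
    (hy : |y| ≤ 2 * Γ) (hy0 : 0 < |y|) (h1 : |y| ≤ 2 ^ j) (h2 : (2 : ℝ) ^ j ≤ 2 * |y|)
    (hΓ : p ≤ 2 ^ j * Γ) : |y| ≤ 2 * Γ * min 1 (clip j y * y / p) + 2 * e := by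
  have hΓ0 : 0 < Γ := by linarith
  rw [clip_of_abs_le h1]
  have : |y| ≤ 2 * Γ * min 1 (y * y / p) := by
    rw [mul_min_of_nonneg _ _ (by positivity), mul_one]
    refine le_min hy ?_
    rw [← mul_div_assoc, le_div_iff₀ hp, ← abs_mul_abs_self y]
    have h3 : p ≤ 2 * |y| * Γ := hΓ.trans (by gcongr)
    nlinarith
  linarith

end PotentialGrowth

/-! ### Total Bellman error and number of lazy updates. -/

section GoodRunCount

variable {S : Type*} {A : Type*} [MeasurableSpace S] [MeasurableSpace A] [Nonempty A] [Finite A]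
  {M : SSP S A} {d : ℕ} {φ : S → A → EuclideanSpace ℝ (Fin d)} {e δ b : ℝ}
  {θ : EuclideanSpace ℝ (Fin d)} {G : (Option S → ℝ) → EuclideanSpace ℝ (Fin d)}
  {x : Trajectory S A} {w : ℕ → EuclideanSpace ℝ (Fin d)} {B : ℕ → ℝ} {τ : ℕ → ℕ}

/-- Total Bellman error of a good run. -/
theorem SSP.GoodRun.sum_abs_gap_le (h : M.GoodRun φ θ G e δ b x w B τ) (hM : M.LinearOp φ θ G)
    (hd : 2 ≤ d) (he : 0 < e) (he1 : √d * e ≤ 1) (hδ : 0 < δ) (hδ1 : δ < 1)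
    (hc : ∀ i, e ≤ x.cost i) (n : ℕ) :
    ∑ i ∈ Finset.range n, |(inner ℝ (x.feat φ i) (bellmanGap φ θ G (w i) (B i)) : ℝ)| ≤
      2 * gapBound d b (∑ i ∈ Finset.range n, x.cost i) (iota d e δ (2 * b) (n + 1)) *
        potentialBound d n e + 2 * e * n := by
  have hd1 : (1 : ℝ) ≤ √d := Real.one_le_sqrt.2 (by exact_mod_cast (by omega : 1 ≤ d))
  have hd2 : (2 : ℝ) ≤ d := by exact_mod_cast hd
  have hC0 : ∀ i, 0 ≤ x.cost i := fun i => he.le.trans (hc i)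
  have hb : 0 ≤ b := by linarith [h.one_le 0, h.le_two_mul 0]
  have hI : ∀ i : ℕ, 12 ≤ iota d e δ (2 * b) (i + 1) := fun i =>
    twelve_le_iota hd he he1 hδ hδ1 ((h.one_le 0).trans (h.le_two_mul 0))
  set Γ : ℕ → ℝ := fun i => gapBound d b (∑ k ∈ Finset.range i, x.cost k)
    (iota d e δ (2 * b) (i + 1)) with hΓ
  have hΓmono : ∀ i ≤ n, Γ i ≤ Γ n := fun i hi => by
    refine gapBound_mono hb (Finset.sum_nonneg fun i _ => hC0 i)
      (Finset.sum_le_sum_of_subset_of_nonneg (Finset.range_mono hi) fun i _ _ => hC0 i)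
      (by linarith [hI i])
      (iota_mono hd he hδ (by linarith [h.one_le 0, h.le_two_mul 0]) le_rfl (by positivity) ?_)
    have : (i : ℝ) ≤ n := by exact_mod_cast hi
    linarith
  have hΓlow : ∀ i, 12 * √d * b ≤ 2 * Γ i := fun i => by
    have h1 : √d * b * 12 ≤ √d * b * iota d e δ (2 * b) (i + 1) := by
      gcongr
      exact hI i
    have h2 : (1 : ℝ) ≤ 8 * d ^ 2 := by nlinarith
    have h3 : 12 * √d * b ≤ 30 * √(2 * b * (∑ k ∈ Finset.range i, x.cost k) *
        iota d e δ (2 * b) (i + 1)) + 470 * √d * b * iota d e δ (2 * b) (i + 1) +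
        288 * d * b ^ 2 := by
      have h4 : 0 ≤ 288 * d * b ^ 2 := by positivity
      have h5 : 0 ≤ √d * b * 12 := by positivity
      have h6 := Real.sqrt_nonneg (2 * b * (∑ k ∈ Finset.range i, x.cost k) *
        iota d e δ (2 * b) (i + 1))
      linarith
    have h7 : 0 ≤ 12 * √d * b := by positivity
    have h8 := h3.trans (le_mul_of_one_le_left (h7.trans h3) h2)
    change _ ≤ Γ i at h8
    linarith
  have hpt : ∀ i, ∃ j : ℤ, e ≤ (2 : ℝ) ^ j ∧
      |(inner ℝ (x.feat φ i) (bellmanGap φ θ G (w i) (B i)) : ℝ)| ≤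
        2 * Γ i * growth (x.feat φ) j i (bellmanGap φ θ G (w i) (B i)) + 2 * e := by
    intro i
    set ν := bellmanGap φ θ G (w i) (B i) with hν
    have hB := h.one_le i
    have hνn : ‖ν‖ ≤ 6 * √d * B i :=
      norm_bellmanGap_le (h.mem_confSet i).1 (h.bellman_mem_confSet i).1
    have hy := (hM.abs_inner_feat_le (x := x) i ν)
    have hΓ0 : 0 ≤ Γ i := by
      have : 0 ≤ 12 * √d * b := by positivity
      linarith [hΓlow i]
    -- Errors below `e` go into the additive term `2e`; a larger one selects the level matching its
    -- own size.
    rcases lt_or_ge (|(inner ℝ (x.feat φ i) ν : ℝ)|) e with hlt | hge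
    · obtain ⟨-, h1, -⟩ := mem_levels_ceil_logb (d := d) (e := e) (B := B i) (x := e) he le_rfl
        (by nlinarith)
      refine ⟨_, h1, ?_⟩
      have := growth_nonneg (φ := x.feat φ) ⌈Real.logb 2 e⌉ i ν
      have : 0 ≤ 2 * Γ i * growth (x.feat φ) ⌈Real.logb 2 e⌉ i ν := by positivity
      linarith
    · obtain ⟨hj, h1, h2⟩ := mem_levels_ceil_logb he hge (hy.trans hνn)
      refine ⟨_, le_zpow_of_mem_levels he hj, ?_⟩
      have hν0 : ν ≠ 0 := by
        intro h0
        rw [h0, inner_zero_right, abs_zero] at hge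
        linarith
      refine abs_le_of_potential_le he.le (seqPotential_pos hν0) ?_ (he.trans_le hge) h1 h2
        (h.potential_le hM hd he he1 hδ hδ1 hc i hj)
      refine (hy.trans hνn).trans (le_trans ?_ (hΓlow i))
      have := h.le_two_mul i
      calc 6 * √d * B i ≤ 6 * √d * (2 * b) := by gcongr
        _ = _ := by ring
  choose j hj hbound using hpt
  have hsum := sum_min_one_div_potential_le (φ := x.feat φ) (by omega)
    (fun i => hM.norm_feature_le _ _) j (fun i => bellmanGap φ θ G (w i) (B i)) he hj n
  have hΓn : 0 ≤ Γ n := by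
    have : 0 ≤ 12 * √d * b := by positivity
    linarith [hΓlow n]
  calc _ ≤ ∑ i ∈ Finset.range n,
        (2 * Γ n * growth (x.feat φ) (j i) i (bellmanGap φ θ G (w i) (B i)) + 2 * e) := by
        refine Finset.sum_le_sum fun i hi => (hbound i).trans ?_
        have := growth_nonneg (φ := x.feat φ) (j i) i (bellmanGap φ θ G (w i) (B i))
        have := hΓmono i (Finset.mem_range.1 hi).le
        gcongr
    _ = 2 * Γ n * ∑ i ∈ Finset.range n,
        growth (x.feat φ) (j i) i (bellmanGap φ θ G (w i) (B i)) + 2 * e * n := by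
        rw [Finset.sum_add_distrib, ← Finset.mul_sum, Finset.sum_const, Finset.card_range,
          nsmul_eq_mul]
        ring
    _ ≤ _ := by
        gcongr
        exact hsum

/-- The lazy update condition is the only reason for a recomputation at index `n + 1`. -/
def Trajectory.LazyOnly (x : Trajectory S A) (φ : S → A → EuclideanSpace ℝ (Fin d)) (e : ℝ)
    (n τ : ℕ) (w : EuclideanSpace ℝ (Fin d)) (B : ℝ) : Prop :=
  x.Trigger φ e n τ w B ∧ x.next n ≠ none ∧ optValue φ w B (x.next n) ≠ 2 * B

omit [Nonempty A] [Finite A] in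
open Classical in
/-- Number of lazy updates. -/
theorem SSP.GoodRun.card_lazy_le (h : M.GoodRun φ θ G e δ b x w B τ) (hM : M.LinearOp φ θ G)
    (hd : 2 ≤ d) (he : 0 < e) (n : ℕ) :
    ∑ i ∈ Finset.range n, (if x.LazyOnly φ e i (τ i) (w i) (B i) then (1 : ℝ) else 0) ≤
      potentialBound d n e := by
  have hd2 : (2 : ℝ) ≤ d := by exact_mod_cast hd
  have key : ∃ (j : ℕ → ℤ) (ν : ℕ → EuclideanSpace ℝ (Fin d)), (∀ t, e ≤ (2 : ℝ) ^ j t) ∧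
      ∑ i ∈ Finset.range n, (if x.LazyOnly φ e i (τ i) (w i) (B i) then (1 : ℝ) else 0) ≤
        ∑ t ∈ Finset.range (τ n), growth (x.feat φ) (j t) t (ν t) := by
    induction n with
    | zero =>
      obtain ⟨k, hk⟩ := pow_unbounded_of_one_lt e (one_lt_two (α := ℝ))
      exact ⟨fun _ => k, fun _ => 0, fun _ => by rw [zpow_natCast]; exact hk.le, by
        rw [h.tau_zero]; simp⟩
    | succ n ih =>
      obtain ⟨j, ν, hj, hle⟩ := ih
      rw [Finset.sum_range_succ]
      by_cases hL : x.LazyOnly φ e n (τ n) (w n) (B n)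
      · rw [if_pos hL]
        have hτ : τ (n + 1) = n + 1 := by
          rcases h.step n with ⟨-, h1, -⟩ | ⟨h1, -⟩
          · exact h1
          · exact absurd hL.1 h1
        obtain ⟨hT, hn1, hn2⟩ := hL
        obtain ⟨j', hj', ν', -, hlt⟩ := (hT.resolve_left hn1).resolve_left hn2
        have hτn := h.tau_le n
        -- The sums run only up to the last recomputation, so the witnesses on `[τ n, n + 1)` are
        -- still free. The triggering pair is placed there and contributes at least one, because `8
        -- d² ≥ 32`.
        refine ⟨fun t => if t < τ n then j t else j', fun t => if t < τ n then ν t else ν',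
          fun t => ?_, ?_⟩
        · dsimp only
          split_ifs
          · exact hj t
          · exact le_zpow_of_mem_levels he hj'
        · rw [hτ, ← Finset.sum_range_add_sum_Ico _ (by omega : τ n ≤ n + 1)]
          refine add_le_add (hle.trans (le_of_eq ?_)) ?_
          · refine Finset.sum_congr rfl fun t ht => ?_
            beta_reduce
            rw [if_pos (Finset.mem_range.1 ht), if_pos (Finset.mem_range.1 ht)]
          · have h1 := one_le_sum_growth (φ := x.feat φ) (j := j') (ν := ν')
              (by omega : τ n ≤ n + 1) (lt_of_le_of_lt ?_ hlt)
            · refine h1.trans (le_of_eq (Finset.sum_congr rfl fun t ht => ?_))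
              have := (Finset.mem_Ico.1 ht).1
              beta_reduce
              rw [if_neg (by omega), if_neg (by omega)]
            · have : 0 ≤ x.potential φ j' (τ n) ν' := seqPotential_nonneg (φ := x.feat φ) _ _ _
              change 32 * x.potential φ j' (τ n) ν' ≤ _
              gcongr
              nlinarith
      · rw [if_neg hL, add_zero]
        refine ⟨j, ν, hj, hle.trans ?_⟩
        refine Finset.sum_le_sum_of_subset_of_nonneg (Finset.range_mono ?_)
          fun t _ _ => growth_nonneg _ _ _
        rcases h.step n with ⟨-, h1, -⟩ | ⟨-, h1, -⟩
        · rw [h1]; exact (h.tau_le n).trans (Nat.le_succ n)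
        · exact h1.ge
  obtain ⟨j, ν, hj, hle⟩ := key
  refine hle.trans ((sum_min_one_div_potential_le (φ := x.feat φ) (by omega)
    (fun i => hM.norm_feature_le _ _) j ν he hj (τ n)).trans ?_)
  exact potentialBound_mono (by omega) he (h.tau_le n)

end GoodRunCount

end LinearSSP

namespace LinearSSP

/-! ### Regret of a good run -/

theorem sqrt_mul_le_of_sq_bound {Q Y X N b l : ℝ} (hY : 0 ≤ Y) (hX : 0 ≤ X)
    (hN : 0 ≤ N) (hb : 0 ≤ b) (hl : 0 ≤ l)
    (h : Q ≤ 16 * b * Y + 16 * b * X + 32 * b ^ 2 * (1 + N) + 832 * b ^ 2 * l) :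
    √(Q * l) ≤ 4 * √(b * Y * l) + X + 3 * b * (1 + N) + 36 * b * l := by
  apply Real.sqrt_le_iff.2 ⟨by positivity, ?_⟩
  have h1 := Real.sq_sqrt (by positivity : 0 ≤ b * Y * l)
  have h2 : Q * l ≤ (16 * b * Y + 16 * b * X + 32 * b ^ 2 * (1 + N) + 832 * b ^ 2 * l) * l := by
    gcongr
  have h0 := Real.sqrt_nonneg (b * Y * l)
  generalize √(b * Y * l) = s at *
  have a1 : 0 ≤ s * (X + 3 * b * (1 + N) + 36 * b * l) := by positivity
  have a2 : 0 ≤ X * (b * l) := by positivity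
  have a3 : 0 ≤ X * (b * (1 + N)) := by positivity
  have a4 : 0 ≤ b ^ 2 * (1 + N) * l := by positivity
  have a5 : 0 ≤ (b * l) ^ 2 := by positivity
  have a6 : 0 ≤ (b * (1 + N)) ^ 2 := by positivity
  have a7 : 0 ≤ X ^ 2 := by positivity
  nlinarith

/-- The root is expanded around `Z` by writing `Y = Z + (Y - Z)`. This keeps the coefficient of `Z`
equal to one, which a regret bound requires. -/
theorem le_of_le_add_sqrt {Y Z P N b l : ℝ} (hZN : Z ≤ N * b)
    (hP : 0 ≤ P) (hb : 0 ≤ b) (hl : 0 ≤ l) (hN : 0 ≤ N)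
    (h : Y ≤ Z + P + 12 * √(b * Y * l)) :
    Y ≤ Z + 2 * P + 24 * b * √(N * l) + 144 * b * l := by
  rcases le_total Y Z with hYZ | hYZ
  · have : 0 ≤ 24 * b * √(N * l) := by positivity
    have : 0 ≤ 144 * b * l := by positivity
    linarith
  · have h1 : √(b * Y * l) ≤ b * √(N * l) + √(b * (Y - Z) * l) := by
      have h2 : b * Y * l ≤ b ^ 2 * (N * l) + b * (Y - Z) * l := by
        have : b * Z * l ≤ b * (N * b) * l := by gcongr
        nlinarith
      refine (Real.sqrt_le_sqrt h2).trans ((sqrt_add_le (by positivity) ?_).trans ?_)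
      · exact mul_nonneg (mul_nonneg hb (by linarith)) hl
      · rw [Real.sqrt_mul (by positivity), Real.sqrt_sq hb]
    have h3 : √(b * (Y - Z) * l) ≤ (Y - Z) / 24 + 6 * (b * l) := by
      apply Real.sqrt_le_iff.2 ⟨?_, ?_⟩
      · have : 0 ≤ b * l := by positivity
        linarith
      · nlinarith [sq_nonneg ((Y - Z) / 24 - 6 * (b * l))]
    linarith

/-- The overestimate gains `So` appear negatively in the cost inequality and positively in the
variance. Taking `C + So` as the unknown lets the same absorption handle both. -/
theorem regret_arith {C X E Pe Q So Nl Ng v b l : ℝ} (hC : 0 ≤ C) (hX : 0 ≤ X) (hQ : 0 ≤ Q)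
    (hSo : 0 ≤ So) (hNl : 0 ≤ Nl) (hNg : 0 ≤ Ng) (hv : 0 ≤ v) (hvb : v ≤ b) (hl : 1 ≤ l)
    (h1 : C ≤ X + E + (Ng + 1) * v + 2 * b * Nl - So + 2 * b)
    (h2 : Q ≤ 16 * b ^ 2 * (1 + Nl) + 8 * b * So + 8 * b * (C + X) + 2 * Pe)
    (h3 : E ≤ 3 * √(Q * l) + 16 * b * l)
    (h4 : Pe ≤ 12 * b * √(Q * l) + 64 * b ^ 2 * l) :
    C - Ng * v ≤ 24 * b * (1 + Nl) + 8 * X + 392 * b * l + 24 * b * √(Ng * l) := by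
  have hb : 0 ≤ b := hv.trans hvb
  have e1 : 24 * b * √(Q * l) ≤ Q / 2 + 288 * b ^ 2 * l := by
    rw [Real.sqrt_mul hQ]
    have a1 := Real.sq_sqrt hQ
    have a2 := Real.sq_sqrt (by linarith : 0 ≤ l)
    have a3 := sq_nonneg (√Q - 24 * (b * √l))
    have a4 : (b * √l) ^ 2 = b ^ 2 * l := by rw [mul_pow, a2]
    nlinarith
  have e2 := sqrt_mul_le_of_sq_bound (Q := Q) (Y := C + So) (X := X) (N := Nl) (b := b) (l := l)
    (by linarith) hX hNl hb (by linarith) (by nlinarith)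
  have e3 : v ≤ b * (1 + Nl) := by nlinarith
  have e4 := le_of_le_add_sqrt (Y := C + So) (Z := Ng * v)
    (P := 12 * b * (1 + Nl) + 4 * X + 124 * b * l) (N := Ng) (b := b) (l := l)
    (by gcongr) (by positivity) hb (by linarith) hNg (by linarith)
  linarith

section GoodRunRegret

variable {S : Type*} {A : Type*} [MeasurableSpace S] [MeasurableSpace A] [Nonempty A] [Finite A]
  {M : SSP S A} {d : ℕ} {φ : S → A → EuclideanSpace ℝ (Fin d)} {e δ b : ℝ}
  {θ : EuclideanSpace ℝ (Fin d)} {G : (Option S → ℝ) → EuclideanSpace ℝ (Fin d)}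
  {x : Trajectory S A} {w : ℕ → EuclideanSpace ℝ (Fin d)} {B : ℕ → ℝ} {τ : ℕ → ℕ}

/-- Because the value at the current state is below `2B`, the upper clipping is inactive, and the
chosen action satisfies `φᵀw ≤ V(s)`; the rest is the Bellman identity. -/
theorem SSP.GoodRun.cost_add_le (h : M.GoodRun φ θ G e δ b x w B τ) (hM : M.LinearOp φ θ G)
    (i : ℕ) :
    x.cost i + optValue φ (w i) (B i) (x.next i) - optValue φ (w i) (B i) (some (x.state i)) ≤
      |(inner ℝ (x.feat φ i) (bellmanGap φ θ G (w i) (B i)) : ℝ)| -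
        M.deviation x (optValue φ (w i) (B i)) i := by
  have hB : 0 ≤ B i := by linarith [h.one_le i]
  have h1 := hM.inner_feat_add_gap (w := w i) h.cost_eq hB i
  have h2 := optValue_eq_of_argmin (φ := φ) (B := B i) (h.argmin i)
  have h3 := h.optValue_state_lt i
  have h4 := le_abs_self (inner ℝ (x.feat φ i) (bellmanGap φ θ G (w i) (B i)) : ℝ)
  have h5 : inner ℝ (x.feat φ i) (w i) ≤ optValue φ (w i) (B i) (some (x.state i)) := by
    rw [h2] at h3 ⊢
    rcases min_lt_iff.1 h3 with h | h
    · rw [min_eq_left h.le]; exact le_max_left _ _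
    · exact absurd h (lt_irrefl _)
  unfold SSP.deviation
  linarith

open Classical in
-- Accounts for the change of value function after a step, by cause. Optimism bounds the value after
-- a goal by `V⋆(s_init)`; the other recomputations only use that the new value is at most the new
-- `B`.
theorem SSP.GoodRun.ledger (h : M.GoodRun φ θ G e δ b x w B τ) (i : ℕ) :
    optValue φ (w (i + 1)) (B (i + 1)) (some (x.state (i + 1))) -
        optValue φ (w i) (B i) (x.next i) ≤
      (if x.next i = none then 1 else 0) * (M.Vstar M.init).toReal +
      2 * b * (if x.LazyOnly φ e i (τ i) (w i) (B i) then 1 else 0) -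
      (if x.next i ≠ none ∧ optValue φ (w i) (B i) (x.next i) = 2 * B i then B i else 0) +
      (B (i + 1) - B i) ∧
    optValue φ (w i) (B i) (x.next i) ^ 2 -
        optValue φ (w (i + 1)) (B (i + 1)) (some (x.state (i + 1))) ^ 2 ≤
      16 * b ^ 2 * (if x.LazyOnly φ e i (τ i) (w i) (B i) then 1 else 0) +
      8 * b * (if x.next i ≠ none ∧ optValue φ (w i) (B i) (x.next i) = 2 * B i
        then B i else 0) := by
  have hB := h.one_le i
  have hBb := h.le_two_mul i
  have hBb' := h.le_two_mul (i + 1)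
  have hV := optValue_nonneg (φ := φ) (w := w i) (by linarith : 0 ≤ B i) (x.next i)
  have hV2 := optValue_le (φ := φ) (w := w i) (by linarith : 0 ≤ B i) (x.next i)
  have hs := h.state_succ i
  have hsq := sq_nonneg (optValue φ (w (i + 1)) (B (i + 1)) (some (x.state (i + 1))))
  rcases h.step i with ⟨hT, -, hBB, hv, hvB⟩ | ⟨hT, -, hw, hBB⟩
  · by_cases hn : x.next i = none
    · have hL : ¬ x.LazyOnly φ e i (τ i) (w i) (B i) := fun hL => hL.2.1 hn
      have hO : ¬ (x.next i ≠ none ∧ optValue φ (w i) (B i) (x.next i) = 2 * B i) :=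
        fun hO => hO.1 hn
      rw [if_pos hn, if_neg hL, if_neg hO]
      rw [hn] at hs ⊢
      rw [hs] at hv hsq ⊢
      simp only [Option.getD_none] at hv hsq ⊢
      have h0 : optValue φ (w i) (B i) none = 0 := rfl
      rw [h0]
      constructor <;> linarith
    · by_cases hO : optValue φ (w i) (B i) (x.next i) = 2 * B i
      · have hL : ¬ x.LazyOnly φ e i (τ i) (w i) (B i) := fun hL => hL.2.2 hO
        -- An overestimate replaces `2 B_i` by at most `B_{i+1}`: a gain of `B_i` up to the
        -- telescoping increase of `B`. The number of overestimates therefore never has to be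
        -- bounded.
        rw [if_neg hn, if_neg hL, if_pos ⟨hn, hO⟩, hO]
        constructor <;> nlinarith
      · rw [if_neg hn, if_pos ⟨hT, hn, hO⟩, if_neg (fun h => hO h.2)]
        constructor
        · linarith
        · have : optValue φ (w i) (B i) (x.next i) ^ 2 ≤ (4 * b) ^ 2 :=
            pow_le_pow_left₀ hV (by linarith) 2
          nlinarith
  · have hL : ¬ x.LazyOnly φ e i (τ i) (w i) (B i) := fun hL => hT hL.1
    have hn : x.next i ≠ none := fun hn => hT (Or.inl hn)
    have hO : optValue φ (w i) (B i) (x.next i) ≠ 2 * B i := fun hO => hT (Or.inr (Or.inl hO))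
    rw [if_neg hn, if_neg hL, if_neg (fun h => hO h.2), hw, hBB]
    obtain ⟨s, hs'⟩ := Option.ne_none_iff_exists'.1 hn
    rw [hs'] at hs
    rw [hs, hs']
    simp only [Option.getD_some]
    constructor <;> linarith

theorem Trajectory.cast_episodes {S A : Type*} (x : Trajectory S A) (n : ℕ)
    [DecidableEq (Option S)] :
    (x.episodes n : ℝ) = ∑ i ∈ Finset.range n, (if x.next i = none then (1 : ℝ) else 0) := by
  have h1 : {i : ℕ | i < n ∧ x.next i = none} =
      ((Finset.range n).filter fun i => x.next i = none : Finset ℕ) := by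
    ext i; simp
  rw [Trajectory.episodes, h1, Set.ncard_coe_finset, Finset.sum_ite]
  simp

open Classical in
/-- The total cost of a good run in terms of the Bellman errors and the number of lazy updates. -/
theorem SSP.GoodRun.cost_le (h : M.GoodRun φ θ G e δ b x w B τ) (hM : M.LinearOp φ θ G)
    (hδ : 0 < δ) (hδ1 : δ < 1) (hvb : (M.Vstar M.init).toReal ≤ b) (hc : ∀ i, 0 ≤ x.cost i) (n : ℕ)
    (hown : M.OwnGood φ δ b x w B n) :
    ∑ i ∈ Finset.range n, x.cost i - x.episodes n * (M.Vstar M.init).toReal ≤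
      24 * b * (1 + ∑ i ∈ Finset.range n,
        (if x.LazyOnly φ e i (τ i) (w i) (B i) then (1 : ℝ) else 0)) +
      8 * ∑ i ∈ Finset.range n, |(inner ℝ (x.feat φ i) (bellmanGap φ θ G (w i) (B i)) : ℝ)| +
      392 * b * ownLevel δ n + 24 * b * √(x.episodes n * ownLevel δ n) := by
  have hl := one_le_ownLevel hδ hδ1 n
  have hv0 : 0 ≤ (M.Vstar M.init).toReal := ENNReal.toReal_nonneg
  have hb : 0 ≤ b := hv0.trans hvb
  have hB0 : ∀ i, 0 ≤ B i := fun i => by linarith [h.one_le i]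
  have hled := fun i => h.ledger i
  set V : ℕ → ℝ := fun i => optValue φ (w i) (B i) (some (x.state i)) with hV
  set V' : ℕ → ℝ := fun i => optValue φ (w i) (B i) (x.next i) with hV'
  set dev : ℕ → ℝ := fun i => M.deviation x (optValue φ (w i) (B i)) i with hdev
  set mean : ℕ → ℝ := fun i => M.stepMean x (optValue φ (w i) (B i)) i with hmean
  set g : ℕ → ℝ := fun i => |(inner ℝ (x.feat φ i) (bellmanGap φ θ G (w i) (B i)) : ℝ)| with hg
  set L : ℕ → ℝ := fun i => if x.LazyOnly φ e i (τ i) (w i) (B i) then (1 : ℝ) else 0 with hL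
  set O : ℕ → ℝ := fun i => if x.next i ≠ none ∧ V' i = 2 * B i then B i else 0 with hO
  set N : ℕ → ℝ := fun i => if x.next i = none then (1 : ℝ) else 0 with hN
  have hNsum : (x.episodes n : ℝ) = ∑ i ∈ Finset.range n, N i := x.cast_episodes n
  have hVn : ∀ i, 0 ≤ V i ∧ V i ≤ 2 * B i := fun i =>
    ⟨optValue_nonneg (hB0 i) _, optValue_le (hB0 i) _⟩
  have hled1 : ∀ i, V (i + 1) - V' i ≤ N i * (M.Vstar M.init).toReal + 2 * b * L i - O i +
      (B (i + 1) - B i) := fun i => (hled i).1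
  have hled2 : ∀ i, V' i ^ 2 - V (i + 1) ^ 2 ≤ 16 * b ^ 2 * L i + 8 * b * O i := fun i =>
    (hled i).2
  have hcost : ∀ i, x.cost i + V' i - V i ≤ g i - dev i := fun i => h.cost_add_le hM i
  have hsq : ∀ i, dev i ^ 2 = V' i ^ 2 - mean i ^ 2 + 2 * (mean i * dev i) := fun i =>
    M.deviation_sq x _ i
  have hgap : ∀ i, V i ^ 2 - mean i ^ 2 ≤ 8 * b * (x.cost i + g i) := fun i => by
    refine (hM.optValue_sq_sub_le h.cost_eq hc (hB0 i) i).trans ?_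
    have h1 := h.le_two_mul i
    have h2 : 0 ≤ x.cost i + g i := add_nonneg (hc i) (abs_nonneg _)
    refine mul_le_mul_of_nonneg_right ?_ h2
    linarith
  have hmb : ∀ i, mean i ^ 2 ≤ (4 * b) ^ 2 := fun i => by
    have h1 := hM.stepMean_nonneg_le x (w i) (hB0 i) i
    exact pow_le_pow_left₀ h1.1 (h1.2.trans (by linarith [h.le_two_mul i])) 2
  have hO0 : ∀ i, 0 ≤ O i := fun i => by
    simp only [hO]; split_ifs
    · exact hB0 i
    · exact le_rfl
  have hL0 : ∀ i, 0 ≤ L i := fun i => by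
    simp only [hL]; split_ifs <;> norm_num
  clear_value V V' dev mean g L O N
  rw [hNsum]
  refine regret_arith (E := |∑ i ∈ Finset.range n, dev i|)
    (Pe := |∑ i ∈ Finset.range n, mean i * dev i|)
    (Q := ∑ i ∈ Finset.range n, dev i ^ 2) (So := ∑ i ∈ Finset.range n, O i)
    (Finset.sum_nonneg fun i _ => hc i) (Finset.sum_nonneg fun i _ => by rw [hg]; positivity)
    (Finset.sum_nonneg fun i _ => sq_nonneg _) (Finset.sum_nonneg fun i _ => hO0 i)
    (Finset.sum_nonneg fun i _ => hL0 i) (by rw [← hNsum]; positivity) hv0 hvb hl ?_ ?_ ?_ ?_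
  · have h1 : ∀ i, x.cost i ≤ g i - dev i + (V i - V (i + 1)) +
        (N i * (M.Vstar M.init).toReal + 2 * b * L i - O i + (B (i + 1) - B i)) := fun i => by
      linarith [hcost i, hled1 i]
    have h2 := Finset.sum_le_sum fun i (_ : i ∈ Finset.range n) => h1 i
    simp only [Finset.sum_add_distrib, Finset.sum_sub_distrib, ← Finset.mul_sum,
      ← Finset.sum_mul] at h2
    have h3 := Finset.sum_range_sub' V n
    have h4 := Finset.sum_range_sub B n
    simp only [Finset.sum_sub_distrib] at h3 h4
    have h5 := neg_abs_le (∑ i ∈ Finset.range n, dev i)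
    have h6 : V 0 ≤ (M.Vstar M.init).toReal := by
      have := h.optValue_init_le
      rw [hV]; dsimp only; rw [h.state_zero]; exact this
    have h7 := (hVn n).1
    have h8 := h.le_two_mul n
    have h9 := h.one_le 0
    linarith
  · have h1 : ∀ i, dev i ^ 2 ≤ (V (i + 1) ^ 2 - V i ^ 2) + (16 * b ^ 2 * L i + 8 * b * O i) +
        8 * b * (x.cost i + g i) + 2 * (mean i * dev i) := fun i => by
      linarith [hsq i, hled2 i, hgap i]
    have h2 := Finset.sum_le_sum fun i (_ : i ∈ Finset.range n) => h1 i
    simp only [Finset.sum_add_distrib, Finset.sum_sub_distrib, ← Finset.mul_sum] at h2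
    have h3 := Finset.sum_range_sub (fun i => V i ^ 2) n
    simp only [Finset.sum_sub_distrib] at h3
    have h4 := le_abs_self (∑ i ∈ Finset.range n, mean i * dev i)
    have h5 : V n ^ 2 ≤ (4 * b) ^ 2 :=
      pow_le_pow_left₀ (hVn n).1 ((hVn n).2.trans (by linarith [h.le_two_mul n])) 2
    have h6 := sq_nonneg (V 0)
    linarith
  · have := hown.1
    simp only [hdev]
    exact this
  · have h1 := hown.2
    simp only [hdev, hmean]
    refine h1.trans (add_le_add_left ?_ _)
    have h2 : √((∑ i ∈ Finset.range n, (M.stepMean x (optValue φ (w i) (B i)) i *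
        M.deviation x (optValue φ (w i) (B i)) i) ^ 2) * ownLevel δ n) ≤
        √((4 * b) ^ 2 * ((∑ i ∈ Finset.range n, M.deviation x (optValue φ (w i) (B i)) i ^ 2) *
          ownLevel δ n)) := by
      refine Real.sqrt_le_sqrt ?_
      rw [← mul_assoc, Finset.mul_sum]
      refine mul_le_mul_of_nonneg_right (Finset.sum_le_sum fun i _ => ?_) (by linarith)
      rw [mul_pow]
      have := hmb i
      rw [hmean] at this
      exact mul_le_mul_of_nonneg_right this (sq_nonneg _)
    rw [Real.sqrt_mul (sq_nonneg (4 * b)), Real.sqrt_sq (by positivity)] at h2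
    linarith

end GoodRunRegret

end LinearSSP

namespace LinearSSP

/-! ### Solving for the regret -/

/-- Inserting `C ≤ K b + R` splits the square root into the leading `√K` term and a term with `√R`,
which is absorbed into `R / 4`. -/
theorem gapBound_mul_le {d : ℕ} {b C I W K R : ℝ} (hb : 1 ≤ b) (hI : 12 ≤ I)
    (hW : 1 ≤ W) (hK : 0 ≤ K) (hR : 0 ≤ R) (hC : C ≤ K * b + R) :
    16 * (gapBound d b C I * W) ≤ 5760 * (d ^ 2 * W * b * √(K * I)) + R / 4 +
      5760 ^ 2 * (d ^ 4 * W ^ 2 * b * I) + 60160 * (d ^ 2 * √d * W * b * I) +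
      36864 * (d ^ 3 * W * b ^ 2) := by
  have h1 : √(2 * b * C * I) ≤ 3 / 2 * (b * √(K * I)) + 3 / 2 * (√(b * I) * √R) := by
    have e1 : 2 * b * C * I ≤ 2 * (b ^ 2 * (K * I)) + 2 * (b * I * R) := by
      have : 2 * b * C * I ≤ 2 * b * (K * b + R) * I := by gcongr
      linarith
    refine (Real.sqrt_le_sqrt e1).trans ((sqrt_add_le (by positivity) (by positivity)).trans ?_)
    have h2 : √2 ≤ 3 / 2 := by
      rw [Real.sqrt_le_left (by norm_num)]; norm_num
    rw [Real.sqrt_mul zero_le_two (b ^ 2 * (K * I)), Real.sqrt_mul zero_le_two (b * I * R),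
      Real.sqrt_mul (sq_nonneg b) (K * I), Real.sqrt_sq (by linarith),
      Real.sqrt_mul (by positivity : 0 ≤ b * I)]
    gcongr
  have h2 : 5760 * (d ^ 2 * W * (√(b * I) * √R)) ≤ R / 4 + 5760 ^ 2 * (d ^ 4 * W ^ 2 * b * I) := by
    have a1 := Real.sq_sqrt hR
    have a2 := Real.sq_sqrt (by positivity : 0 ≤ b * I)
    have a3 := sq_nonneg (√R / 2 - 5760 * (d ^ 2 * W * √(b * I)))
    have a4 : (d ^ 2 * W * √(b * I)) ^ 2 = d ^ 4 * W ^ 2 * b * I := by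
      rw [mul_pow, a2]; ring
    nlinarith
  have h3 : 3840 * (d ^ 2 * W * √(2 * b * C * I)) ≤
      3840 * (d ^ 2 * W * (3 / 2 * (b * √(K * I)) + 3 / 2 * (√(b * I) * √R))) := by
    gcongr
  unfold gapBound
  linarith

/-- All remaining multiples of `R` on the right are small: `R / 4` from the Bellman errors and `R /
75` from the discretisation. -/
theorem regret_solve {d : ℕ} {b C I W K R l en : ℝ} (hd : 2 ≤ d) (hb : 1 ≤ b) (hI : 12 ≤ I)
    (hW : 1 ≤ W) (hK : 2 ≤ K) (hR : 0 ≤ R) (hC : C ≤ K * b + R) (hl : 1 ≤ l) (hlI : l ≤ I)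
    (hen : en * (150 * d ^ 3 * K) ≤ C)
    (h : R ≤ 24 * b * (1 + W) + 8 * (2 * gapBound d b C I * W + 2 * en) + 392 * b * l +
      24 * b * √(K * l)) :
    R ≤ 10 ^ 8 * (d ^ 2 * W * b * √(K * I) + d ^ 4 * W ^ 2 * b * I + d ^ 3 * W * b ^ 2) := by
  have hd2 : (2 : ℝ) ≤ d := by exact_mod_cast hd
  have h1 := gapBound_mul_le (d := d) hb hI hW (by linarith) hR hC
  have hsd : √(d : ℝ) ≤ d ^ 2 := by
    rw [Real.sqrt_le_left (by positivity)]
    calc (d : ℝ) = d * 1 := (mul_one _).symm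
      _ ≤ d * d ^ 3 := by gcongr; exact one_le_pow₀ (by linarith)
      _ = _ := by ring
  have hd21 : (1 : ℝ) ≤ d ^ 2 := one_le_pow₀ (by linarith)
  have hd41 : (1 : ℝ) ≤ d ^ 4 := one_le_pow₀ (by linarith)
  have hWW : W ≤ W ^ 2 := by nlinarith
  have e1 : d ^ 2 * √d * W * b * I ≤ d ^ 4 * W ^ 2 * b * I := by
    calc d ^ 2 * √d * W * b * I ≤ d ^ 2 * d ^ 2 * W ^ 2 * b * I := by gcongr
      _ = _ := by ring
  have e2 : b * W ≤ d ^ 4 * W ^ 2 * b * I := by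
    calc b * W = 1 * W * b * 1 := by ring
      _ ≤ _ := by gcongr; linarith
  have e3 : b * l ≤ d ^ 4 * W ^ 2 * b * I := by
    calc b * l = 1 * 1 * b * l := by ring
      _ ≤ _ := by gcongr; exact one_le_pow₀ hW
  have e4 : b * √(K * l) ≤ d ^ 2 * W * b * √(K * I) := by
    calc b * √(K * l) = 1 * 1 * b * √(K * l) := by ring
      _ ≤ _ := by gcongr
  have e5 : b ≤ b * W := by nlinarith
  -- The accuracy is `cmin / (150 d³ K)`, so the discretisation error over all steps is the total
  -- cost divided by `150 d³ K`, and the factor `K` in the cost bound cancels.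
  have e6 : 16 * en ≤ (b + R) / 75 := by
    rcases le_total en 0 with h0 | h0
    · have : 0 ≤ (b + R) / 75 := by positivity
      linarith
    · have hd3 : (2 : ℝ) ^ 3 ≤ d ^ 3 := by gcongr
      have a1 : en * (150 * 2 ^ 3 * K) ≤ K * b + R := by
        refine le_trans ?_ (hen.trans hC)
        gcongr
      have a2 : R ≤ K * R / 2 := by nlinarith
      have a3 : K * (1200 * en) ≤ K * (b + R / 2) := by linarith
      have a4 := le_of_mul_le_mul_left a3 (by linarith)
      linarith
  have hT3 : 0 ≤ d ^ 3 * W * b ^ 2 := by positivity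
  have hT1 : 0 ≤ d ^ 2 * W * b * √(K * I) := by positivity
  generalize d ^ 2 * W * b * √(K * I) = T1 at *
  generalize d ^ 4 * W ^ 2 * b * I = T2 at *
  generalize (d : ℝ) ^ 3 * W * b ^ 2 = T3 at *
  generalize d ^ 2 * √d * W * b * I = T4 at *
  have h7 : R ≤ 24 * (b + b * W) + 16 * (gapBound d b C I * W) + 16 * en + 392 * (b * l) +
      24 * (b * √(K * l)) := by
    linarith
  linarith

theorem log_two_mul_le {n : ℕ} (hn : 0 < n) : (Nat.log 2 n : ℝ) ≤ 3 / 2 * Real.log n := by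
  have h1 : (2 : ℝ) ^ Nat.log 2 n ≤ n := by exact_mod_cast Nat.pow_log_le_self 2 hn.ne'
  have h2 := Real.log_le_log (by positivity) h1
  rw [Real.log_pow] at h2
  have := Real.log_two_gt_d9
  have : (0 : ℝ) ≤ Nat.log 2 n := Nat.cast_nonneg _
  nlinarith

/-! ### Logarithmic factors expressed through one logarithm. -/

section Logs

variable {d n : ℕ} {e δ b : ℝ}

theorem one_le_potentialBound (hd : 2 ≤ d) (he : 0 < e) : 1 ≤ potentialBound d n e := by
  have hd2 : (2 : ℝ) ≤ d := by exact_mod_cast hd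
  have h1 : 0 ≤ Real.log (d + 2 * (n : ℝ) ^ 2 / e) := by
    apply Real.log_nonneg
    have : 0 ≤ 2 * (n : ℝ) ^ 2 / e := by positivity
    linarith
  unfold potentialBound
  have : 0 ≤ 2 * ((Nat.log 2 n : ℝ) + 1) * (5 / 2 * d * Real.log (d + 2 * (n : ℝ) ^ 2 / e)) := by
    positivity
  linarith

theorem potentialBound_le (hd : 2 ≤ d) (he : 0 < e) (he1 : e ≤ 1) (hδ : 0 < δ) (hδ1 : δ < 1)
    (hb : 1 ≤ b) : potentialBound d n e ≤ 26 * d * Real.log (logArg d e δ (2 * b) (n + 1)) ^ 2 := by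
  have hd2 : (2 : ℝ) ≤ d := by exact_mod_cast hd
  have hn : (0 : ℝ) ≤ n := Nat.cast_nonneg n
  have hL := one_le_log_logArg (n := n) hd he he1 hδ hδ1 (by linarith : 1 ≤ 2 * b)
  have hle := le_logArg (n := n) hd he hδ hδ1 (by linarith : 1 ≤ 2 * b)
  have hr := one_le_ratio (n := n) hd he he1 (by linarith : 1 ≤ 2 * b)
  have h1 : d * ((n : ℝ) + 1) / e ≤ logArg d e δ (2 * b) (n + 1) := by
    have : d * ((n : ℝ) + 1) / e ≤ d * (2 * b) * (n + 1) / e := by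
      gcongr
      nlinarith
    linarith
  set Z := logArg d e δ (2 * b) (n + 1) with hZ
  set L := Real.log Z with hLdef
  have hz : 1 ≤ d * ((n : ℝ) + 1) / e := by
    rw [le_div_iff₀ he]
    nlinarith
  have hZ1 : 1 ≤ Z := hz.trans h1
  have hn1 : (n : ℝ) + 1 ≤ Z := by
    refine le_trans ?_ h1
    rw [le_div_iff₀ he]
    nlinarith
  have h2 : Real.log (d + 2 * (n : ℝ) ^ 2 / e) ≤ 2 * L := by
    have : d + 2 * (n : ℝ) ^ 2 / e ≤ Z ^ 2 := by
      calc d + 2 * (n : ℝ) ^ 2 / e ≤ (d * (n + 1) / e) * (d * (n + 1) / e) := by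
            rw [div_mul_div_comm, ← sub_nonneg]
            have : (d * ((n : ℝ) + 1) * (d * (n + 1)) / (e * e)) - (d + 2 * (n : ℝ) ^ 2 / e) =
              (d * (n + 1) * (d * (n + 1)) - d * (e * e) - 2 * n ^ 2 * e) / (e * e) := by
              field_simp
              ring
            rw [this]
            apply div_nonneg _ (by positivity)
            have a1 : e * e ≤ 1 := by nlinarith
            have a2 : d * (e * e) ≤ d * 1 := by gcongr
            have a3 : 2 * (n : ℝ) ^ 2 * e ≤ 2 * n ^ 2 * 1 := by gcongr
            have a4 : d * 2 * (((n : ℝ) + 1) * (n + 1)) ≤ d * d * ((n + 1) * (n + 1)) := by gcongr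
            have a5 : 2 * (((n : ℝ) + 1) * (n + 1)) ≤ d * ((n + 1) * (n + 1)) := by gcongr
            have a6 : (d : ℝ) * 1 ≤ d * ((n + 1) * (n + 1)) := by gcongr; nlinarith
            nlinarith
        _ ≤ Z * Z := by gcongr
        _ = Z ^ 2 := by ring
    have h3 := Real.log_le_log (by positivity) this
    rwa [Real.log_pow] at h3
  have h3 : (Nat.log 2 n : ℝ) ≤ 3 / 2 * L := by
    rcases Nat.eq_zero_or_pos n with rfl | hpos
    · simp only [Nat.log_zero_right, Nat.cast_zero]
      linarith
    · refine (log_two_mul_le hpos).trans ?_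
      have : Real.log n ≤ L := Real.log_le_log (by exact_mod_cast hpos) (by linarith)
      linarith
  have h4 : 0 ≤ Real.log (d + 2 * (n : ℝ) ^ 2 / e) := by
    apply Real.log_nonneg
    have : 0 ≤ 2 * (n : ℝ) ^ 2 / e := by positivity
    linarith
  unfold potentialBound
  calc 2 * ((Nat.log 2 n : ℝ) + 1) * (5 / 2 * d * Real.log (d + 2 * (n : ℝ) ^ 2 / e)) + 1
      ≤ 2 * (3 / 2 * L + L) * (5 / 2 * d * (2 * L)) + 1 := by gcongr
    _ = 25 * d * L ^ 2 + 1 := by ring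
    _ ≤ 26 * d * L ^ 2 := by nlinarith

theorem ownLevel_le (hd : 2 ≤ d) (he : 0 < e) (he1 : e ≤ 1) (hδ : 0 < δ) (hδ1 : δ < 1)
    (hb : 1 ≤ b) : ownLevel δ n ≤ 3 * Real.log (logArg d e δ (2 * b) (n + 1)) := by
  have hn : (0 : ℝ) ≤ n := Nat.cast_nonneg n
  have hd2 : (2 : ℝ) ≤ d := by exact_mod_cast hd
  unfold ownLevel
  have h1 : 4 * ((n : ℝ) + 1) / δ ≤ logArg d e δ (2 * b) (n + 1) := by
    unfold logArg
    have a1 : 1 * δ ≥ e * δ := by gcongr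
    have a2 : 4 * ((n : ℝ) + 1) ≤ 48 * d * (2 * b) * (n + 1) := by
      gcongr
      nlinarith
    calc 4 * ((n : ℝ) + 1) / δ = 4 * ((n : ℝ) + 1) / (1 * δ) := by rw [one_mul]
      _ ≤ _ := by gcongr
  have h2 : 16 * ((n : ℝ) + 1) ^ 3 / δ ≤ logArg d e δ (2 * b) (n + 1) ^ 3 := by
    calc 16 * ((n : ℝ) + 1) ^ 3 / δ ≤ (4 * (n + 1) / δ) ^ 3 := by
          rw [div_pow, mul_pow]
          have : δ ^ 3 ≤ δ := by
            calc δ ^ 3 ≤ δ ^ 1 := pow_le_pow_of_le_one hδ.le hδ1.le (by norm_num)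
              _ = δ := pow_one δ
          gcongr
          norm_num
      _ ≤ _ := by gcongr
  have h3 := Real.log_le_log (by positivity) h2
  rwa [Real.log_pow] at h3

end Logs

/-- Replacing the logarithmic factors by powers of `L`. -/
theorem regret_log {d : ℕ} {b I W K L R : ℝ} (hd : 2 ≤ d) (hb : 1 ≤ b) (hK : 2 ≤ K) (hL : 1 ≤ L)
    (hI : I = 2 ^ 11 * d * L) (hW1 : 1 ≤ W) (hW : W ≤ 26 * d * L ^ 2)
    (h : R ≤ 10 ^ 8 * (d ^ 2 * W * b * √(K * I) + d ^ 4 * W ^ 2 * b * I + d ^ 3 * W * b ^ 2)) :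
    R ≤ 10 ^ 15 * L ^ 5 * (d ^ 3 * √d * b * √K + d ^ 7 * b ^ 2) := by
  have hd2 : (2 : ℝ) ≤ d := by exact_mod_cast hd
  have hL0 : 0 ≤ L := by linarith
  have h1 : √(K * I) ≤ 46 * (√K * √d * L) := by
    rw [hI]
    apply Real.sqrt_le_iff.2 ⟨by positivity, ?_⟩
    rw [mul_pow, mul_pow, mul_pow, Real.sq_sqrt (by linarith), Real.sq_sqrt (by linarith)]
    have : K * (d * L) ≤ K * (d * L ^ 2) := by gcongr; nlinarith
    nlinarith
  have e1 : d ^ 2 * W * b * √(K * I) ≤ 1196 * (L ^ 5 * (d ^ 3 * √d * b * √K)) := by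
    calc d ^ 2 * W * b * √(K * I) ≤ d ^ 2 * (26 * d * L ^ 2) * b * (46 * (√K * √d * L)) := by gcongr
      _ = 1196 * (L ^ 3 * (d ^ 3 * √d * b * √K)) := by ring
      _ ≤ _ := by have := pow_le_pow_right₀ hL (by norm_num : 3 ≤ 5); gcongr
  have e2 : d ^ 4 * W ^ 2 * b * I ≤ 1384448 * (L ^ 5 * (d ^ 7 * b ^ 2)) := by
    calc d ^ 4 * W ^ 2 * b * I ≤ d ^ 4 * (26 * d * L ^ 2) ^ 2 * b * I := by
          have : 0 ≤ I := by rw [hI]; positivity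
          gcongr
      _ = 1384448 * (L ^ 5 * (d ^ 7 * b)) := by rw [hI]; ring
      _ ≤ _ := by gcongr; nlinarith
  have e3 : d ^ 3 * W * b ^ 2 ≤ 26 * (L ^ 5 * (d ^ 7 * b ^ 2)) := by
    calc d ^ 3 * W * b ^ 2 ≤ d ^ 3 * (26 * d * L ^ 2) * b ^ 2 := by gcongr
      _ = 26 * (L ^ 2 * (d ^ 4 * b ^ 2)) := by ring
      _ ≤ _ := by
        have := pow_le_pow_right₀ hL (by norm_num : 2 ≤ 5)
        have := pow_le_pow_right₀ (by linarith : (1 : ℝ) ≤ d) (by norm_num : 4 ≤ 7)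
        gcongr
  have e4 : 0 ≤ L ^ 5 * (d ^ 3 * √d * b * √K) := by positivity
  have e5 : 0 ≤ L ^ 5 * (d ^ 7 * b ^ 2) := by positivity
  linarith

/-- Removing the number of steps from the logarithmic factor. -/
theorem log_le_of_regret {d : ℕ} {b K L N c δ : ℝ} (hd : 2 ≤ d) (hb : 1 ≤ b) (hK : 2 ≤ K)
    (hL : 1 ≤ L) (hc : 0 < c) (hc1 : c ≤ 1) (hδ : 0 < δ) (hδ1 : δ < 1) (hN : 0 ≤ N)
    (hLdef : L = Real.log (14400 * d ^ 4 * b * K * (N + 1) / (c * δ)))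
    (h : N * c ≤ K * b + 10 ^ 15 * L ^ 5 * (d ^ 3 * √d * b * √K + d ^ 7 * b ^ 2)) :
    L ≤ 120 * Real.log (d * b * K / (c * δ)) := by
  have hd2 : (2 : ℝ) ≤ d := by exact_mod_cast hd
  have hd1 : (1 : ℝ) ≤ d := by linarith
  set D := d * b * K / (c * δ) with hD
  have hcδ : c * δ ≤ 1 := by nlinarith
  have hcd0 : 0 < c * δ := by positivity
  have hD4 : 4 ≤ D := by
    rw [hD, le_div_iff₀ hcd0]
    have : 2 * 1 * 2 ≤ d * b * K := by gcongr
    linarith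
  have hsd : √(d : ℝ) ≤ d := by
    rw [Real.sqrt_le_left (by positivity)]; nlinarith
  have hsK : √K ≤ K := by
    rw [Real.sqrt_le_left (by positivity)]; nlinarith
  have h1 : (N + 1) * c ≤ 10 ^ 17 * L ^ 5 * (d ^ 7 * b ^ 2 * K) := by
    have hL5 : 1 ≤ L ^ 5 := one_le_pow₀ hL
    have hd7 : (1 : ℝ) ≤ d ^ 7 := one_le_pow₀ hd1
    have hbb : b ≤ b ^ 2 := by nlinarith
    have a0 : 1 ≤ L ^ 5 * (d ^ 7 * b ^ 2 * K) := by
      calc (1 : ℝ) = 1 * (1 * 1 ^ 2 * 1) := by ring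
        _ ≤ _ := by gcongr; linarith
    have a1 : K * b ≤ L ^ 5 * (d ^ 7 * b ^ 2 * K) := by
      calc K * b = 1 * (1 * b * K) := by ring
        _ ≤ _ := by gcongr
    have a2 : d ^ 3 * √d * b * √K ≤ d ^ 7 * b ^ 2 * K := by
      calc d ^ 3 * √d * b * √K ≤ d ^ 3 * d ^ 4 * b ^ 2 * K := by
            gcongr
            calc √(d : ℝ) ≤ d * 1 := by linarith
              _ ≤ d * d ^ 3 := by gcongr; exact one_le_pow₀ hd1
              _ = d ^ 4 := by ring
        _ = _ := by ring
    have a3 : d ^ 7 * b ^ 2 ≤ d ^ 7 * b ^ 2 * K :=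
      le_mul_of_one_le_right (by positivity) (by linarith)
    have a4 : 10 ^ 15 * L ^ 5 * (d ^ 3 * √d * b * √K + d ^ 7 * b ^ 2) ≤
        10 ^ 15 * L ^ 5 * (d ^ 7 * b ^ 2 * K + d ^ 7 * b ^ 2 * K) := by gcongr
    linarith
  have h2 : 14400 * d ^ 4 * b * K * (N + 1) / (c * δ) ≤ 10 ^ 22 * L ^ 5 * D ^ 11 := by
    have a1 : 14400 * d ^ 4 * b * K * (N + 1) / (c * δ) =
        14400 * d ^ 4 * b * K * ((N + 1) * c) / (c ^ 2 * δ) := by field_simp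
    have a2 : d ^ 11 * b ^ 3 * K ^ 2 / (c ^ 2 * δ) ≤ D ^ 11 := by
      rw [hD, div_pow, mul_pow, mul_pow]
      have b1 : (c * δ) ^ 11 ≤ c ^ 2 * δ := by
        rw [mul_pow]
        have := pow_le_pow_of_le_one hc.le hc1 (by norm_num : 2 ≤ 11)
        have h3 := pow_le_pow_of_le_one hδ.le hδ1.le (by norm_num : 1 ≤ 11)
        rw [pow_one] at h3
        gcongr
      gcongr
      · norm_num
      · linarith
      · norm_num
    rw [a1]
    calc 14400 * d ^ 4 * b * K * ((N + 1) * c) / (c ^ 2 * δ)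
        ≤ 14400 * d ^ 4 * b * K * (10 ^ 17 * L ^ 5 * (d ^ 7 * b ^ 2 * K)) / (c ^ 2 * δ) := by gcongr
      _ = 14400 * 10 ^ 17 * L ^ 5 * (d ^ 11 * b ^ 3 * K ^ 2 / (c ^ 2 * δ)) := by ring
      _ ≤ 10 ^ 22 * L ^ 5 * D ^ 11 := by gcongr; norm_num
  have hpos : 0 < 14400 * d ^ 4 * b * K * (N + 1) / (c * δ) := by positivity
  have h3 := Real.log_le_log hpos h2
  rw [← hLdef, Real.log_mul (by positivity) (by positivity), Real.log_mul (by positivity)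
    (by positivity), Real.log_pow, Real.log_pow, Real.log_pow] at h3
  have h4 : Real.log 10 ≤ 3 := by
    rw [Real.log_le_iff_le_exp (by norm_num)]
    have : (2.7 : ℝ) ≤ Real.exp 1 := by linarith [Real.exp_one_gt_d9]
    calc (10 : ℝ) ≤ 2.7 ^ 3 := by norm_num
      _ ≤ Real.exp 1 ^ 3 := by gcongr
      _ = Real.exp 3 := by rw [← Real.exp_nat_mul]; norm_num
  -- `L` enters its own bound through `log (L⁵)`; with the slope `1/20` only `L / 4` returns, which
  -- the left side absorbs.
  have h5 : Real.log L ≤ L / 20 + 2 := by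
    have a1 := Real.log_le_sub_one_of_pos (show 0 < L / 20 by linarith)
    rw [Real.log_div (by linarith) (by norm_num)] at a1
    have a2 : Real.log 20 ≤ 3 := by
      rw [Real.log_le_iff_le_exp (by norm_num)]
      have : (2.718 : ℝ) ≤ Real.exp 1 := by linarith [Real.exp_one_gt_d9]
      calc (20 : ℝ) ≤ 2.718 ^ 3 := by norm_num
        _ ≤ Real.exp 1 ^ 3 := by gcongr
        _ = Real.exp 3 := by rw [← Real.exp_nat_mul]; norm_num
    linarith
  have h6 : 1 ≤ Real.log D := by
    rw [Real.le_log_iff_exp_le (by linarith)]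
    linarith [Real.exp_one_lt_d9]
  push_cast at h3
  linarith

end LinearSSP

namespace LinearSSP

/-! ### Finite-time bound, termination and the final probability estimate. -/

section Final

variable {S : Type*} {A : Type*} [MeasurableSpace S] [MeasurableSpace A] [Nonempty A] [Finite A]
  {M : SSP S A} {d : ℕ} {φ : S → A → EuclideanSpace ℝ (Fin d)} {δ b : ℝ} {K : ℕ}
  {θ : EuclideanSpace ℝ (Fin d)} {G : (Option S → ℝ) → EuclideanSpace ℝ (Fin d)}
  {x : Trajectory S A} {w : ℕ → EuclideanSpace ℝ (Fin d)} {B : ℕ → ℝ} {τ : ℕ → ℕ}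

theorem accuracy_bounds {c : ℝ} (hd : 2 ≤ d) (hK : 2 ≤ K) (hc : 0 < c) (hc1 : c ≤ 1) :
    0 < c / (150 * (d : ℝ) ^ 3 * K) ∧ c / (150 * (d : ℝ) ^ 3 * K) ≤ c ∧
      √d * (c / (150 * (d : ℝ) ^ 3 * K)) ≤ 1 := by
  have hd2 : (2 : ℝ) ≤ d := by exact_mod_cast hd
  have hK2 : (2 : ℝ) ≤ K := by exact_mod_cast hK
  have h1 : (d : ℝ) * 1 * 1 ≤ 150 * d ^ 3 * K := by
    have : (d : ℝ) * 1 ≤ 150 * d ^ 3 := by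
      have : (1 : ℝ) ≤ d ^ 2 := one_le_pow₀ (by linarith)
      nlinarith
    gcongr
    linarith
  have h0 : 0 < 150 * (d : ℝ) ^ 3 * K := by positivity
  refine ⟨by positivity, div_le_self hc.le (by linarith), ?_⟩
  have hsd : √(d : ℝ) ≤ d := by
    rw [Real.sqrt_le_left (by positivity)]; nlinarith
  rw [← mul_div_assoc, div_le_one h0]
  calc √(d : ℝ) * c ≤ d * 1 := by gcongr
    _ ≤ _ := by linarith

/-- The cost of a good run is bounded as long as at most `K` episodes are completed. -/
theorem SSP.GoodRun.regret_le
    (h : M.GoodRun φ θ G (M.cmin / (150 * (d : ℝ) ^ 3 * K)) δ b x w B τ) (hM : M.LinearOp φ θ G)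
    (hd : 2 ≤ d) (hK : 2 ≤ K) (hδ : 0 < δ) (hδ1 : δ < 1) (hb : 1 ≤ b) (hcmin : 0 < M.cmin)
    (hcmin1 : M.cmin ≤ 1) (hvb : (M.Vstar M.init).toReal ≤ b) (n : ℕ)
    (hown : M.OwnGood φ δ b x w B n) (hn : x.episodes n ≤ K) :
    ∑ i ∈ Finset.range n, x.cost i ≤ x.episodes n * (M.Vstar M.init).toReal +
      10 ^ 15 * 120 ^ 5 * Real.log (d * b * K / (M.cmin * δ)) ^ 5 *
        (d ^ 3 * √d * b * √K + d ^ 7 * b ^ 2) := by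
  classical
  have hd2 : (2 : ℝ) ≤ d := by exact_mod_cast hd
  have hK2 : (2 : ℝ) ≤ K := by exact_mod_cast hK
  obtain ⟨he, hec, hed⟩ := accuracy_bounds (c := M.cmin) hd hK hcmin hcmin1
  have hcost : ∀ i, M.cmin ≤ x.cost i := fun i => by rw [h.cost_eq]; exact M.cmin_le_cost _ _
  have hX := h.sum_abs_gap_le hM hd he hed hδ hδ1 (fun i => hec.trans (hcost i)) n
  have hN := h.card_lazy_le hM hd he n
  have hR := h.cost_le hM hδ hδ1 hvb (fun i => hcmin.le.trans (hcost i)) n hown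
  have he1 := hec.trans hcmin1
  have hWb := potentialBound_le (n := n) hd he he1 hδ hδ1 hb
  have hlb := ownLevel_le (n := n) hd he he1 hδ hδ1 hb
  have hW1 := one_le_potentialBound (n := n) hd he
  have hl1 := one_le_ownLevel hδ hδ1 n
  have hL1 := one_le_log_logArg (n := n) hd he he1 hδ hδ1 (by linarith : 1 ≤ 2 * b)
  have hI12 := twelve_le_iota (n := n) hd he hed hδ hδ1 (by linarith : 1 ≤ 2 * b)
  have hIeq := iota_eq d (M.cmin / (150 * (d : ℝ) ^ 3 * K)) δ (2 * b) (n + 1)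
  have hZ : logArg d (M.cmin / (150 * (d : ℝ) ^ 3 * K)) δ (2 * b) (n + 1) =
      14400 * d ^ 4 * b * K * (n + 1) / (M.cmin * δ) := by
    unfold logArg
    field_simp
    ring
  have hnC : n * M.cmin ≤ ∑ i ∈ Finset.range n, x.cost i := by
    have := Finset.sum_le_sum fun i (_ : i ∈ Finset.range n) => hcost i
    rwa [Finset.sum_const, Finset.card_range, nsmul_eq_mul] at this
  have hen : M.cmin / (150 * (d : ℝ) ^ 3 * K) * n * (150 * d ^ 3 * K) ≤
      ∑ i ∈ Finset.range n, x.cost i := by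
    refine le_trans (le_of_eq ?_) hnC
    field_simp
  have hv0 : 0 ≤ (M.Vstar M.init).toReal := ENNReal.toReal_nonneg
  have hepK : (x.episodes n : ℝ) ≤ K := by exact_mod_cast hn
  have hep : x.episodes n * (M.Vstar M.init).toReal ≤ K * b := by gcongr
  have hsq : √(x.episodes n * ownLevel δ n) ≤ √(K * ownLevel δ n) := by gcongr
  set C := ∑ i ∈ Finset.range n, x.cost i
  set L := Real.log (logArg d (M.cmin / (150 * (d : ℝ) ^ 3 * K)) δ (2 * b) (n + 1)) with hL
  set I := iota d (M.cmin / (150 * (d : ℝ) ^ 3 * K)) δ (2 * b) (n + 1)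
  set W := potentialBound d n (M.cmin / (150 * (d : ℝ) ^ 3 * K))
  set R := C - x.episodes n * (M.Vstar M.init).toReal with hRdef
  have hlI : ownLevel δ n ≤ I := by
    rw [hIeq]
    nlinarith
  have hmain : R ≤ 10 ^ 15 * L ^ 5 * (d ^ 3 * √d * b * √K + d ^ 7 * b ^ 2) := by
    rcases le_total R 0 with h0 | h0
    · exact h0.trans (by positivity)
    · refine regret_log hd hb hK2 hL1 hIeq hW1 hWb ?_
      refine regret_solve (C := C) (l := ownLevel δ n)
        (en := M.cmin / (150 * (d : ℝ) ^ 3 * K) * n) hd hb hI12 hW1 hK2 h0 (by linarith) hl1 hlI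
        hen ?_
      refine hR.trans ?_
      have e1 : 24 * b * (1 + ∑ i ∈ Finset.range n,
          (if x.LazyOnly φ (M.cmin / (150 * (d : ℝ) ^ 3 * K)) i (τ i) (w i) (B i)
            then (1 : ℝ) else 0)) ≤ 24 * b * (1 + W) := by gcongr
      have e2 : 24 * b * √(x.episodes n * ownLevel δ n) ≤ 24 * b * √(K * ownLevel δ n) := by gcongr
      linarith
  -- Until here the logarithm contains the number of steps. It is eliminated using `n cmin ≤ C` and
  -- the bound on `C` just obtained.
  have hLΛ := log_le_of_regret (N := n) hd hb hK2 hL1 hcmin hcmin1 hδ hδ1 (Nat.cast_nonneg n)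
    (by rw [hL, hZ]) (by linarith)
  have hfin : 10 ^ 15 * L ^ 5 * (d ^ 3 * √d * b * √K + d ^ 7 * b ^ 2) ≤
      10 ^ 15 * (120 * Real.log (d * b * K / (M.cmin * δ))) ^ 5 *
        (d ^ 3 * √d * b * √K + d ^ 7 * b ^ 2) := by gcongr
  rw [mul_pow] at hfin
  linarith

theorem Trajectory.episodes_succ_le {S A : Type*} (x : Trajectory S A) (n : ℕ) :
    x.episodes (n + 1) ≤ x.episodes n + 1 := by
  classical
  have h1 := x.cast_episodes (n + 1)
  rw [Finset.sum_range_succ, ← x.cast_episodes n] at h1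
  have h2 : (if x.next n = none then (1 : ℝ) else 0) ≤ 1 := by split_ifs <;> norm_num
  have h3 : (x.episodes (n + 1) : ℝ) ≤ ((x.episodes n + 1 : ℕ) : ℝ) := by push_cast; linarith
  exact_mod_cast h3

/-- The episode count rises by at most one per step, so missing `K` means staying below `K` forever;
then the total cost is bounded while each step costs at least `c`, a contradiction. -/
theorem Trajectory.exists_episodes_eq {S A : Type*} (x : Trajectory S A) {c D : ℝ} (hc : 0 < c)
    (hcost : ∀ i, c ≤ x.cost i)
    (h : ∀ n, x.episodes n ≤ K → ∑ i ∈ Finset.range n, x.cost i ≤ D) :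
    ∃ n, x.episodes n = K := by
  by_contra hne
  push Not at hne
  have hle : ∀ n, x.episodes n ≤ K := by
    intro n
    induction n with
    | zero => simp [Trajectory.episodes]
    | succ n ih =>
      have h1 := x.episodes_succ_le n
      have h2 := hne n
      omega
  obtain ⟨n, hn⟩ := exists_nat_gt (D / c)
  have h1 := Finset.sum_le_sum fun i (_ : i ∈ Finset.range n) => hcost i
  rw [Finset.sum_const, Finset.card_range, nsmul_eq_mul] at h1
  rw [div_lt_iff₀ hc] at hn
  linarith [h n (hle n)]

theorem SSP.GoodRun.regret_le_of_own
    (h : M.GoodRun φ θ G (M.cmin / (150 * (d : ℝ) ^ 3 * K)) δ b x w B τ) (hM : M.LinearOp φ θ G)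
    (hd : 2 ≤ d) (hK : 2 ≤ K) (hδ : 0 < δ) (hδ1 : δ < 1) (hb : 1 ≤ b) (hcmin : 0 < M.cmin)
    (hvb : (M.Vstar M.init).toReal ≤ b) (hown : ∀ n, M.OwnGood φ δ b x w B n) :
    M.regret K x ≤ ((10 ^ 15 * 120 ^ 5 * Real.log (d * b * K / (M.cmin * δ)) ^ 5 *
        ((d : ℝ) ^ (7 / 2 : ℝ) * b * √K + (d : ℝ) ^ 7 * b ^ 2) : ℝ) : EReal) := by
  obtain ⟨a⟩ := ‹Nonempty A›
  have hcmin1 : M.cmin ≤ 1 := (M.cmin_le_cost M.init a).trans (M.cost_le_one M.init a)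
  have hd0 : (0 : ℝ) < d := by exact_mod_cast (by omega : 0 < d)
  have hpow : (d : ℝ) ^ (7 / 2 : ℝ) = d ^ 3 * √d := by
    rw [Real.sqrt_eq_rpow, ← Real.rpow_natCast, ← Real.rpow_add hd0]
    norm_num
  rw [hpow]
  have hreg := fun n => h.regret_le hM hd hK hδ hδ1 hb hcmin hcmin1 hvb n (hown n)
  have hex : ∃ n, x.episodes n = K := by
    refine x.exists_episodes_eq hcmin (fun i => ?_) (fun n hn => (hreg n hn).trans
      (add_le_add_left (mul_le_mul_of_nonneg_right (Nat.cast_le.2 hn) ENNReal.toReal_nonneg) _))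
    rw [h.cost_eq]; exact M.cmin_le_cost _ _
  unfold SSP.regret
  rw [dif_pos hex, EReal.coe_le_coe_iff]
  have hspec := Nat.find_spec hex
  have := hreg (Nat.find hex) hspec.le
  rw [hspec] at this
  linarith

end Final

end LinearSSP

theorem mainTheorem2 :
    ∃ (C : ℝ) (p : ℕ), 0 < C ∧
      ∀ (S : Type u) (A : Type v) [MeasurableSpace S] [MeasurableSpace A]
        [MeasurableSingletonClass A] [Finite A]
        (M : LinearSSP.SSP S A) (d : ℕ) (φ : S → A → EuclideanSpace ℝ (Fin d))
        (K : ℕ) (δ : ℝ)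
        (Ω : Type w) [mΩ : MeasurableSpace Ω] (Pr : Measure Ω) [IsProbabilityMeasure Pr]
        (ℱ : Filtration ℕ mΩ) (a : ℕ → Ω → A) (y : ℕ → Ω → Option S)
        (wt : ℕ → Ω → EuclideanSpace ℝ (Fin d)) (Bt : ℕ → Ω → ℝ),
        2 ≤ d → 2 ≤ K → 0 < δ → δ < 1 →
        M.IsLinear φ → 0 < M.cmin →
        (∃ π, M.IsProper π) → M.Bstar ≠ ⊤ → 1 < M.Bstar →
        M.IsInteraction φ (M.cmin / (150 * (d : ℝ) ^ 3 * K)) δ Pr ℱ a y wt Bt →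
        1 - δ ≤ Pr.real {ω |
          M.regret K (M.trajectory (a · ω) (y · ω)) ≤
            ((C * Real.log (d * M.Bstar.toReal * K / (M.cmin * δ)) ^ p *
              ((d : ℝ) ^ (7 / 2 : ℝ) * M.Bstar.toReal * √K +
                (d : ℝ) ^ 7 * M.Bstar.toReal ^ 2) : ℝ) : EReal)} := by
  refine ⟨10 ^ 15 * 120 ^ 5, 5, by norm_num, ?_⟩
  intro S A _ _ _ _ M d φ K δ Ω mΩ Pr _ ℱ a y wt Bt hd hK hδ hδ1 hlin hcmin hproper hBt hB1 hint
  obtain ⟨π, -⟩ := hproper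
  have : Nonempty A := ⟨π M.init⟩
  obtain ⟨θ, G, hM⟩ := hlin.exists_linearOp
  have hcmin1 : M.cmin ≤ 1 :=
    (M.cmin_le_cost M.init (π M.init)).trans (M.cost_le_one M.init (π M.init))
  obtain ⟨he, hec, hed⟩ := LinearSSP.accuracy_bounds (c := M.cmin) hd hK hcmin hcmin1
  have hb1 : 1 ≤ M.Bstar.toReal := by
    rw [← ENNReal.toReal_one]
    exact ENNReal.toReal_mono hBt hB1.le
  have hnet := hM.measure_exists_not_netGood_le hint hd he (hec.trans hcmin1) hδ hδ1
  have hown := hM.measure_exists_not_ownGood_le hint hδ hδ1 hb1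
  set good : Set Ω := {ω |
    M.regret K (M.trajectory (a · ω) (y · ω)) ≤
      ((10 ^ 15 * 120 ^ 5 * Real.log (d * M.Bstar.toReal * K / (M.cmin * δ)) ^ 5 *
        ((d : ℝ) ^ (7 / 2 : ℝ) * M.Bstar.toReal * √K +
          (d : ℝ) ^ 7 * M.Bstar.toReal ^ 2) : ℝ) : EReal)} with hgood
  have hbad : Pr goodᶜ ≤ ENNReal.ofReal δ := by
    have hrun := hint.isRun
    rw [ae_iff] at hrun
    have h1 := LinearSSP.measure_le_add_of_imp (s := goodᶜ) (LinearSSP.measure_le_add_of_imp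
      (s := _ ∪ _) hnet hown fun ω hω => hω) hrun.le ?_
    · refine h1.trans (le_of_eq ?_)
      rw [add_zero, ← ENNReal.ofReal_add (by linarith) (by linarith), add_halves]
    · intro ω hω
      by_contra hnot
      rw [not_or, Set.mem_union, not_or] at hnot
      simp only [Set.mem_ofPred_eq, not_not] at hnot
      obtain ⟨⟨hn, ho⟩, hr⟩ := hnot
      obtain ⟨τ, hτ⟩ := hM.exists_goodRun hd he hed hδ hδ1 hBt hb1 hn hr
      refine hω (hτ.regret_le_of_own hM hd hK hδ hδ1 hb1 hcmin
        (LinearSSP.SSP.toReal_Vstar_le hBt _) fun n => ?_)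
      -- On a good run the estimates already lie in `[1, 2 B⋆]`, so the truncation made for the
      -- martingale argument is the identity.
      have htr : (fun i => LinearSSP.truncEstimate M.Bstar.toReal (Bt i ω)) = (Bt · ω) := by
        funext i
        exact if_pos ⟨by linarith [hτ.one_le i], hτ.le_two_mul i⟩
      have := ho n
      rwa [htr] at this
  -- Subadditivity on the good set and its complement suffices; measurability of the good set is not
  -- required.
  have huniv : (1 : ℝ≥0∞) ≤ Pr good + ENNReal.ofReal δ := by
    calc (1 : ℝ≥0∞) = Pr (good ∪ goodᶜ) := by rw [Set.union_compl_self, measure_univ]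
      _ ≤ Pr good + Pr goodᶜ := measure_union_le _ _
      _ ≤ _ := by gcongr
  have h2 := ENNReal.toReal_mono (by finiteness) huniv
  rw [ENNReal.toReal_add (by finiteness) (by finiteness), ENNReal.toReal_ofReal hδ.le,
    ENNReal.toReal_one] at h2
  change 1 - δ ≤ (Pr good).toReal
  linarith
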